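/- Let $(M^m,g_M)$ be a closed smooth Riemannian manifold, let $n\ge 1$ and $m+n\ge 3$, and let $(N,g)=(M\times\mathbf R^n,\,g_M+g_E)$, where $g_E$ is the Euclidean metric. Put $a=\frac{4(m+n-1)}{m+n-2}$ and $p=\frac{2(m+n)}{m+n-2}$. Let $L_1^2(N)$ be the Sobolev space of the functions in $L^2(N)$ whose weak gradient is in $L^2$. For $2\le s\le p$ and $u\in L_1^2(N)$, $u\ne 0$, let $$Q_s(u)=\frac{a\int_N|\nabla u|^2\,dV_g+\int_N S_g u^2\,dV_g}{\left(\int_N |u|^s\,dV_g\right)^{2/s}},$$ where $S_g$ is the scalar curvature of $(N,g)$. For a measurable set $U\subset N$ let $U^*$ be its Steiner symmetrization with respect to $M$: the fibre of $U^*$ over $x\in M$ is the open ball in $\mathbf R^n$ centred at $0$ with the same Lebesgue measure as the fibre of $U$ over $x$ (all of $\mathbf R^n$ if this measure is infinite; if it is zero, $\{0\}$ or $\emptyset$ according to whether the fibre of $U$ is nonempty or empty). For $u:N\to\mathbf R$ with $u\ge 0$ almost everywhere let $u^*(q)=\sup\{c\in\mathbf R : q\in\{u>c\}^*\}$. (1)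 If $u\in L_1^2(N)$, $u\ge 0$ almost everywhere and $u\ne 0$, then $u^*\in L_1^2(N)$, $u^*\ge 0$ almost everywhere, $u^*\neq 0$, and $Q_s(u^*)\le Q_s(u)$. (2) Consequently a minimizer can be taken nonnegative and radial in the $\mathbf R^n$ variable: if $u$ minimizes $Q_s$ among the nonzero functions of $L_1^2(N)$ (for $s=p$, if $u$ is a Yamabe minimizer), then so does $|u|^*$, which is nonnegative almost everywhere and whose value at $(x,y)\in M\times\mathbf R^n$ depends only on $x$ and $|y|$. -/

import Mathlib

open MeasureTheory Bundle
open scoped Manifold ContDiff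

/- Euclidean spaces carry their standard chart, the identity. -/
attribute [local instance 2000] chartedSpaceSelf

noncomputable section

/-! ## Riemannian geometry in the charts of a manifold

Throughout, `N` is a manifold modelled on the finite-dimensional space `E` through `I`, the
basis `b` of `E` provides the coordinates in each chart, and a metric `g` is given by its scalar
products `g q` on the tangent spaces `T_q N`. -/

/-- A field of (scalar) products on the tangent spaces of `N`. -/
abbrev MetricField {E : Type*} [NormedAddCommGroup E] [NormedSpace ℝ E] {H : Type*}
    [TopologicalSpace H] (I : ModelWithCorners ℝ E H) (N : Type*) [TopologicalSpace N]
    [ChartedSpace H N] : Type _ :=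
  ∀ q : N, TangentSpace I q → TangentSpace I q → ℝ

section Riemannian

variable {E : Type*} [NormedAddCommGroup E] [NormedSpace ℝ E] {H : Type*} [TopologicalSpace H]
  {I : ModelWithCorners ℝ E H} {N : Type*} [TopologicalSpace N] [ChartedSpace H N]
  {ι : Type*} [Fintype ι] [DecidableEq ι]

/-- The coordinate vector field `∂_i` of the chart at `p`, at the point with coordinates `z`. -/
def coordVec (I : ModelWithCorners ℝ E H) (b : Module.Basis ι ℝ E) (p : N) (z : E) (i : ι) :
    TangentSpace I ((extChartAt I p).symm z) :=
  mfderiv 𝓘(ℝ, E) I (extChartAt I p).symm z (b i)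

/-- The matrix `g_ij = g(∂_i, ∂_j)` of the metric in the chart at `p`, as a function of the
coordinates `z`. -/
def gramMatrix (g : MetricField I N) (b : Module.Basis ι ℝ E) (p : N) (z : E) : Matrix ι ι ℝ :=
  Matrix.of fun i j => g ((extChartAt I p).symm z) (coordVec I b p z i) (coordVec I b p z j)

/-- The partial derivative `∂_i f` with respect to the coordinates given by `b`. -/
def partialD (b : Module.Basis ι ℝ E) (i : ι) (f : E → ℝ) (z : E) : ℝ :=
  fderiv ℝ f z (b i)

/-- The Christoffel symbol `Γ^k_{ij}` of a matrix function `G = (g_ij)`, that is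
`(1/2) g^{kl} (∂_i g_{jl} + ∂_j g_{il} - ∂_l g_{ij})`, summed over `l`. -/
def christoffel (b : Module.Basis ι ℝ E) (G : E → Matrix ι ι ℝ) (k i j : ι) (z : E) : ℝ :=
  (1 / 2) * ∑ l, (G z)⁻¹ k l *
    (partialD b i (fun w => G w j l) z + partialD b j (fun w => G w i l) z
      - partialD b l (fun w => G w i j) z)

/-- The Ricci curvature `R_{jk}` of a matrix function `G = (g_ij)`, that is
`∂_i Γ^i_{jk} - ∂_j Γ^i_{ik} + Γ^i_{il} Γ^l_{jk} - Γ^i_{jl} Γ^l_{ik}`, summed over `i` and `l`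
(the sign for which round spheres have positive curvature). -/
def ricciCoord (b : Module.Basis ι ℝ E) (G : E → Matrix ι ι ℝ) (j k : ι) (z : E) : ℝ :=
  ∑ i, (partialD b i (christoffel b G i j k) z - partialD b j (christoffel b G i i k) z
    + ∑ l, (christoffel b G i i l z * christoffel b G l j k z
      - christoffel b G i j l z * christoffel b G l i k z))

/-- The scalar curvature `S_g(q) = g^{jk} R_{jk}`, computed in the chart at `q`. -/
def scalarCurvature (g : MetricField I N) (b : Module.Basis ι ℝ E) (q : N) : ℝ :=
  ∑ j, ∑ k, (gramMatrix g b q (extChartAt I q q))⁻¹ j k *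
    ricciCoord b (gramMatrix g b q) j k (extChartAt I q q)

variable [FiniteDimensional ℝ E] [MeasurableSpace E] [BorelSpace E] [MeasurableSpace N]

/-- The measure `√det(g_ij) dz` on the domain of the chart at `p`. -/
def chartVolume (g : MetricField I N) (b : Module.Basis ι ℝ E) (p : N) : Measure N :=
  (((b.addHaar).restrict (extChartAt I p).target).withDensity
    fun z => ENNReal.ofReal (Real.sqrt (gramMatrix g b p z).det)).map (extChartAt I p).symm

/-- The Riemannian volume `dV_g`. The measures `√det(g_ij) dz` agree on the overlaps of the
charts, and `dV_g`, the measure which restricts to each of them, is their supremum. -/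
def riemannianVolume (g : MetricField I N) (b : Module.Basis ι ℝ E) : Measure N :=
  ⨆ p : N, chartVolume g b p

/-- The vector field `X` is the weak gradient of `u`: in the chart at any point, `u` and the
components `g(X, ∂_i)` are locally integrable, and `g(X, ∂_i)` is the `i`-th weak partial
derivative of `u`. -/
def HasWeakGradient (g : MetricField I N) (b : Module.Basis ι ℝ E) (u : N → ℝ)
    (X : ∀ q : N, TangentSpace I q) : Prop :=
  ∀ p : N,
    LocallyIntegrableOn (fun z => u ((extChartAt I p).symm z)) (extChartAt I p).target
      b.addHaar ∧
    ∀ i : ι,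
      LocallyIntegrableOn
        (fun z => g ((extChartAt I p).symm z) (X ((extChartAt I p).symm z)) (coordVec I b p z i))
        (extChartAt I p).target b.addHaar ∧
      ∀ ψ : E → ℝ, ContDiff ℝ ∞ ψ → HasCompactSupport ψ → tsupport ψ ⊆ (extChartAt I p).target →
        ∫ z, u ((extChartAt I p).symm z) * partialD b i ψ z ∂b.addHaar =
          - ∫ z, g ((extChartAt I p).symm z) (X ((extChartAt I p).symm z)) (coordVec I b p z i)
              * ψ z ∂b.addHaar

/-- The Sobolev space `L_1^2(N)`: `u ∈ L^2` with a weak gradient in `L^2`. -/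
def MemSobolev (g : MetricField I N) (b : Module.Basis ι ℝ E) (u : N → ℝ) : Prop :=
  MemLp u 2 (riemannianVolume g b) ∧
    ∃ X : ∀ q : N, TangentSpace I q, HasWeakGradient g b u X ∧
      Integrable (fun q => g q (X q) (X q)) (riemannianVolume g b)

open Classical in
/-- The weak gradient `∇u`, which is unique almost everywhere (and `0` if there is none). -/
def weakGradient (g : MetricField I N) (b : Module.Basis ι ℝ E) (u : N → ℝ) :
    ∀ q : N, TangentSpace I q :=
  if h : ∃ X : ∀ q : N, TangentSpace I q, HasWeakGradient g b u X then h.choose else fun _ => 0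

/-- The quotient `(a ∫ |∇u|² + ∫ S_g u²) / (∫ |u|^s)^{2/s}`. -/
def yamabeQuotient (g : MetricField I N) (b : Module.Basis ι ℝ E) (a s : ℝ) (u : N → ℝ) : ℝ :=
  (a * ∫ q, g q (weakGradient g b u q) (weakGradient g b u q) ∂riemannianVolume g b
      + ∫ q, scalarCurvature g b q * u q ^ 2 ∂riemannianVolume g b)
    / (∫ q, |u q| ^ s ∂riemannianVolume g b) ^ (2 / s)

/-- `u` attains the infimum of the quotient over all the nonzero functions in `L_1^2(N)`. -/
def IsYamabeMinimizer (g : MetricField I N) (b : Module.Basis ι ℝ E) (a s : ℝ) (u : N → ℝ) :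
    Prop :=
  MemSobolev g b u ∧ ¬ u =ᵐ[riemannianVolume g b] 0 ∧
    ∀ v : N → ℝ, MemSobolev g b v → ¬ v =ᵐ[riemannianVolume g b] 0 →
      yamabeQuotient g b a s u ≤ yamabeQuotient g b a s v

end Riemannian

/-! ## The product `M × ℝⁿ` -/

/-- The product metric `g_M + g_E` on `M × ℝⁿ`. -/
def productMetric {m n : ℕ} {M : Type*} [TopologicalSpace M]
    [ChartedSpace (EuclideanSpace ℝ (Fin m)) M] (gM : MetricField (𝓡 m) M) :
    MetricField ((𝓡 m).prod (𝓡 n)) (M × EuclideanSpace ℝ (Fin n)) :=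
  fun q (v w : EuclideanSpace ℝ (Fin m) × EuclideanSpace ℝ (Fin n)) =>
    gM q.1 v.1 w.1 + inner ℝ v.2 w.2

/-- The standard basis of `ℝᵐ × ℝⁿ`. -/
def stdBasis (m n : ℕ) :
    Module.Basis (Fin m ⊕ Fin n) ℝ (EuclideanSpace ℝ (Fin m) × EuclideanSpace ℝ (Fin n)) :=
  (EuclideanSpace.basisFun (Fin m) ℝ).toBasis.prod (EuclideanSpace.basisFun (Fin n) ℝ).toBasis

/-! ## Steiner symmetrization with respect to `M` -/

/-- The Steiner symmetrization `U^*`. If the fibre of `U` over `x` has positive measure, then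
the fibre of `U^*` over `x` is the open ball centred at `0` of the same measure (all of `ℝⁿ`, if
that measure is infinite). If it has measure zero, then the fibre of `U^*` is `{0}` or empty,
according to whether the fibre of `U` is nonempty or empty. -/
def steinerSet {M : Type*} {n : ℕ} (U : Set (M × EuclideanSpace ℝ (Fin n))) :
    Set (M × EuclideanSpace ℝ (Fin n)) :=
  {q | (0 < volume (Prod.mk q.1 ⁻¹' U) ∧
          (volume (Prod.mk q.1 ⁻¹' U) = ⊤ ∨
            ∃ ρ : ℝ, volume (Metric.ball (0 : EuclideanSpace ℝ (Fin n)) ρ)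
              = volume (Prod.mk q.1 ⁻¹' U) ∧ q.2 ∈ Metric.ball 0 ρ)) ∨
        (volume (Prod.mk q.1 ⁻¹' U) = 0 ∧ (Prod.mk q.1 ⁻¹' U).Nonempty ∧ q.2 = 0)}

/-- The Steiner symmetrization `u^*(q) = sup {c | q ∈ {u > c}^*}` of a function. -/
def steiner {M : Type*} {n : ℕ} (u : M × EuclideanSpace ℝ (Fin n) → ℝ) :
    M × EuclideanSpace ℝ (Fin n) → ℝ :=
  fun q => sSup {c : ℝ | q ∈ steinerSet {q' | c < u q'}}

/-- A function on `M × ℝⁿ` which is radial in the variable of `ℝⁿ`. -/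
def IsRadial {M : Type*} {n : ℕ} (u : M × EuclideanSpace ℝ (Fin n) → ℝ) : Prop :=
  ∀ (x : M) (y y' : EuclideanSpace ℝ (Fin n)), ‖y‖ = ‖y'‖ → u (x, y) = u (x, y')

end

/-!
Steiner symmetrization rearranges a function on each fibre `{x} × ℝⁿ` separately. It keeps the
distribution of the function on almost every fibre, hence all its `L^s` norms. The scalar curvature
of the product `M × ℝⁿ` depends on `x ∈ M` only (`scalarCurvature_prod`), since in charts the metric
does not depend on the coordinates of `ℝⁿ`; so `∫ S u²` is kept too (`integral_mul_steiner_sq`). What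
has to be shown is that `∫ |∇u|²` does not increase, and that the symmetrization has a weak gradient
at all.

The energy splits into derivatives along `ℝⁿ` and derivatives along `M`. For a Lipschitz function of
compact support, the former decrease by the Pólya–Szegő inequality (`polya_szego`). Its proof runs
through the sup-convolution `sup_z (f z - |z - y|² / (2t))`: the derivative of its integral at `t = 0`
is half of the energy, its superlevel sets are unions of neighbourhoods of superlevel sets of `f`,
and among the sets of given volume balls have the smallest neighbourhoods (Brunn–Minkowski, deduced
from the Prékopa–Leindler inequality). The derivatives along the base decrease because the
rearrangement is a contraction of `L²` (`lintegral_schwarz_sub_sq_le`, from the Hardy–Littlewood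
inequality), which is applied to difference quotients between fibres. Diagonalizing the quadratic
form gives the decrease for every energy `A(x)(∂_x u, ∂_x u) + c(x) |∂_y u|²` on `X × ℝⁿ`
(`lintegral_energy_steiner_le`). Sobolev functions on `X × ℝⁿ` follow by density of smooth functions,
weak compactness and weak lower semicontinuity (`exists_weak_approx_steiner`). Since symmetrization
is continuous on `L²`, the weak limits are the derivatives of the symmetrization.

On `M × ℝⁿ` the problem is local in `M`, because symmetrization commutes with multiplication by
nonnegative functions on `M`: over a small ball of a chart of `M`, a Sobolev function can be replaced
by its product with a cutoff function, to which the flat case applies with the coefficients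
`√det(g_ij) g^{ij}` (`exists_local_steiner_gradient`). The local derivatives transform by the chain
rule (`IsDiffeoOn.weakDeriv_comp`) and glue to a weak gradient (`exists_hasWeakGradient_of_charts`);
adding up the energies over a countable partition of `M` gives `exists_steiner_gradient`. As the
Riemannian volume is the product of that of `M` and Lebesgue measure (`riemannianVolume_prod`), the
statements about the other integrals hold as well, and the quotients are compared in
`yamabeQuotient_le_of_ae_eq_steiner`. There the symmetrized function is `|u|`, which covers both
parts of the theorem at once.
-/

section SteinerSymmetrization

open Filter Topology Metric
open scoped ENNReal NNReal

set_option linter.unusedSectionVars false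

/-! ### The Prékopa–Leindler and Brunn–Minkowski inequalities -/

/-- The Prékopa–Leindler inequality for the measure `μ` on a real vector space. -/
def PrekopaLeindler {E : Type*} [AddCommGroup E] [Module ℝ E] [MeasurableSpace E]
    (μ : Measure E) : Prop :=
  ∀ l : ℝ, 0 < l → l < 1 → ∀ f g h : E → ℝ≥0∞, Measurable f → Measurable g → Measurable h →
    (∀ x y, f x ^ l * g y ^ (1 - l) ≤ h (l • x + (1 - l) • y)) →
    (∫⁻ x, f x ∂μ) ^ l * (∫⁻ x, g x ∂μ) ^ (1 - l) ≤ ∫⁻ x, h x ∂μ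

/-- The Brunn–Minkowski inequality on the line. The sum of two compact sets contains a translate of
each, and the two translates share at most one point. -/
theorem brunnMinkowski_real {A B C : Set ℝ} (hA : MeasurableSet A) (hB : MeasurableSet B)
    (hA' : A.Nonempty) (hB' : B.Nonempty)
    (h : ∀ a ∈ A, ∀ b ∈ B, a + b ∈ C) : volume A + volume B ≤ volume C := by
  by_cases hA0 : volume A = 0
  · obtain ⟨a, ha⟩ := hA'
    rw [hA0, zero_add, ← measure_preimage_add volume (-a) B]
    refine measure_mono fun x hx => ?_
    have := h a ha _ hx
    simpa using this
  by_cases hB0 : volume B = 0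
  · obtain ⟨b, hb⟩ := hB'
    rw [hB0, add_zero, ← measure_preimage_add_right volume (-b) A]
    refine measure_mono fun x hx => ?_
    have := h _ hx b hb
    simpa using this
  by_contra! hlt
  obtain ⟨y, hy, z, hz, hyz⟩ := ENNReal.exists_lt_add_of_lt_add hlt hA0 hB0
  obtain ⟨K, hKA, hK, hyK⟩ := hA.exists_lt_isCompact hy
  obtain ⟨L, hLB, hL, hzL⟩ := hB.exists_lt_isCompact hz
  have hKne : K.Nonempty := nonempty_of_measure_ne_zero (bot_lt_of_lt hyK).ne'
  have hLne : L.Nonempty := nonempty_of_measure_ne_zero (bot_lt_of_lt hzL).ne'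
  -- `K + min L` and `max K + L` meet in at most one point.
  obtain ⟨k, hkK, hk⟩ := hK.exists_isGreatest hKne
  obtain ⟨l, hlL, hl⟩ := hL.exists_isLeast hLne
  have hdisj : AEDisjoint volume ((fun x => x + -l) ⁻¹' K) ((fun x => -k + x) ⁻¹' L) := by
    refine measure_mono_null (t := {k + l}) ?_ (by simp)
    rintro x ⟨h1, h2⟩
    have h1 := hk h1
    have h2 := hl h2
    simp only [Set.mem_singleton_iff]
    linarith
  have hm : volume K + volume L ≤ volume C := by
    rw [← measure_preimage_add_right volume (-l) K, ← measure_preimage_add volume (-k) L,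
      ← measure_union₀ (hL.measurableSet.preimage (by fun_prop)).nullMeasurableSet hdisj]
    refine measure_mono ?_
    rintro x (hx | hx)
    · simpa using h _ (hKA hx) l (hLB hlL)
    · simpa using h k (hKA hkK) _ (hLB hx)
  exact absurd (hyz.trans_le (add_le_add hyK.le hzL.le)) hm.not_gt

/-- The layer cake formula for a function with values in `[0, 1]`. -/
theorem lintegral_eq_lintegral_meas_lt_of_le_one {α : Type*} [MeasurableSpace α] (μ : Measure α)
    {f : α → ℝ≥0∞} (hf : Measurable f) (h1 : ∀ x, f x ≤ 1) :
    ∫⁻ x, f x ∂μ = ∫⁻ t in Set.Ioo (0 : ℝ) 1, μ {x | ENNReal.ofReal t < f x} := by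
  have hfin : ∀ x, f x ≠ ⊤ := fun x => ((h1 x).trans_lt ENNReal.one_lt_top).ne
  have h := lintegral_eq_lintegral_meas_lt μ (f := fun x => (f x).toReal)
    (Filter.Eventually.of_forall fun x => ENNReal.toReal_nonneg) hf.ennreal_toReal.aemeasurable
  simp only [ENNReal.ofReal_toReal (hfin _)] at h
  rw [h, ← Set.Ioo_union_Ici_eq_Ioi (zero_lt_one (α := ℝ)),
    lintegral_union measurableSet_Ici (Set.disjoint_left.2 fun x hx hx' => not_le.2 hx.2 hx')]
  have h0 : ∫⁻ t in Set.Ici (1 : ℝ), μ {x | t < (f x).toReal} = 0 := by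
    rw [setLIntegral_congr_fun (g := fun _ => 0) measurableSet_Ici]
    · simp
    intro t ht
    have : {x | t < (f x).toReal} = ∅ := by
      ext x
      simp only [Set.mem_ofPred_eq, Set.mem_empty_iff_false, iff_false, not_lt]
      exact (ENNReal.toReal_mono ENNReal.one_ne_top (h1 x)).trans ht
    simp [this]
  rw [h0, add_zero]
  refine setLIntegral_congr_fun measurableSet_Ioo fun t ht => ?_
  simp only [ENNReal.ofReal_lt_iff_lt_toReal ht.1.le (hfin _)]

theorem geom_mean_le_arith_mean_ennreal {l : ℝ} (h0 : 0 < l) (h1 : l < 1) (a b : ℝ≥0∞) :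
    a ^ l * b ^ (1 - l) ≤ ENNReal.ofReal l * a + ENNReal.ofReal (1 - l) * b := by
  have hl1 : 0 < 1 - l := by linarith
  by_cases ha : a = ⊤
  · have : ENNReal.ofReal l * a = ⊤ := by rw [ha, ENNReal.mul_top (by simpa using h0)]
    simp [this]
  by_cases hb : b = ⊤
  · have : ENNReal.ofReal (1 - l) * b = ⊤ := by rw [hb, ENNReal.mul_top (by simpa using h1)]
    simp [this]
  lift a to NNReal using ha
  lift b to NNReal using hb
  have := NNReal.geom_mean_le_arith_mean2_weighted (⟨l, h0.le⟩ : NNReal) ⟨1 - l, hl1.le⟩ a b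
    (NNReal.eq (by change l + (1 - l) = 1; ring))
  rw [← ENNReal.coe_rpow_of_nonneg _ h0.le, ← ENNReal.coe_rpow_of_nonneg _ hl1.le,
    ENNReal.ofReal, ENNReal.ofReal, Real.toNNReal_of_nonneg h0.le, Real.toNNReal_of_nonneg hl1.le]
  exact_mod_cast this

theorem volume_smul_real {l : ℝ} (hl : 0 < l) (A : Set ℝ) :
    volume ((fun x : ℝ => l⁻¹ * x) ⁻¹' A) = ENNReal.ofReal l * volume A := by
  rw [Real.volume_preimage_mul_left (inv_ne_zero hl.ne')]
  simp [abs_of_pos hl]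

/-- Normalized case on the line: the superlevel sets of `f` and `g` below their common supremum
`1` are nonempty, so that the one-dimensional Brunn–Minkowski inequality applies to them. -/
theorem prekopaLeindler_real_normalized {l : ℝ} (h0 : 0 < l) (h1 : l < 1) {f g h : ℝ → ℝ≥0∞}
    (hf : Measurable f) (hg : Measurable g) (hh : Measurable h)
    (hfg : ∀ x y, f x ^ l * g y ^ (1 - l) ≤ h (l • x + (1 - l) • y))
    (hf1 : ⨆ x, f x = 1) (hg1 : ⨆ x, g x = 1) :
    (∫⁻ x, f x) ^ l * (∫⁻ x, g x) ^ (1 - l) ≤ ∫⁻ x, h x := by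
  have hl1 : 0 < 1 - l := by linarith
  refine (geom_mean_le_arith_mean_ennreal h0 h1 _ _).trans ?_
  -- Truncate `h` at height `1`, so that only the levels `t < 1` matter.
  have hmin : ∫⁻ x, min (h x) 1 ≤ ∫⁻ x, h x := lintegral_mono fun x => min_le_left _ _
  refine le_trans ?_ hmin
  rw [lintegral_eq_lintegral_meas_lt_of_le_one volume hf (fun x => hf1 ▸ le_iSup f x),
    lintegral_eq_lintegral_meas_lt_of_le_one volume hg (fun x => hg1 ▸ le_iSup g x),
    lintegral_eq_lintegral_meas_lt_of_le_one volume (hh.min measurable_const)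
      (fun x => min_le_right _ _)]
  have hmono : ∀ k : ℝ → ℝ≥0∞, Measurable fun t : ℝ => volume {x | ENNReal.ofReal t < k x} := by
    intro k
    have : Antitone fun t : ℝ => volume {x | ENNReal.ofReal t < k x} := fun s t hst =>
      measure_mono fun x (hx : _ < _) => (ENNReal.ofReal_le_ofReal hst).trans_lt hx
    exact this.measurable
  rw [← lintegral_const_mul _ (hmono f), ← lintegral_const_mul _ (hmono g),
    ← lintegral_add_left ((hmono f).const_mul _)]
  refine setLIntegral_mono' measurableSet_Ioo fun t ht => ?_
  have ht1 : ENNReal.ofReal t < 1 := by simpa using ht.2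
  rw [← volume_smul_real h0, ← volume_smul_real hl1]
  refine brunnMinkowski_real ((measurableSet_lt measurable_const hf).preimage (by fun_prop))
    ((measurableSet_lt measurable_const hg).preimage (by fun_prop)) ?_ ?_ ?_
  · obtain ⟨x, hx⟩ := lt_iSup_iff.1 (hf1 ▸ ht1)
    exact ⟨l * x, by simpa [h0.ne'] using hx⟩
  · obtain ⟨x, hx⟩ := lt_iSup_iff.1 (hg1 ▸ ht1)
    exact ⟨(1 - l) * x, by simpa [hl1.ne'] using hx⟩
  · intro a ha b hb
    have ha : ENNReal.ofReal t < f (l⁻¹ * a) := ha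
    have hb : ENNReal.ofReal t < g ((1 - l)⁻¹ * b) := hb
    have hab := hfg (l⁻¹ * a) ((1 - l)⁻¹ * b)
    rw [smul_eq_mul, smul_eq_mul, mul_inv_cancel_left₀ h0.ne', mul_inv_cancel_left₀ hl1.ne'] at hab
    have ht0 : ENNReal.ofReal t ≠ 0 := by simpa using ht.1
    have htt : ENNReal.ofReal t = ENNReal.ofReal t ^ l * ENNReal.ofReal t ^ (1 - l) := by
      rw [← ENNReal.rpow_add _ _ ht0 ENNReal.ofReal_ne_top]; simp
    refine lt_min (lt_of_lt_of_le ?_ hab) ht1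
    rw [htt]
    exact ENNReal.mul_lt_mul (ENNReal.rpow_lt_rpow ha h0) (ENNReal.rpow_lt_rpow hb hl1)

/-- Bounded case on the line: each function is divided by its supremum. -/
theorem prekopaLeindler_real_bounded {l : ℝ} (h0 : 0 < l) (h1 : l < 1) {f g h : ℝ → ℝ≥0∞}
    (hf : Measurable f) (hg : Measurable g) (hh : Measurable h)
    (hfg : ∀ x y, f x ^ l * g y ^ (1 - l) ≤ h (l • x + (1 - l) • y))
    (hf1 : ⨆ x, f x ≠ ⊤) (hg1 : ⨆ x, g x ≠ ⊤) :
    (∫⁻ x, f x) ^ l * (∫⁻ x, g x) ^ (1 - l) ≤ ∫⁻ x, h x := by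
  have hl1 : 0 < 1 - l := by linarith
  set a := ⨆ x, f x with ha
  set b := ⨆ x, g x with hb
  by_cases ha0 : a = 0
  · have : f = 0 := by
      ext x; exact le_antisymm ((le_iSup f x).trans ha0.le) zero_le
    simp [this, h0]
  by_cases hb0 : b = 0
  · have : g = 0 := by
      ext x; exact le_antisymm ((le_iSup g x).trans hb0.le) zero_le
    simp [this, hl1]
  have hai : a⁻¹ ≠ ⊤ := ENNReal.inv_ne_top.2 ha0
  have hbi : b⁻¹ ≠ ⊤ := ENNReal.inv_ne_top.2 hb0
  have hc : a⁻¹ ^ l * b⁻¹ ^ (1 - l) ≠ ⊤ :=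
    ENNReal.mul_ne_top (ENNReal.rpow_ne_top_of_nonneg h0.le hai)
      (ENNReal.rpow_ne_top_of_nonneg hl1.le hbi)
  have hc0 : a⁻¹ ^ l * b⁻¹ ^ (1 - l) ≠ 0 := by
    refine mul_ne_zero ?_ ?_
    · exact (ENNReal.rpow_pos (ENNReal.inv_pos.2 hf1) hai).ne'
    · exact (ENNReal.rpow_pos (ENNReal.inv_pos.2 hg1) hbi).ne'
  have key := prekopaLeindler_real_normalized h0 h1 (f := fun x => a⁻¹ * f x)
    (g := fun x => b⁻¹ * g x) (h := fun x => a⁻¹ ^ l * b⁻¹ ^ (1 - l) * h x)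
    (hf.const_mul _) (hg.const_mul _) (hh.const_mul _) ?_ ?_ ?_
  · rw [lintegral_const_mul _ hf, lintegral_const_mul _ hg, lintegral_const_mul _ hh,
      ENNReal.mul_rpow_of_nonneg _ _ h0.le, ENNReal.mul_rpow_of_nonneg _ _ hl1.le,
      mul_mul_mul_comm] at key
    exact (ENNReal.mul_le_mul_iff_right hc0 hc).1 key
  · intro x y
    rw [ENNReal.mul_rpow_of_nonneg _ _ h0.le, ENNReal.mul_rpow_of_nonneg _ _ hl1.le,
      mul_mul_mul_comm]
    gcongr
    exact hfg x y
  · rw [← ENNReal.mul_iSup, ← ha, ENNReal.inv_mul_cancel ha0 hf1]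
  · rw [← ENNReal.mul_iSup, ← hb, ENNReal.inv_mul_cancel hb0 hg1]

theorem tendsto_lintegral_min_nat {α : Type*} [MeasurableSpace α] (μ : Measure α)
    {f : α → ℝ≥0∞} (hf : Measurable f) :
    Filter.Tendsto (fun k : ℕ => ∫⁻ x, min (f x) k ∂μ) Filter.atTop (nhds (∫⁻ x, f x ∂μ)) := by
  refine lintegral_tendsto_of_tendsto_of_monotone
    (fun k => (hf.min measurable_const).aemeasurable) ?_ ?_
  · refine Filter.Eventually.of_forall fun x i j hij => ?_
    have : (i : ℝ≥0∞) ≤ j := by exact_mod_cast hij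
    exact min_le_min le_rfl this
  · refine Filter.Eventually.of_forall fun x => ?_
    have := (tendsto_const_nhds (x := f x)).min ENNReal.tendsto_nat_nhds_top
    simpa using this

/-- The general case on the line: the functions are truncated at height `k`. -/
theorem prekopaLeindler_real : PrekopaLeindler (volume : Measure ℝ) := by
  intro l h0 h1 f g h hf hg hh hfg
  have hl1 : 0 < 1 - l := by linarith
  by_cases hf0 : ∫⁻ x, f x = 0
  · simp [hf0, h0]
  by_cases hg0 : ∫⁻ x, g x = 0
  · simp [hg0, hl1]
  have hF := (tendsto_lintegral_min_nat volume hf).ennrpow_const l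
  have hG := (tendsto_lintegral_min_nat volume hg).ennrpow_const (1 - l)
  refine le_of_tendsto (ENNReal.Tendsto.mul hF (Or.inl ?_) hG (Or.inl ?_))
    (Filter.Eventually.of_forall fun k => ?_)
  · simp [hf0, h0.not_gt]
  · simp [hg0, hl1.not_gt]
  have hb : ∀ k' : ℝ → ℝ≥0∞, ⨆ x, min (k' x) (k : ℝ≥0∞) ≠ ⊤ := fun k' =>
    ((iSup_le fun x => min_le_right _ _).trans_lt (ENNReal.natCast_lt_top k)).ne
  refine prekopaLeindler_real_bounded h0 h1 (hf.min measurable_const) (hg.min measurable_const) hh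
    (fun x y => le_trans ?_ (hfg x y)) (hb f) (hb g)
  exact mul_le_mul' (ENNReal.rpow_le_rpow (min_le_left _ _) h0.le)
    (ENNReal.rpow_le_rpow (min_le_left _ _) hl1.le)

/-- The inequality tensorizes: the inequality in the second factor is the hypothesis needed to apply
the one in the first factor to the integrals over the fibres. -/
theorem PrekopaLeindler.prod {E F : Type*} [AddCommGroup E] [Module ℝ E] [MeasurableSpace E]
    [AddCommGroup F] [Module ℝ F] [MeasurableSpace F] {μ : Measure E} {ν : Measure F} [SFinite ν]
    (hμ : PrekopaLeindler μ) (hν : PrekopaLeindler ν) : PrekopaLeindler (μ.prod ν) := by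
  intro l h0 h1 f g h hf hg hh hfg
  rw [lintegral_prod _ hf.aemeasurable, lintegral_prod _ hg.aemeasurable,
    lintegral_prod _ hh.aemeasurable]
  refine hμ l h0 h1 _ _ _ hf.lintegral_prod_right' hg.lintegral_prod_right'
    hh.lintegral_prod_right' fun x y => ?_
  exact hν l h0 h1 _ _ _ (hf.comp measurable_prodMk_left) (hg.comp measurable_prodMk_left)
    (hh.comp measurable_prodMk_left) fun x' y' => hfg (x, x') (y, y')

/-- The inequality is transported by linear measure preserving bijections. -/
theorem PrekopaLeindler.of_equiv {E F : Type*} [AddCommGroup E] [Module ℝ E] [MeasurableSpace E]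
    [AddCommGroup F] [Module ℝ F] [MeasurableSpace F] {μ : Measure E} {ν : Measure F}
    (hμ : PrekopaLeindler μ) (e : E ≃ᵐ F) (he : MeasurePreserving e μ ν)
    (hlin : ∀ (a b : ℝ) (x y : E), e (a • x + b • y) = a • e x + b • e y) :
    PrekopaLeindler ν := by
  intro l h0 h1 f g h hf hg hh hfg
  rw [← he.lintegral_comp hf, ← he.lintegral_comp hg, ← he.lintegral_comp hh]
  refine hμ l h0 h1 _ _ _ (hf.comp e.measurable) (hg.comp e.measurable) (hh.comp e.measurable)
    fun x y => ?_
  simpa [hlin] using hfg (e x) (e y)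

theorem prekopaLeindler_pi (n : ℕ) : PrekopaLeindler (volume : Measure (Fin n → ℝ)) := by
  induction n with
  | zero =>
    intro l h0 h1 f g h hf hg hh hfg
    rw [volume_pi, Measure.pi_of_empty _ 0]
    simp only [lintegral_dirac]
    convert hfg 0 0 using 2
  | succ n ih =>
    refine PrekopaLeindler.of_equiv (μ := (volume : Measure ℝ).prod (volume : Measure (Fin n → ℝ)))
      (prekopaLeindler_real.prod ih)
      (MeasurableEquiv.piFinSuccAbove (fun _ => ℝ) 0).symm
      (volume_preserving_piFinSuccAbove (fun _ => ℝ) 0).symm ?_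
    intro a b x y
    ext i
    refine Fin.cases ?_ (fun i => ?_) i <;>
      simp [MeasurableEquiv.piFinSuccAbove, Fin.insertNthEquiv]

theorem prekopaLeindler_euclidean (n : ℕ) :
    PrekopaLeindler (volume : Measure (EuclideanSpace ℝ (Fin n))) :=
  (prekopaLeindler_pi n).of_equiv (MeasurableEquiv.toLp 2 (Fin n → ℝ))
    (EuclideanSpace.volume_preserving_symm_measurableEquiv_toLp (Fin n)).symm fun _ _ _ _ => rfl

open Metric in
/-- The Brunn–Minkowski inequality for a set and a ball: among the sets of given measure, balls
have the smallest neighbourhoods. -/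
theorem volume_ball_add_le_volume_thickening {n : ℕ} {A : Set (EuclideanSpace ℝ (Fin n))}
    (hA : MeasurableSet A) (hA' : A.Nonempty) {ρ r : ℝ} (hρ : 0 ≤ ρ) (hr : 0 < r)
    (h : volume (ball (0 : EuclideanSpace ℝ (Fin n)) ρ) ≤ volume A) :
    volume (ball (0 : EuclideanSpace ℝ (Fin n)) (ρ + r)) ≤ volume (thickening r A) := by
  rcases hρ.eq_or_lt with rfl | hρ
  · obtain ⟨a, ha⟩ := hA'
    rw [zero_add, Measure.addHaar_ball_center volume (0 : EuclideanSpace ℝ (Fin n)) r,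
      ← Measure.addHaar_ball_center volume a r]
    exact measure_mono (ball_subset_thickening ha r)
  have hs : 0 < ρ + r := by linarith
  set l := ρ / (ρ + r) with hl
  have h0 : 0 < l := by positivity
  have hl1' : 1 - l = r / (ρ + r) := by rw [hl]; field_simp; ring
  have hl1 : 0 < 1 - l := by rw [hl1']; positivity
  have h1 : l < 1 := by linarith
  set A' : Set (EuclideanSpace ℝ (Fin n)) := (fun x => l • x) ⁻¹' A with hA'
  have hvA : volume (ball (0 : EuclideanSpace ℝ (Fin n)) (ρ + r)) ≤ volume A' := by
    have e1 : ball (0 : EuclideanSpace ℝ (Fin n)) (ρ + r) = (fun x => l • x) ⁻¹' ball 0 ρ := by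
      ext x
      simp only [mem_ball_zero_iff, Set.mem_preimage, norm_smul, Real.norm_eq_abs, abs_of_pos h0]
      rw [hl, div_mul_eq_mul_div, div_lt_iff₀ hs, mul_comm, mul_comm ρ, mul_lt_mul_iff_left₀ hρ]
    rw [e1, hA', Measure.addHaar_preimage_smul _ h0.ne', Measure.addHaar_preimage_smul _ h0.ne']
    gcongr
  have key := prekopaLeindler_euclidean n l h0 h1 (A'.indicator 1)
    ((ball (0 : EuclideanSpace ℝ (Fin n)) (ρ + r)).indicator 1) ((thickening r A).indicator 1)
    (measurable_one.indicator (hA.preimage (by fun_prop)))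
    (measurable_one.indicator measurableSet_ball)
    (measurable_one.indicator isOpen_thickening.measurableSet) ?_
  · rw [lintegral_indicator_one (hA.preimage (by fun_prop)),
      lintegral_indicator_one measurableSet_ball,
      lintegral_indicator_one isOpen_thickening.measurableSet] at key
    refine le_trans ?_ key
    set v := volume (ball (0 : EuclideanSpace ℝ (Fin n)) (ρ + r)) with hv
    have hv0 : v ≠ 0 := (measure_ball_pos _ _ hs).ne'
    have hvt : v ≠ ⊤ := measure_ball_lt_top.ne
    calc v = v ^ l * v ^ (1 - l) := by rw [← ENNReal.rpow_add _ _ hv0 hvt]; simp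
      _ ≤ _ := by gcongr
  · intro x y
    by_cases hx : x ∈ A'
    · by_cases hy : y ∈ ball (0 : EuclideanSpace ℝ (Fin n)) (ρ + r)
      · have : l • x + (1 - l) • y ∈ thickening r A := by
          rw [mem_thickening_iff]
          refine ⟨l • x, hx, ?_⟩
          rw [dist_eq_norm, add_sub_cancel_left, norm_smul, Real.norm_eq_abs, abs_of_pos hl1, hl1',
            div_mul_eq_mul_div, div_lt_iff₀ hs]
          exact mul_lt_mul_of_pos_left (by simpa using hy) hr
        simp [hx, hy, this]
      · simp [hy, hl1]
    · simp [hx, h0]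

/-! ### The symmetric decreasing rearrangement on `ℝⁿ` -/

theorem volume_ball_lt_volume_ball {n : ℕ} (hn : 1 ≤ n) {r s : ℝ} (hr : 0 ≤ r) (hrs : r < s) :
    volume (ball (0 : EuclideanSpace ℝ (Fin n)) r)
      < volume (ball (0 : EuclideanSpace ℝ (Fin n)) s) := by
  have : Nonempty (Fin n) := ⟨⟨0, hn⟩⟩
  rw [Measure.addHaar_ball volume _ hr, Measure.addHaar_ball volume _ (hr.trans hrs.le)]
  refine ENNReal.mul_lt_mul_left (measure_ball_pos _ _ one_pos).ne' measure_ball_lt_top.ne ?_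
  rw [finrank_euclideanSpace_fin]
  exact (ENNReal.ofReal_lt_ofReal_iff (pow_pos (hr.trans_lt hrs) n)).2
    (pow_lt_pow_left₀ hrs hr (by omega))

theorem volume_ball_lt_volume_ball_iff {n : ℕ} (hn : 1 ≤ n) {r s : ℝ} (hr : 0 ≤ r) :
    volume (ball (0 : EuclideanSpace ℝ (Fin n)) r)
      < volume (ball (0 : EuclideanSpace ℝ (Fin n)) s) ↔ r < s := by
  refine ⟨fun h => ?_, volume_ball_lt_volume_ball hn hr⟩
  by_contra! hsr
  exact absurd h (measure_mono (ball_subset_ball hsr)).not_gt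

theorem exists_volume_ball_eq {n : ℕ} (hn : 1 ≤ n) {V : ℝ≥0∞} (hV : V ≠ ⊤) :
    ∃ ρ : ℝ, 0 ≤ ρ ∧ volume (ball (0 : EuclideanSpace ℝ (Fin n)) ρ) = V := by
  set w := volume (ball (0 : EuclideanSpace ℝ (Fin n)) 1) with hw
  have hw0 : w ≠ 0 := (measure_ball_pos _ _ one_pos).ne'
  have hwt : w ≠ ⊤ := measure_ball_lt_top.ne
  have : Nonempty (Fin n) := ⟨⟨0, hn⟩⟩
  refine ⟨((V / w).toReal) ^ ((n : ℝ)⁻¹), by positivity, ?_⟩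
  rw [Measure.addHaar_ball volume _ (by positivity), finrank_euclideanSpace_fin,
    Real.rpow_inv_natCast_pow ENNReal.toReal_nonneg (by omega),
    ENNReal.ofReal_toReal (ENNReal.div_ne_top hV hw0), ENNReal.div_mul_cancel hw0 hwt]

theorem volume_ball_norm_pos {n : ℕ} {y : EuclideanSpace ℝ (Fin n)} (hy : y ≠ 0) :
    0 < volume (ball (0 : EuclideanSpace ℝ (Fin n)) ‖y‖) :=
  measure_ball_pos _ _ (norm_pos_iff.2 hy)

theorem volume_setOf_volume_ball_norm_lt {n : ℕ} (hn : 1 ≤ n) (V : ℝ≥0∞) :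
    volume {y : EuclideanSpace ℝ (Fin n) |
      volume (ball (0 : EuclideanSpace ℝ (Fin n)) ‖y‖) < V} = V := by
  have : Nonempty (Fin n) := ⟨⟨0, hn⟩⟩
  by_cases hV : V = ⊤
  · subst hV
    simp only [measure_ball_lt_top]
    simp [measure_univ_of_isAddLeftInvariant]
  obtain ⟨ρ, hρ, rfl⟩ := exists_volume_ball_eq hn hV
  congr 1
  ext y
  simp [volume_ball_lt_volume_ball_iff hn (norm_nonneg y)]

/-- Except for the special rule at the centre, the point `(x, y)` belongs to `U^*` if and only if
the ball of radius `‖y‖` has smaller volume than the fibre of `U`. This covers fibres of infinite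
measure as well. -/
theorem mem_steinerSet_iff {M : Type*} {n : ℕ} (hn : 1 ≤ n)
    (U : Set (M × EuclideanSpace ℝ (Fin n))) (q : M × EuclideanSpace ℝ (Fin n)) :
    q ∈ steinerSet U ↔
      volume (ball (0 : EuclideanSpace ℝ (Fin n)) ‖q.2‖) < volume (Prod.mk q.1 ⁻¹' U) ∨
        (volume (Prod.mk q.1 ⁻¹' U) = 0 ∧ (Prod.mk q.1 ⁻¹' U).Nonempty ∧ q.2 = 0) := by
  refine or_congr_left ⟨?_, fun h => ⟨bot_lt_of_lt h, ?_⟩⟩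
  · rintro ⟨-, h | ⟨ρ, hρ, hq⟩⟩
    · rw [h]; exact measure_ball_lt_top
    · rw [← hρ]
      exact volume_ball_lt_volume_ball hn (norm_nonneg _) (by simpa using hq)
  · by_cases ht : volume (Prod.mk q.1 ⁻¹' U) = ⊤
    · exact Or.inl ht
    · obtain ⟨ρ, hρ, hV⟩ := exists_volume_ball_eq hn ht
      refine Or.inr ⟨ρ, hV, ?_⟩
      rw [← hV, volume_ball_lt_volume_ball_iff hn (norm_nonneg _)] at h
      simpa using h

/-- The symmetric decreasing rearrangement of a function on `ℝⁿ`: its Steiner symmetrization,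
over a base which is a point. -/
noncomputable def schwarz {n : ℕ} (f : EuclideanSpace ℝ (Fin n) → ℝ) : EuclideanSpace ℝ (Fin n) → ℝ :=
  fun y => steiner (M := Unit) (fun q => f q.2) ((), y)

theorem steiner_eq_schwarz {M : Type*} {n : ℕ} (u : M × EuclideanSpace ℝ (Fin n) → ℝ) (x : M)
    (y : EuclideanSpace ℝ (Fin n)) : steiner u (x, y) = schwarz (fun y => u (x, y)) y := rfl

theorem isRadial_steiner {M : Type*} {n : ℕ} (hn : 1 ≤ n)
    (u : M × EuclideanSpace ℝ (Fin n) → ℝ) : IsRadial (steiner u) := by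
  intro x y y' h
  have h0 : y = 0 ↔ y' = 0 := by rw [← norm_eq_zero, h, norm_eq_zero]
  simp only [steiner, mem_steinerSet_iff hn, h, h0]

/-- Functions whose symmetric decreasing rearrangement is well behaved: they are nonnegative
almost everywhere, and their superlevel sets are eventually small. -/
structure Rearrangeable {n : ℕ} (f : EuclideanSpace ℝ (Fin n) → ℝ) : Prop where
  nonneg : 0 ≤ᵐ[volume] f
  small : ∀ ε : ℝ≥0∞, 0 < ε → ∃ C : ℝ, volume {y | C < f y} ≤ ε

/-- Chebyshev's inequality. -/
theorem Rearrangeable.of_memLp {n : ℕ} {f : EuclideanSpace ℝ (Fin n) → ℝ} (h0 : 0 ≤ᵐ[volume] f)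
    (hf : MemLp f 2) : Rearrangeable f := by
  refine ⟨h0, fun ε hε => ?_⟩
  have hI : ∫⁻ y, ‖f y‖ₑ ^ (2 : ℝ) ≠ ⊤ := by
    have := (lintegral_rpow_enorm_lt_top_of_eLpNorm_lt_top (p := 2) (by simp) (by simp) hf.2).ne
    simpa using this
  set I := ∫⁻ y, ‖f y‖ₑ ^ (2 : ℝ) with hIdef
  by_cases hεt : ε = ⊤
  · exact ⟨0, by simp [hεt]⟩
  refine ⟨1 + (I / ε).toReal, ?_⟩
  set C := 1 + (I / ε).toReal with hC
  have hC1 : 1 ≤ C := le_add_of_nonneg_right ENNReal.toReal_nonneg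
  have hm := mul_meas_ge_le_lintegral₀ (μ := volume) (f := fun y => ‖f y‖ₑ ^ (2 : ℝ))
    (hf.1.enorm.pow_const _) (ENNReal.ofReal C)
  have hsub : volume {y | C < f y} ≤ volume {y | ENNReal.ofReal C ≤ ‖f y‖ₑ ^ (2 : ℝ)} := by
    refine measure_mono fun y (hy : C < f y) => ?_
    have hfy : ‖f y‖ₑ = ENNReal.ofReal (f y) := by
      rw [Real.enorm_eq_ofReal (by linarith)]
    change ENNReal.ofReal C ≤ ‖f y‖ₑ ^ (2 : ℝ)
    rw [hfy, ENNReal.ofReal_rpow_of_nonneg (by linarith) (by norm_num)]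
    refine ENNReal.ofReal_le_ofReal ?_
    norm_num
    nlinarith
  refine hsub.trans ?_
  have hC0 : ENNReal.ofReal C ≠ 0 := by simp; linarith
  have h1 : volume {y | ENNReal.ofReal C ≤ ‖f y‖ₑ ^ (2 : ℝ)} ≤ I / ENNReal.ofReal C := by
    rw [ENNReal.le_div_iff_mul_le (Or.inl hC0) (Or.inl ENNReal.ofReal_ne_top), mul_comm]
    exact hm
  refine h1.trans ?_
  have h2 : I / ε ≤ ENNReal.ofReal C := by
    rw [← ENNReal.ofReal_toReal (ENNReal.div_ne_top hI hε.ne')]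
    exact ENNReal.ofReal_le_ofReal (by rw [hC]; linarith)
  rw [ENNReal.div_le_iff_le_mul (Or.inl hC0) (Or.inl ENNReal.ofReal_ne_top)]
  rw [ENNReal.div_le_iff_le_mul (Or.inl hε.ne') (Or.inl hεt)] at h2
  rwa [mul_comm]

/-- Below level `0`, the superlevel sets have full measure; this makes the set whose supremum
defines the rearrangement nonempty. -/
theorem Rearrangeable.volume_eq_top {n : ℕ} (hn : 1 ≤ n) {f : EuclideanSpace ℝ (Fin n) → ℝ}
    (hf : Rearrangeable f) {c : ℝ} (hc : c < 0) : volume {y | c < f y} = ⊤ := by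
  have : Nonempty (Fin n) := ⟨⟨0, hn⟩⟩
  have : {y | c < f y} =ᵐ[volume] Set.univ := by
    filter_upwards [hf.nonneg] with y hy
    exact propext ⟨fun _ => trivial, fun _ => hc.trans_le hy⟩
  rw [measure_congr this, measure_univ_of_isAddLeftInvariant]

/-- Away from the centre, or if the superlevel sets of measure zero are empty, the special rule for
fibres of measure zero plays no role. -/
theorem schwarz_eq_sSup {n : ℕ} (hn : 1 ≤ n) (f : EuclideanSpace ℝ (Fin n) → ℝ)
    {y : EuclideanSpace ℝ (Fin n)}
    (hy : y ≠ 0 ∨ ∀ c, volume {z | c < f z} = 0 → {z | c < f z} = ∅) :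
    schwarz f y = sSup {c | volume (ball (0 : EuclideanSpace ℝ (Fin n)) ‖y‖)
      < volume {z | c < f z}} := by
  unfold schwarz steiner
  congr 1
  ext c
  rw [Set.mem_ofPred_eq, mem_steinerSet_iff hn]
  refine or_iff_left ?_
  rintro ⟨h1, h2, h3⟩
  rcases hy with hy | hy
  · exact hy h3
  · have := hy c h1
    exact h2.ne_empty this

/-- The superlevel sets of a rearrangement are balls of the same measure. -/
theorem lt_schwarz_iff_of_le {n : ℕ} (hn : 1 ≤ n) {f : EuclideanSpace ℝ (Fin n) → ℝ}
    (hf : Rearrangeable f) {y : EuclideanSpace ℝ (Fin n)}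
    (hy : y ≠ 0 ∨ ∀ c, volume {z | c < f z} = 0 → {z | c < f z} = ∅) {C : ℝ}
    (hC : volume {z | C < f z} ≤ volume (ball (0 : EuclideanSpace ℝ (Fin n)) ‖y‖)) (c : ℝ) :
    c < schwarz f y ↔
      volume (ball (0 : EuclideanSpace ℝ (Fin n)) ‖y‖) < volume {z | c < f z} := by
  rw [schwarz_eq_sSup hn f hy]
  set β := volume (ball (0 : EuclideanSpace ℝ (Fin n)) ‖y‖)
  have hanti : ∀ {a b : ℝ}, a ≤ b → volume {z | b < f z} ≤ volume {z | a < f z} :=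
    fun {a b} hab => measure_mono fun z (hz : b < f z) => hab.trans_lt hz
  have hbdd : BddAbove {c | β < volume {z | c < f z}} := by
    refine ⟨C, fun c hc => ?_⟩
    by_contra! hlt
    exact absurd (hc.trans_le (hanti hlt.le)) hC.not_gt
  constructor
  · intro h
    obtain ⟨c', hc', hcc'⟩ := exists_lt_of_lt_csSup
      ⟨-1, by simp [hf.volume_eq_top hn, β, measure_ball_lt_top]⟩ h
    exact hc'.trans_le (hanti hcc'.le)
  · intro h
    -- continuity of the measure along `{c + 1/(k+1) < f} ↑ {c < f}`
    have hU : {z | c < f z} = ⋃ k : ℕ, {z | c + 1 / ((k : ℝ) + 1) < f z} := by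
      ext z
      simp only [Set.mem_ofPred_eq, Set.mem_iUnion]
      constructor
      · intro hz
        obtain ⟨k, hk⟩ := exists_nat_one_div_lt (sub_pos.2 hz)
        exact ⟨k, by linarith⟩
      · rintro ⟨k, hk⟩
        have : (0 : ℝ) < 1 / ((k : ℝ) + 1) := by positivity
        linarith
    rw [hU, Monotone.measure_iUnion] at h
    · obtain ⟨k, hk⟩ := lt_iSup_iff.1 h
      have : (0 : ℝ) < 1 / ((k : ℝ) + 1) := by positivity
      exact (lt_add_of_pos_right c this).trans_le (le_csSup hbdd hk)
    · intro i j hij z (hz : c + 1 / ((i : ℝ) + 1) < f z)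
      have : 1 / ((j : ℝ) + 1) ≤ 1 / ((i : ℝ) + 1) := Nat.one_div_le_one_div hij
      change c + 1 / ((j : ℝ) + 1) < f z
      linarith

theorem lt_schwarz_iff {n : ℕ} (hn : 1 ≤ n) {f : EuclideanSpace ℝ (Fin n) → ℝ}
    (hf : Rearrangeable f) {y : EuclideanSpace ℝ (Fin n)} (hy : y ≠ 0) (c : ℝ) :
    c < schwarz f y ↔
      volume (ball (0 : EuclideanSpace ℝ (Fin n)) ‖y‖) < volume {z | c < f z} := by
  obtain ⟨C, hC⟩ := hf.small _ (volume_ball_norm_pos hy)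
  exact lt_schwarz_iff_of_le hn hf (Or.inl hy) hC c

/-- The rearrangement is nonnegative everywhere; where the supremum is infinite, its value is `0` by
convention. -/
theorem schwarz_nonneg {n : ℕ} (hn : 1 ≤ n) {f : EuclideanSpace ℝ (Fin n) → ℝ}
    (hf : Rearrangeable f) (y : EuclideanSpace ℝ (Fin n)) : 0 ≤ schwarz f y := by
  by_cases hb : BddAbove {c : ℝ | ((), y) ∈
    steinerSet {q' : Unit × EuclideanSpace ℝ (Fin n) | c < f q'.2}}
  · refine le_of_forall_lt fun c hc => ?_
    obtain ⟨d, hcd, hd⟩ := exists_between hc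
    refine hcd.trans_le (le_csSup hb ?_)
    refine (mem_steinerSet_iff hn _ _).2 (Or.inl ?_)
    have : Prod.mk () ⁻¹' {q' : Unit × EuclideanSpace ℝ (Fin n) | d < f q'.2}
      = {z | d < f z} := rfl
    rw [this, hf.volume_eq_top hn hd]
    exact measure_ball_lt_top
  · exact (Real.sSup_of_not_bddAbove hb).ge

theorem schwarz_congr_ae {n : ℕ} (hn : 1 ≤ n) {f g : EuclideanSpace ℝ (Fin n) → ℝ}
    (h : f =ᵐ[volume] g) {y : EuclideanSpace ℝ (Fin n)} (hy : y ≠ 0) :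
    schwarz f y = schwarz g y := by
  rw [schwarz_eq_sSup hn f (Or.inl hy), schwarz_eq_sSup hn g (Or.inl hy)]
  congr! 4 with c
  refine measure_congr ?_
  filter_upwards [h] with z hz
  change (c < f z) = (c < g z)
  rw [hz]

theorem ae_ne_zero_euclidean {n : ℕ} (hn : 1 ≤ n) :
    ∀ᵐ y : EuclideanSpace ℝ (Fin n), y ≠ 0 := by
  have : Nonempty (Fin n) := ⟨⟨0, hn⟩⟩
  exact compl_mem_ae_iff.2 (measure_singleton 0)

/-- A function and its rearrangement are equimeasurable. -/
theorem volume_lt_schwarz {n : ℕ} (hn : 1 ≤ n) {f : EuclideanSpace ℝ (Fin n) → ℝ}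
    (hf : Rearrangeable f) (c : ℝ) : volume {y | c < schwarz f y} = volume {y | c < f y} := by
  rw [← volume_setOf_volume_ball_norm_lt hn (volume {y | c < f y})]
  refine measure_congr ?_
  filter_upwards [ae_ne_zero_euclidean hn] with y hy
  exact propext (lt_schwarz_iff hn hf hy c)

/-- The value at the centre is removed, as the supremum there need not be finite. -/
theorem measurable_indicator_schwarz {n : ℕ} (hn : 1 ≤ n) {f : EuclideanSpace ℝ (Fin n) → ℝ}
    (hf : Rearrangeable f) : Measurable (Set.indicator {0}ᶜ (schwarz f)) := by
  refine measurable_of_Ioi fun c => ?_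
  have h1 : MeasurableSet {y : EuclideanSpace ℝ (Fin n) |
      volume (ball (0 : EuclideanSpace ℝ (Fin n)) ‖y‖) < volume {z | c < f z}} := by
    refine measurableSet_lt ?_ measurable_const
    have : Monotone fun r : ℝ => volume (ball (0 : EuclideanSpace ℝ (Fin n)) r) :=
      fun r s h => measure_mono (ball_subset_ball h)
    exact this.measurable.comp measurable_norm
  have h2 : Set.indicator {0}ᶜ (schwarz f) ⁻¹' Set.Ioi c =
      ({y : EuclideanSpace ℝ (Fin n) | volume (ball (0 : EuclideanSpace ℝ (Fin n)) ‖y‖)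
        < volume {z | c < f z}} ∩ {0}ᶜ) ∪ ({0} ∩ {_y | c < 0}) := by
    ext y
    by_cases hy : y = 0
    · simp [hy]
    · simp [hy, lt_schwarz_iff hn hf hy]
  rw [h2]
  exact (h1.inter (measurableSet_singleton 0).compl).union
    ((measurableSet_singleton 0).inter (MeasurableSet.const _))

theorem schwarz_ae_eq_indicator {n : ℕ} (hn : 1 ≤ n) (f : EuclideanSpace ℝ (Fin n) → ℝ) :
    schwarz f =ᵐ[volume] Set.indicator {0}ᶜ (schwarz f) := by
  filter_upwards [ae_ne_zero_euclidean hn] with y hy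
  simp [hy]

theorem aemeasurable_schwarz {n : ℕ} (hn : 1 ≤ n) {f : EuclideanSpace ℝ (Fin n) → ℝ}
    (hf : Rearrangeable f) : AEMeasurable (schwarz f) :=
  ⟨_, measurable_indicator_schwarz hn hf, schwarz_ae_eq_indicator hn f⟩

theorem lintegral_schwarz_rpow {n : ℕ} (hn : 1 ≤ n) {f : EuclideanSpace ℝ (Fin n) → ℝ}
    (hf : Rearrangeable f) (hfm : AEMeasurable f) {s : ℝ} (hs : 0 < s) :
    ∫⁻ y, ENNReal.ofReal (schwarz f y ^ s) = ∫⁻ y, ENNReal.ofReal (f y ^ s) := by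
  rw [lintegral_rpow_eq_lintegral_meas_lt_mul volume
      (Filter.Eventually.of_forall (schwarz_nonneg hn hf)) (aemeasurable_schwarz hn hf) hs,
    lintegral_rpow_eq_lintegral_meas_lt_mul volume hf.nonneg hfm hs]
  simp only [volume_lt_schwarz hn hf]

/-- The layer cake formula for a product. -/
theorem lintegral_mul_eq_lintegral_meas_inter {α : Type*} [MeasurableSpace α] (μ : Measure α)
    {f g : α → ℝ} (hf : Measurable f) (hg : Measurable g) (hf0 : 0 ≤ f) (hg0 : 0 ≤ g) :
    ∫⁻ x, ENNReal.ofReal (f x) * ENNReal.ofReal (g x) ∂μ =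
      ∫⁻ s in Set.Ioi (0 : ℝ), ∫⁻ t in Set.Ioi (0 : ℝ), μ ({x | t < g x} ∩ {x | s < f x}) := by
  have h1 : ∫⁻ x, ENNReal.ofReal (f x) * ENNReal.ofReal (g x) ∂μ =
      ∫⁻ x, ENNReal.ofReal (f x) ∂(μ.withDensity fun x => ENNReal.ofReal (g x)) := by
    rw [lintegral_withDensity_eq_lintegral_mul _ hg.ennreal_ofReal hf.ennreal_ofReal]
    simp only [Pi.mul_apply, mul_comm]
  rw [h1, lintegral_eq_lintegral_meas_lt _ (Filter.Eventually.of_forall hf0) hf.aemeasurable]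
  refine lintegral_congr fun s => ?_
  have hs : MeasurableSet {x | s < f x} := measurableSet_lt measurable_const hf
  rw [withDensity_apply _ hs,
    lintegral_eq_lintegral_meas_lt _ (Filter.Eventually.of_forall hg0) hg.aemeasurable]
  refine lintegral_congr fun t => ?_
  rw [Measure.restrict_apply (measurableSet_lt measurable_const hg)]

/-- The Hardy–Littlewood inequality: balls with the same centre have the largest possible
intersection. -/
theorem lintegral_mul_le_lintegral_schwarz_mul {n : ℕ} (hn : 1 ≤ n)
    {f g : EuclideanSpace ℝ (Fin n) → ℝ} (hf : Rearrangeable f) (hg : Rearrangeable g)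
    (hfm : Measurable f) (hgm : Measurable g) (hf0 : 0 ≤ f) (hg0 : 0 ≤ g) :
    ∫⁻ y, ENNReal.ofReal (f y) * ENNReal.ofReal (g y) ≤
      ∫⁻ y, ENNReal.ofReal (schwarz f y) * ENNReal.ofReal (schwarz g y) := by
  have h1 : ∫⁻ y, ENNReal.ofReal (schwarz f y) * ENNReal.ofReal (schwarz g y) =
      ∫⁻ y, ENNReal.ofReal (Set.indicator {0}ᶜ (schwarz f) y) *
        ENNReal.ofReal (Set.indicator {0}ᶜ (schwarz g) y) := by
    refine lintegral_congr_ae ?_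
    filter_upwards [schwarz_ae_eq_indicator hn f, schwarz_ae_eq_indicator hn g] with y h1 h2
    rw [h1, h2]
  rw [h1, lintegral_mul_eq_lintegral_meas_inter volume hfm hgm hf0 hg0,
    lintegral_mul_eq_lintegral_meas_inter volume (measurable_indicator_schwarz hn hf)
    (measurable_indicator_schwarz hn hg) (Set.indicator_nonneg fun y _ => schwarz_nonneg hn hf y)
    (Set.indicator_nonneg fun y _ => schwarz_nonneg hn hg y)]
  refine lintegral_mono fun s => lintegral_mono fun t => ?_
  -- Two balls with the same centre meet in the smaller one.
  have h2 : volume ({y | t < Set.indicator {0}ᶜ (schwarz g) y} ∩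
      {y | s < Set.indicator {0}ᶜ (schwarz f) y}) =
      volume {y : EuclideanSpace ℝ (Fin n) | volume (ball (0 : EuclideanSpace ℝ (Fin n)) ‖y‖)
        < min (volume {z | t < g z}) (volume {z | s < f z})} := by
    refine measure_congr ?_
    filter_upwards [ae_ne_zero_euclidean hn] with y hy
    refine propext ?_
    change (t < Set.indicator {0}ᶜ (schwarz g) y ∧ s < Set.indicator {0}ᶜ (schwarz f) y) ↔ _ < _
    simp [hy, lt_schwarz_iff hn hf hy, lt_schwarz_iff hn hg hy]
  rw [h2, volume_setOf_volume_ball_norm_lt hn]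
  exact le_min (measure_mono Set.inter_subset_left) (measure_mono Set.inter_subset_right)

theorem lintegral_ofReal_sub_sq_add {α : Type*} [MeasurableSpace α] {μ : Measure α} {f g : α → ℝ}
    (hf : AEMeasurable f μ) (hg : AEMeasurable g μ) (hf0 : ∀ x, 0 ≤ f x) (hg0 : ∀ x, 0 ≤ g x) :
    ∫⁻ x, ENNReal.ofReal ((f x - g x) ^ 2) ∂μ
      + 2 * ∫⁻ x, ENNReal.ofReal (f x) * ENNReal.ofReal (g x) ∂μ =
    ∫⁻ x, ENNReal.ofReal (f x ^ (2 : ℝ)) ∂μ + ∫⁻ x, ENNReal.ofReal (g x ^ (2 : ℝ)) ∂μ := by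
  rw [← lintegral_const_mul'' 2 (f := fun x => ENNReal.ofReal (f x) * ENNReal.ofReal (g x))
      (hf.ennreal_ofReal.mul hg.ennreal_ofReal),
    ← lintegral_add_left' (f := fun x => ENNReal.ofReal ((f x - g x) ^ 2))
      ((hf.sub hg).pow_const 2).ennreal_ofReal,
    ← lintegral_add_left' (hf.pow_const (2 : ℝ)).ennreal_ofReal]
  refine lintegral_congr fun x => ?_
  have h2 : (2 : ℝ≥0∞) = ENNReal.ofReal 2 := by simp
  rw [h2, ← ENNReal.ofReal_mul (hf0 x), ← ENNReal.ofReal_mul (by norm_num),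
    ← ENNReal.ofReal_add (sq_nonneg _) (by have := hf0 x; have := hg0 x; positivity),
    ← ENNReal.ofReal_add (by have := hf0 x; positivity) (by have := hg0 x; positivity)]
  congr 1
  norm_num
  ring

/-- Rearrangement does not increase distances in `L²`: it preserves norms and does not decrease
inner products. -/
theorem lintegral_schwarz_sub_sq_le {n : ℕ} (hn : 1 ≤ n)
    {f g : EuclideanSpace ℝ (Fin n) → ℝ} (hf : Rearrangeable f) (hg : Rearrangeable g)
    (hfm : Measurable f) (hgm : Measurable g) (hf0 : 0 ≤ f) (hg0 : 0 ≤ g)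
    (hf2 : ∫⁻ y, ENNReal.ofReal (f y ^ (2 : ℝ)) ≠ ⊤)
    (hg2 : ∫⁻ y, ENNReal.ofReal (g y ^ (2 : ℝ)) ≠ ⊤) :
    ∫⁻ y, ENNReal.ofReal ((schwarz f y - schwarz g y) ^ 2) ≤
      ∫⁻ y, ENNReal.ofReal ((f y - g y) ^ 2) := by
  have e1 := lintegral_ofReal_sub_sq_add (μ := volume) hfm.aemeasurable hgm.aemeasurable hf0 hg0
  have e2 := lintegral_ofReal_sub_sq_add (μ := volume) (aemeasurable_schwarz hn hf)
    (aemeasurable_schwarz hn hg) (schwarz_nonneg hn hf) (schwarz_nonneg hn hg)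
  rw [lintegral_schwarz_rpow hn hf hfm.aemeasurable two_pos,
    lintegral_schwarz_rpow hn hg hgm.aemeasurable two_pos, ← e1] at e2
  have h := lintegral_mul_le_lintegral_schwarz_mul hn hf hg hfm hgm hf0 hg0
  have hfin : 2 * ∫⁻ y, ENNReal.ofReal (schwarz f y) * ENNReal.ofReal (schwarz g y) ≠ ⊤ := by
    refine ne_top_of_le_ne_top (ENNReal.add_ne_top.2 ⟨hf2, hg2⟩) ?_
    rw [← e1, ← e2]
    exact le_add_self
  refine (ENNReal.add_le_add_iff_right hfin).1 ?_
  rw [e2]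
  gcongr

/-! ### Steiner symmetrization of square integrable functions -/

theorem eLpNorm_two_eq_lintegral_sq {α : Type*} [MeasurableSpace α] (μ : Measure α) (f : α → ℝ) :
    eLpNorm f 2 μ = (∫⁻ x, ENNReal.ofReal (f x ^ 2) ∂μ) ^ (1 / 2 : ℝ) := by
  rw [eLpNorm_eq_lintegral_rpow_enorm_toReal (by simp) (by simp)]
  simp only [ENNReal.toReal_ofNat]
  congr 1
  refine lintegral_congr fun x => ?_
  rw [Real.enorm_eq_ofReal_abs, ENNReal.ofReal_rpow_of_nonneg (abs_nonneg _) (by norm_num)]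
  simp

theorem lintegral_sq_ne_top_of_memLp {α : Type*} [MeasurableSpace α] {μ : Measure α} {f : α → ℝ}
    (hf : MemLp f 2 μ) : ∫⁻ x, ENNReal.ofReal (f x ^ 2) ∂μ ≠ ⊤ := by
  intro h
  have := hf.2.ne
  rw [eLpNorm_two_eq_lintegral_sq, h] at this
  simp at this

theorem memLp_two_of_lintegral_sq {α : Type*} [MeasurableSpace α] {μ : Measure α} {f : α → ℝ}
    (hf : AEMeasurable f μ) (h : ∫⁻ x, ENNReal.ofReal (f x ^ 2) ∂μ ≠ ⊤) : MemLp f 2 μ := by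
  refine ⟨hf.aestronglyMeasurable, ?_⟩
  rw [eLpNorm_two_eq_lintegral_sq]
  exact ENNReal.rpow_lt_top_of_nonneg (by norm_num) h

/-- Measurable nonnegative functions on `M × ℝⁿ` all of whose restrictions to the fibres are square
integrable. -/
structure FibrewiseL2 {M : Type*} [MeasurableSpace M] {n : ℕ}
    (u : M × EuclideanSpace ℝ (Fin n) → ℝ) : Prop where
  measurable : Measurable u
  nonneg : 0 ≤ u
  fibre : ∀ x, ∫⁻ y, ENNReal.ofReal (u (x, y) ^ (2 : ℝ)) ≠ ⊤

namespace FibrewiseL2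

variable {M : Type*} [MeasurableSpace M] {n : ℕ} {u v : M × EuclideanSpace ℝ (Fin n) → ℝ}

theorem measurable_fibre (hu : FibrewiseL2 u) (x : M) : Measurable fun y => u (x, y) :=
  hu.measurable.comp measurable_prodMk_left

theorem rearrangeable (hu : FibrewiseL2 u) (x : M) : Rearrangeable fun y => u (x, y) := by
  refine Rearrangeable.of_memLp (Filter.Eventually.of_forall fun y => hu.nonneg (x, y)) ?_
  refine memLp_two_of_lintegral_sq (hu.measurable_fibre x).aemeasurable ?_
  simpa using hu.fibre x

theorem measurable_indicator_steiner (hn : 1 ≤ n) (hu : FibrewiseL2 u) :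
    Measurable (Set.indicator {q : M × EuclideanSpace ℝ (Fin n) | q.2 ≠ 0} (steiner u)) := by
  refine measurable_of_Ioi fun c => ?_
  have h0 : MeasurableSet {q : M × EuclideanSpace ℝ (Fin n) | q.2 ≠ 0} :=
    (measurable_snd (measurableSet_singleton 0)).compl
  have h1 : MeasurableSet {q : M × EuclideanSpace ℝ (Fin n) |
      volume (ball (0 : EuclideanSpace ℝ (Fin n)) ‖q.2‖) < volume {z | c < u (q.1, z)}} := by
    refine measurableSet_lt ?_ ?_
    · have : Monotone fun r : ℝ => volume (ball (0 : EuclideanSpace ℝ (Fin n)) r) :=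
        fun r s h => measure_mono (ball_subset_ball h)
      exact this.measurable.comp (measurable_norm.comp measurable_snd)
    · exact (measurable_measure_prodMk_left
        (measurableSet_lt measurable_const hu.measurable)).comp measurable_fst
  have h2 : Set.indicator {q : M × EuclideanSpace ℝ (Fin n) | q.2 ≠ 0} (steiner u) ⁻¹' Set.Ioi c =
      ({q : M × EuclideanSpace ℝ (Fin n) | volume (ball (0 : EuclideanSpace ℝ (Fin n)) ‖q.2‖)
        < volume {z | c < u (q.1, z)}} ∩ {q | q.2 ≠ 0}) ∪ ({q | q.2 ≠ 0}ᶜ ∩ {_q | c < 0}) := by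
    ext ⟨x, y⟩
    by_cases hy : y = 0
    · simp [hy]
    · simp [hy, steiner_eq_schwarz, lt_schwarz_iff hn (hu.rearrangeable x) hy]
  rw [h2]
  exact (h1.inter h0).union (h0.compl.inter (MeasurableSet.const _))

theorem steiner_nonneg (hn : 1 ≤ n) (hu : FibrewiseL2 u) (q : M × EuclideanSpace ℝ (Fin n)) :
    0 ≤ steiner u q := schwarz_nonneg hn (hu.rearrangeable q.1) q.2

variable {ν : Measure M}

theorem aemeasurable_steiner (hn : 1 ≤ n) (hu : FibrewiseL2 u) :
    AEMeasurable (steiner u) (ν.prod volume) := by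
  refine ⟨_, hu.measurable_indicator_steiner hn, ?_⟩
  filter_upwards [Measure.quasiMeasurePreserving_snd.ae (ae_ne_zero_euclidean hn)] with q hq
  rw [Set.indicator_of_mem (by exact hq)]

theorem lintegral_steiner_rpow (hn : 1 ≤ n) (hu : FibrewiseL2 u) {s : ℝ} (hs : 0 < s) :
    ∫⁻ q, ENNReal.ofReal (steiner u q ^ s) ∂(ν.prod volume) =
      ∫⁻ q, ENNReal.ofReal (u q ^ s) ∂(ν.prod volume) := by
  rw [lintegral_prod _ ((hu.aemeasurable_steiner hn).pow_const s).ennreal_ofReal,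
    lintegral_prod _ (hu.measurable.pow_const s).ennreal_ofReal.aemeasurable]
  exact lintegral_congr fun x => lintegral_schwarz_rpow hn (hu.rearrangeable x)
    (hu.measurable_fibre x).aemeasurable hs

theorem lintegral_steiner_sub_sq_le (hn : 1 ≤ n) (hu : FibrewiseL2 u) (hv : FibrewiseL2 v) :
    ∫⁻ q, ENNReal.ofReal ((steiner u q - steiner v q) ^ 2) ∂(ν.prod volume) ≤
      ∫⁻ q, ENNReal.ofReal ((u q - v q) ^ 2) ∂(ν.prod volume) := by
  rw [lintegral_prod (fun q => ENNReal.ofReal ((steiner u q - steiner v q) ^ 2))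
      (((hu.aemeasurable_steiner hn).sub (hv.aemeasurable_steiner hn)).pow_const 2).ennreal_ofReal,
    lintegral_prod (fun q => ENNReal.ofReal ((u q - v q) ^ 2))
      ((hu.measurable.sub hv.measurable).pow_const 2).ennreal_ofReal.aemeasurable]
  refine lintegral_mono fun x => ?_
  have h := lintegral_schwarz_sub_sq_le hn (hu.rearrangeable x) (hv.rearrangeable x)
    (hu.measurable_fibre x) (hv.measurable_fibre x) (fun y => hu.nonneg (x, y))
    (fun y => hv.nonneg (x, y)) (hu.fibre x) (hv.fibre x)
  simpa only [steiner_eq_schwarz] using h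

end FibrewiseL2

section

variable {M : Type*} [MeasurableSpace M] {n : ℕ} {u v : M × EuclideanSpace ℝ (Fin n) → ℝ}
  {ν : Measure M}

/-- Symmetrization respects equality almost everywhere. The hyperplane `y = 0`, where single points
of a fibre may matter, is a null set. -/
theorem steiner_congr_ae (hn : 1 ≤ n) (h : u =ᵐ[ν.prod volume] v) :
    steiner u =ᵐ[ν.prod volume] steiner v := by
  filter_upwards [Measure.quasiMeasurePreserving_snd.ae (ae_ne_zero_euclidean hn),
    Measure.quasiMeasurePreserving_fst.ae (Measure.ae_ae_of_ae_prod h)] with q hq hq'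
  exact schwarz_congr_ae hn hq' hq

/-- Fubini's theorem for null sets which are merely null measurable. -/
theorem ae_prod_of_ae_ae {Y : Type*} [MeasurableSpace Y] {τ : Measure Y} [SFinite τ]
    {p : M × Y → Prop} (hp : NullMeasurableSet {q | p q} (ν.prod τ))
    (h : ∀ᵐ x ∂ν, ∀ᵐ y ∂τ, p (x, y)) : ∀ᵐ q ∂(ν.prod τ), p q := by
  obtain ⟨t, hts, ht, hst⟩ := hp.exists_measurable_subset_ae_eq
  have : ∀ᵐ q ∂(ν.prod τ), q ∈ t := by
    rw [Measure.ae_prod_mem_iff_ae_ae_mem ht]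
    filter_upwards [h, Measure.ae_ae_of_ae_prod hst] with x hx hx'
    filter_upwards [hx, hx'] with y hy hy'
    exact (hy'.mpr hy : t (x, y))
  exact this.mono fun q hq => hts hq

/-- Every nonnegative function in `L²` has a representative which is Borel measurable, nonnegative
everywhere and square integrable on every fibre. -/
theorem exists_fibrewiseL2 (hu : MemLp u 2 (ν.prod volume)) (h0 : 0 ≤ᵐ[ν.prod volume] u) :
    ∃ u', FibrewiseL2 u' ∧ u' =ᵐ[ν.prod volume] u := by
  classical
  obtain ⟨w, hw, hwu⟩ : ∃ w, Measurable w ∧ u =ᵐ[ν.prod volume] w :=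
    ⟨_, hu.1.aemeasurable.measurable_mk, hu.1.aemeasurable.ae_eq_mk⟩
  set I : M → ℝ≥0∞ := fun x => ∫⁻ y, ENNReal.ofReal (max (w (x, y)) 0 ^ (2 : ℝ)) with hI
  have hm : Measurable fun q : M × EuclideanSpace ℝ (Fin n) =>
      ENNReal.ofReal (max (w q) 0 ^ (2 : ℝ)) :=
    ((hw.max measurable_const).pow_const _).ennreal_ofReal
  have hIm : Measurable I := hm.lintegral_prod_right'
  have hIfin : ∀ᵐ x ∂ν, I x < ⊤ := by
    refine ae_lt_top hIm ?_
    rw [hI, ← lintegral_prod _ hm.aemeasurable]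
    refine ne_top_of_le_ne_top (lintegral_sq_ne_top_of_memLp hu) (lintegral_mono_ae ?_)
    filter_upwards [hwu, h0] with q h1 h2
    have h2 : 0 ≤ w q := h1 ▸ h2
    rw [h1, max_eq_left h2]
    simp
  have hS : MeasurableSet {q : M × EuclideanSpace ℝ (Fin n) | I q.1 < ⊤} :=
    measurableSet_lt (hIm.comp measurable_fst) measurable_const
  -- The function is set to zero on the fibres where it is not square integrable.
  refine ⟨Set.indicator {q | I q.1 < ⊤} fun q => max (w q) 0,
    ⟨(hw.max measurable_const).indicator hS, Set.indicator_nonneg fun q _ => le_max_right _ _,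
      fun x => ?_⟩, ?_⟩
  · by_cases hx : I x < ⊤
    · simpa only [Set.indicator, Set.mem_ofPred_eq, hx, if_true] using hx.ne
    · simp [Set.indicator, hx]
  · filter_upwards [hwu, h0, Measure.quasiMeasurePreserving_fst.ae hIfin] with q h1 h2 h3
    have h2 : 0 ≤ w q := h1 ▸ h2
    rw [Set.indicator_of_mem (by exact h3), max_eq_left h2, h1]

theorem steiner_ae_nonneg (hn : 1 ≤ n) (hu : MemLp u 2 (ν.prod volume))
    (h0 : 0 ≤ᵐ[ν.prod volume] u) : 0 ≤ᵐ[ν.prod volume] steiner u := by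
  obtain ⟨u', hu', huu'⟩ := exists_fibrewiseL2 hu h0
  filter_upwards [steiner_congr_ae hn huu'] with q hq
  rw [← hq]
  exact hu'.steiner_nonneg hn q

theorem memLp_steiner (hn : 1 ≤ n) (hu : MemLp u 2 (ν.prod volume))
    (h0 : 0 ≤ᵐ[ν.prod volume] u) : MemLp (steiner u) 2 (ν.prod volume) := by
  obtain ⟨u', hu', huu'⟩ := exists_fibrewiseL2 hu h0
  refine (memLp_congr_ae (steiner_congr_ae hn huu')).1 ?_
  refine memLp_two_of_lintegral_sq (hu'.aemeasurable_steiner hn) ?_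
  have h := hu'.lintegral_steiner_rpow (ν := ν) hn two_pos
  simp only [Real.rpow_two] at h
  rw [h]
  exact lintegral_sq_ne_top_of_memLp ((memLp_congr_ae huu').2 hu)

theorem lintegral_steiner_rpow (hn : 1 ≤ n) (hu : MemLp u 2 (ν.prod volume))
    (h0 : 0 ≤ᵐ[ν.prod volume] u) {s : ℝ} (hs : 0 < s) :
    ∫⁻ q, ENNReal.ofReal (steiner u q ^ s) ∂(ν.prod volume) =
      ∫⁻ q, ENNReal.ofReal (u q ^ s) ∂(ν.prod volume) := by
  obtain ⟨u', hu', huu'⟩ := exists_fibrewiseL2 hu h0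
  rw [← lintegral_congr_ae (f := fun q => ENNReal.ofReal (steiner u' q ^ s))
      ((steiner_congr_ae hn huu').mono fun q hq => by simp only [hq]),
    hu'.lintegral_steiner_rpow hn hs]
  exact lintegral_congr_ae (huu'.mono fun q hq => by simp only [hq])

theorem integral_abs_steiner_rpow (hn : 1 ≤ n) (hu : MemLp u 2 (ν.prod volume))
    (h0 : 0 ≤ᵐ[ν.prod volume] u) {s : ℝ} (hs : 0 < s) :
    ∫ q, |steiner u q| ^ s ∂(ν.prod volume) = ∫ q, |u q| ^ s ∂(ν.prod volume) := by
  rw [integral_eq_lintegral_of_nonneg_ae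
      (Filter.Eventually.of_forall fun q => Real.rpow_nonneg (abs_nonneg _) _)
      (((continuous_abs.measurable.comp_aemeasurable
        (memLp_steiner hn hu h0).1.aemeasurable).pow_const s).aestronglyMeasurable),
    integral_eq_lintegral_of_nonneg_ae
      (Filter.Eventually.of_forall fun q => Real.rpow_nonneg (abs_nonneg _) _)
      (((continuous_abs.measurable.comp_aemeasurable
        hu.1.aemeasurable).pow_const s).aestronglyMeasurable)]
  congr 1
  rw [lintegral_congr_ae (g := fun q => ENNReal.ofReal (steiner u q ^ s))
      ((steiner_ae_nonneg hn hu h0).mono fun q (hq : 0 ≤ steiner u q) => by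
        simp only [abs_of_nonneg hq]),
    lintegral_congr_ae (f := fun q => ENNReal.ofReal (|u q| ^ s))
      (g := fun q => ENNReal.ofReal (u q ^ s))
      (h0.mono fun q (hq : 0 ≤ u q) => by simp only [abs_of_nonneg hq])]
  exact lintegral_steiner_rpow hn hu h0 hs

/-- Symmetrization does not increase distances in `L²`. -/
theorem eLpNorm_steiner_sub_le (hn : 1 ≤ n) (hu : MemLp u 2 (ν.prod volume))
    (h0 : 0 ≤ᵐ[ν.prod volume] u) (hv : MemLp v 2 (ν.prod volume))
    (hv0 : 0 ≤ᵐ[ν.prod volume] v) :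
    eLpNorm (steiner u - steiner v) 2 (ν.prod volume) ≤ eLpNorm (u - v) 2 (ν.prod volume) := by
  obtain ⟨u', hu', huu'⟩ := exists_fibrewiseL2 hu h0
  obtain ⟨v', hv', hvv'⟩ := exists_fibrewiseL2 hv hv0
  rw [← eLpNorm_congr_ae ((steiner_congr_ae hn huu').sub (steiner_congr_ae hn hvv')),
    ← eLpNorm_congr_ae (huu'.sub hvv'), eLpNorm_two_eq_lintegral_sq, eLpNorm_two_eq_lintegral_sq]
  exact ENNReal.rpow_le_rpow (hu'.lintegral_steiner_sub_sq_le hn hv') (by norm_num)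

theorem ae_lintegral_steiner_sq (hn : 1 ≤ n) (hu : MemLp u 2 (ν.prod volume))
    (h0 : 0 ≤ᵐ[ν.prod volume] u) :
    ∀ᵐ x ∂ν, ∫⁻ y, ENNReal.ofReal (steiner u (x, y) ^ 2) =
      ∫⁻ y, ENNReal.ofReal (u (x, y) ^ 2) := by
  obtain ⟨u', hu', huu'⟩ := exists_fibrewiseL2 hu h0
  filter_upwards [Measure.ae_ae_of_ae_prod huu',
    Measure.ae_ae_of_ae_prod (steiner_congr_ae hn huu')] with x hx hx'
  have h := lintegral_schwarz_rpow hn (hu'.rearrangeable x)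
    (hu'.measurable_fibre x).aemeasurable two_pos
  simp only [Real.rpow_two] at h
  calc _ = ∫⁻ y, ENNReal.ofReal (steiner u' (x, y) ^ 2) :=
        lintegral_congr_ae (hx'.mono fun y hy => by simp only [hy])
    _ = ∫⁻ y, ENNReal.ofReal (u' (x, y) ^ 2) := h
    _ = _ := lintegral_congr_ae (hx.mono fun y hy => by simp only [hy])

variable [SFinite ν]

/-- Fubini's theorem for the product of an integrable function `f` on `M × ℝⁿ` and an arbitrary
function `h` of `x ∈ M`. No measurability of `h` is needed: as `f ≥ 0`, the two integrands are
integrable for the same `h`. -/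
theorem integral_mul_eq_integral_mul_fibre {Y : Type*} [MeasurableSpace Y] {τ : Measure Y}
    [SFinite τ] (h : M → ℝ) {f : M × Y → ℝ}
    (hf : Integrable f (ν.prod τ)) (h0 : 0 ≤ᵐ[ν.prod τ] f) :
    ∫ q, h q.1 * f q ∂(ν.prod τ) = ∫ x, h x * ∫ y, f (x, y) ∂τ ∂ν := by
  by_cases hint : Integrable (fun q : M × Y => h q.1 * f q) (ν.prod τ)
  · rw [integral_prod _ hint]
    simp only [integral_const_mul]
  rw [integral_undef hint, integral_undef]
  -- If the right-hand side is integrable, then so is the left-hand side.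
  contrapose! hint
  set w : M → ℝ := fun x => ∫ y, f (x, y) ∂τ with hw
  have hwm : AEMeasurable w ν := hf.integral_prod_left.1.aemeasurable
  -- where `w` vanishes, so does `f`; elsewhere, `h = (h w) / w`
  set k : M → ℝ := fun x => (h x * w x) / w x with hk
  have hkm : AEMeasurable k ν := hint.1.aemeasurable.div hwm
  have hf0 : ∀ᵐ x ∂ν, ∀ᵐ y ∂τ, 0 ≤ f (x, y) := Measure.ae_ae_of_ae_prod h0
  have hkf : (fun q : M × Y => k q.1 * f q) =ᵐ[ν.prod τ] fun q => h q.1 * f q := by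
    have hkm' : AEMeasurable (fun q : M × Y => k q.1 * f q) (ν.prod τ) :=
      (hkm.comp_quasiMeasurePreserving Measure.quasiMeasurePreserving_fst).mul hf.1.aemeasurable
    have hw0 : ∀ᵐ q ∂(ν.prod τ), w q.1 = 0 → f q = 0 := by
      have hm : NullMeasurableSet {q : M × Y | w q.1 = 0 → f q = 0} (ν.prod τ) := by
        have e : {q : M × Y | w q.1 = 0 → f q = 0} = {q | w q.1 = 0}ᶜ ∪ {q | f q = 0} := by
          ext q; simp [imp_iff_not_or]
        rw [e]
        exact ((nullMeasurableSet_eq_fun (hwm.comp_quasiMeasurePreserving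
          Measure.quasiMeasurePreserving_fst) aemeasurable_const).compl).union
          (nullMeasurableSet_eq_fun hf.1.aemeasurable aemeasurable_const)
      refine ae_prod_of_ae_ae hm ?_
      filter_upwards [hf0, hf.prod_right_ae] with x hx hix
      by_cases hwx : w x = 0
      · have := (integral_eq_zero_iff_of_nonneg_ae hx hix).1 hwx
        exact this.mono fun y hy _ => hy
      · simp [hwx]
    filter_upwards [hw0] with q hq
    by_cases hwq : w q.1 = 0
    · simp [hq hwq]
    · simp [hk, hwq]
  refine Integrable.congr ?_ hkf
  have hm : AEStronglyMeasurable (fun q : M × Y => k q.1 * f q) (ν.prod τ) :=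
    ((hkm.comp_quasiMeasurePreserving Measure.quasiMeasurePreserving_fst).mul
      hf.1.aemeasurable).aestronglyMeasurable
  rw [integrable_prod_iff hm]
  refine ⟨?_, ?_⟩
  · filter_upwards [hf.prod_right_ae] with x hx using hx.const_mul _
  · refine hint.norm.congr ?_
    filter_upwards [hf0] with x hx
    simp only [norm_mul, integral_const_mul]
    have e : ∫ y, ‖f (x, y)‖ ∂τ = w x :=
      integral_congr_ae (hx.mono fun y (hy : 0 ≤ f (x, y)) => by simp [abs_of_nonneg hy])
    have hwx : 0 ≤ w x := integral_nonneg_of_ae hx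
    rw [e, hk, Real.norm_eq_abs (w x), abs_of_nonneg hwx]
    by_cases h' : w x = 0
    · simp [h']
    · simp [h']

/-- Symmetrization preserves the integral of the square over almost every fibre, hence integrals
with weights that depend on `x ∈ M` only. -/
theorem integral_mul_steiner_sq (hn : 1 ≤ n) (hu : MemLp u 2 (ν.prod volume))
    (h0 : 0 ≤ᵐ[ν.prod volume] u) (h : M → ℝ) :
    ∫ q, h q.1 * steiner u q ^ 2 ∂(ν.prod volume) = ∫ q, h q.1 * u q ^ 2 ∂(ν.prod volume) := by
  have hs := memLp_steiner hn hu h0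
  rw [integral_mul_eq_integral_mul_fibre h hs.integrable_sq
      (Filter.Eventually.of_forall fun q => sq_nonneg _),
    integral_mul_eq_integral_mul_fibre h hu.integrable_sq
      (Filter.Eventually.of_forall fun q => sq_nonneg _)]
  refine integral_congr_ae ?_
  filter_upwards [ae_lintegral_steiner_sq hn hu h0, hs.integrable_sq.prod_right_ae,
    hu.integrable_sq.prod_right_ae] with x hx h1 h2
  congr 1
  rw [integral_eq_lintegral_of_nonneg_ae (Filter.Eventually.of_forall fun q => sq_nonneg _) h1.1,
    integral_eq_lintegral_of_nonneg_ae (Filter.Eventually.of_forall fun q => sq_nonneg _) h2.1, hx]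

end

/-! ### Rearrangement and Lipschitz functions -/

/-- Balls of slightly larger radius still have volume at most `V`. -/
theorem exists_gt_volume_ball_le {n : ℕ} (hn : 1 ≤ n) {r : ℝ} (hr : 0 ≤ r) {V : ℝ≥0∞}
    (h : volume (ball (0 : EuclideanSpace ℝ (Fin n)) r) < V) :
    ∃ ρ, r < ρ ∧ volume (ball (0 : EuclideanSpace ℝ (Fin n)) ρ) ≤ V := by
  by_cases hV : V = ⊤
  · exact ⟨r + 1, by linarith, hV ▸ le_top⟩
  · obtain ⟨ρ, -, hρV⟩ := exists_volume_ball_eq hn hV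
    rw [← hρV, volume_ball_lt_volume_ball_iff hn hr] at h
    exact ⟨ρ, h, hρV.le⟩

/-- A continuous nonnegative function of compact support on `ℝⁿ`. -/
structure IsBump {n : ℕ} (f : EuclideanSpace ℝ (Fin n) → ℝ) : Prop where
  continuous : Continuous f
  compact : HasCompactSupport f
  nonneg : 0 ≤ f

namespace IsBump

variable {n : ℕ} {f g : EuclideanSpace ℝ (Fin n) → ℝ}

theorem exists_bound (hf : IsBump f) : ∃ B : ℝ, 0 ≤ B ∧ ∀ y, f y ≤ B := by
  obtain ⟨C, hC⟩ := hf.compact.exists_bound_of_continuous hf.continuous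
  exact ⟨C, (norm_nonneg _).trans (hC 0), fun y => (le_abs_self _).trans (hC y)⟩

theorem rearrangeable (hf : IsBump f) : Rearrangeable f :=
  Rearrangeable.of_memLp (Eventually.of_forall hf.nonneg)
    (hf.continuous.memLp_of_hasCompactSupport hf.compact)

/-- For continuous functions, the description of the superlevel sets holds at the centre too, since
open sets of measure zero are empty. -/
theorem lt_schwarz_iff (hn : 1 ≤ n) (hf : IsBump f) (y : EuclideanSpace ℝ (Fin n)) (c : ℝ) :
    c < schwarz f y ↔
      volume (ball (0 : EuclideanSpace ℝ (Fin n)) ‖y‖) < volume {z | c < f z} := by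
  obtain ⟨B, hB, hfB⟩ := hf.exists_bound
  refine lt_schwarz_iff_of_le hn hf.rearrangeable (Or.inr fun c hc => ?_) (C := B) ?_ c
  · exact (isOpen_lt continuous_const hf.continuous).measure_eq_zero_iff volume |>.1 hc
  · have : {z | B < f z} = ∅ := by
      ext z; simpa using hfB z
    simp [this]

theorem schwarz_nonneg (hn : 1 ≤ n) (hf : IsBump f) (y : EuclideanSpace ℝ (Fin n)) :
    0 ≤ schwarz f y := _root_.schwarz_nonneg hn hf.rearrangeable y

theorem schwarz_le (hn : 1 ≤ n) (hf : IsBump f) {B : ℝ} (hB : ∀ y, f y ≤ B)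
    (y : EuclideanSpace ℝ (Fin n)) : schwarz f y ≤ B := by
  by_contra! h
  rw [hf.lt_schwarz_iff hn] at h
  have : {z | B < f z} = ∅ := by
    ext z; simpa using hB z
  simp [this] at h

/-- Rearrangement is monotone and commutes with adding constants, hence contracts uniform distances.
-/
theorem schwarz_le_add (hn : 1 ≤ n) (hf : IsBump f) (hg : IsBump g) {δ : ℝ}
    (h : ∀ y, f y ≤ g y + δ) (y : EuclideanSpace ℝ (Fin n)) :
    schwarz f y ≤ schwarz g y + δ := by
  refine le_of_forall_lt fun c hc => ?_
  rw [hf.lt_schwarz_iff hn] at hc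
  have : c - δ < schwarz g y := by
    rw [hg.lt_schwarz_iff hn]
    refine hc.trans_le (measure_mono fun z (hz : c < f z) => ?_)
    change c - δ < g z
    linarith [h z]
  linarith

/-- Symmetrization preserves Lipschitz constants, by the Brunn–Minkowski inequality. -/
theorem lipschitzWith_schwarz (hn : 1 ≤ n) (hf : IsBump f) {L : ℝ≥0} (hL : LipschitzWith L f) :
    LipschitzWith L (schwarz f) := by
  refine LipschitzWith.of_le_add_mul L fun x y => ?_
  rcases (dist_nonneg (x := x) (y := y)).eq_or_lt with hr | hr
  · rw [dist_eq_zero.1 hr.symm]; simp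
  set r := dist x y
  refine le_of_forall_lt fun c hc => ?_
  rw [hf.lt_schwarz_iff hn] at hc
  obtain ⟨ρ, hxρ, hρ⟩ := exists_gt_volume_ball_le hn (norm_nonneg x) hc
  have hρ0 : 0 ≤ ρ := (norm_nonneg x).trans hxρ.le
  have hne : {z | c < f z}.Nonempty := nonempty_of_measure_ne_zero (bot_lt_of_lt hc).ne'
  have hBM := volume_ball_add_le_volume_thickening
    (isOpen_lt continuous_const hf.continuous).measurableSet hne hρ0 hr hρ
  -- The `r`-neighbourhood of `{f > c}` lies in `{f > c - L r}`.
  have hsub : thickening r {z | c < f z} ⊆ {z | c - L * r < f z} := by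
    intro w hw
    obtain ⟨z, hz, hwz⟩ := mem_thickening_iff.1 hw
    have h1 : f z ≤ f w + L * dist z w := by
      have := hL.dist_le_mul z w
      rw [Real.dist_eq] at this
      linarith [le_abs_self (f z - f w)]
    have h2 : (L : ℝ) * dist z w ≤ L * r := by
      rw [dist_comm]; exact mul_le_mul_of_nonneg_left hwz.le L.2
    have hz : c < f z := hz
    change c - L * r < f w
    linarith
  have hy : ‖y‖ < ρ + r := by
    have : ‖y‖ ≤ ‖x‖ + r := by
      have := norm_sub_norm_le y x
      rw [← dist_eq_norm, dist_comm] at this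
      linarith
    linarith
  have : c - L * r < schwarz f y := by
    rw [hf.lt_schwarz_iff hn]
    exact (volume_ball_lt_volume_ball hn (norm_nonneg y) hy).trans_le
      (hBM.trans (measure_mono hsub))
  linarith

end IsBump

/-- The quadratic sup-convolution `y ↦ sup_z (f z - |z - y|² / (2t))`. -/
noncomputable def supConv {n : ℕ} (t : ℝ) (f : EuclideanSpace ℝ (Fin n) → ℝ)
    (y : EuclideanSpace ℝ (Fin n)) : ℝ :=
  ⨆ z, (f z - ‖z - y‖ ^ 2 / (2 * t))

section supConv

variable {n : ℕ} {f : EuclideanSpace ℝ (Fin n) → ℝ} {B t : ℝ}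

theorem bddAbove_supConv (ht : 0 < t) (hB : ∀ y, f y ≤ B) (y : EuclideanSpace ℝ (Fin n)) :
    BddAbove (Set.range fun z => f z - ‖z - y‖ ^ 2 / (2 * t)) := by
  refine ⟨B, ?_⟩
  rintro _ ⟨z, rfl⟩
  have : 0 ≤ ‖z - y‖ ^ 2 / (2 * t) := by positivity
  have := hB z
  dsimp only
  linarith

theorem le_supConv (ht : 0 < t) (hB : ∀ y, f y ≤ B) (y z : EuclideanSpace ℝ (Fin n)) :
    f z - ‖z - y‖ ^ 2 / (2 * t) ≤ supConv t f y :=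
  le_ciSup (bddAbove_supConv ht hB y) z

theorem self_le_supConv (ht : 0 < t) (hB : ∀ y, f y ≤ B) (y : EuclideanSpace ℝ (Fin n)) :
    f y ≤ supConv t f y := by
  simpa using le_supConv ht hB y y

theorem lt_supConv_iff (ht : 0 < t) (hB : ∀ y, f y ≤ B) {y : EuclideanSpace ℝ (Fin n)} {c : ℝ} :
    c < supConv t f y ↔ ∃ z, c < f z - ‖z - y‖ ^ 2 / (2 * t) :=
  lt_ciSup_iff (bddAbove_supConv ht hB y)

theorem measurable_supConv (ht : 0 < t) (hB : ∀ y, f y ≤ B) : Measurable (supConv t f) := by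
  refine measurable_of_Ioi fun c => IsOpen.measurableSet ?_
  have : supConv t f ⁻¹' Set.Ioi c = ⋃ z, {y | c < f z - ‖z - y‖ ^ 2 / (2 * t)} := by
    ext y
    simp [lt_supConv_iff ht hB]
  rw [this]
  exact isOpen_iUnion fun z => isOpen_lt continuous_const (by fun_prop)

/-- The superlevel sets of the sup-convolution are unions of neighbourhoods of superlevel sets of
`f`, so that the Brunn–Minkowski inequality applies to them. -/
theorem volume_lt_supConv_schwarz_le (hn : 1 ≤ n) (hf : IsBump f) (ht : 0 < t)
    (hB : ∀ y, f y ≤ B) (c : ℝ) :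
    volume {y | c < supConv t (schwarz f) y} ≤ volume {y | c < supConv t f y} := by
  rw [← volume_setOf_volume_ball_norm_lt hn (volume {y | c < supConv t f y})]
  refine measure_mono fun y hy => ?_
  obtain ⟨z, hz⟩ := (lt_supConv_iff ht (hf.schwarz_le hn hB)).1 hy
  have hz : c + ‖z - y‖ ^ 2 / (2 * t) < schwarz f z := by linarith
  set r := ‖z - y‖ with hr
  rw [hf.lt_schwarz_iff hn] at hz
  obtain ⟨ρ, hzρ, hρ⟩ := exists_gt_volume_ball_le hn (norm_nonneg z) hz
  have hρ0 : 0 ≤ ρ := (norm_nonneg z).trans hzρ.le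
  change volume (ball (0 : EuclideanSpace ℝ (Fin n)) ‖y‖) < volume {y | c < supConv t f y}
  rcases (norm_nonneg (z - y)).eq_or_lt with h0 | h0
  · have hzy : z = y := by rw [eq_comm, norm_eq_zero, sub_eq_zero] at h0; exact h0
    rw [← hzy]
    refine hz.trans_le (measure_mono fun w (hw : _ < f w) => ?_)
    have : 0 ≤ r ^ 2 / (2 * t) := by positivity
    change c < supConv t f w
    linarith [self_le_supConv ht hB w]
  have hne : {w | c + r ^ 2 / (2 * t) < f w}.Nonempty :=
    nonempty_of_measure_ne_zero (bot_lt_of_lt hz).ne'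
  have hBM := volume_ball_add_le_volume_thickening
    (isOpen_lt continuous_const hf.continuous).measurableSet hne hρ0 h0 hρ
  have hsub : thickening r {w | c + r ^ 2 / (2 * t) < f w} ⊆ {w | c < supConv t f w} := by
    intro w hw
    obtain ⟨w', hw', hd⟩ := mem_thickening_iff.1 hw
    have hw' : c + r ^ 2 / (2 * t) < f w' := hw'
    refine (lt_supConv_iff ht hB).2 ⟨w', ?_⟩
    rw [dist_comm, dist_eq_norm] at hd
    have : ‖w' - w‖ ^ 2 / (2 * t) ≤ r ^ 2 / (2 * t) := by gcongr
    linarith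
  have hy' : ‖y‖ < ρ + r := by
    have := norm_sub_norm_le y z
    rw [norm_sub_rev] at this
    linarith
  exact (volume_ball_lt_volume_ball hn (norm_nonneg y) hy').trans_le
    (hBM.trans (measure_mono hsub))

/-- Rearrangement does not increase the integral of the sup-convolution. -/
theorem lintegral_supConv_schwarz_le (hn : 1 ≤ n) (hf : IsBump f) (ht : 0 < t)
    (hB : ∀ y, f y ≤ B) :
    ∫⁻ y, ENNReal.ofReal (supConv t (schwarz f) y) ≤ ∫⁻ y, ENNReal.ofReal (supConv t f y) := by
  have hBs := hf.schwarz_le hn hB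
  rw [lintegral_eq_lintegral_meas_lt volume (Eventually.of_forall fun y =>
      (hf.schwarz_nonneg hn y).trans (self_le_supConv ht hBs y))
      (measurable_supConv ht hBs).aemeasurable,
    lintegral_eq_lintegral_meas_lt volume (Eventually.of_forall fun y =>
      (hf.nonneg y).trans (self_le_supConv ht hB y)) (measurable_supConv ht hB).aemeasurable]
  exact lintegral_mono fun c => volume_lt_supConv_schwarz_le hn hf ht hB c

/-- The gradient vector of a linear form. -/
theorem exists_norm_sq_eq_apply (l : EuclideanSpace ℝ (Fin n) →L[ℝ] ℝ) :
    ∃ v, ‖v‖ = ‖l‖ ∧ l v = ‖l‖ ^ 2 := by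
  refine ⟨(InnerProductSpace.toDual ℝ _).symm l, by simp, ?_⟩
  rw [← InnerProductSpace.toDual_symm_apply (x := (InnerProductSpace.toDual ℝ _).symm l),
    real_inner_self_eq_norm_sq]
  simp

/-- Following the gradient shows that the sup-convolution grows at least at the rate
`|∇f|² / 2`. -/
theorem le_liminf_supConv_sub_div (hB : ∀ y, f y ≤ B) {y : EuclideanSpace ℝ (Fin n)}
    (hf : DifferentiableAt ℝ f y) {t : ℕ → ℝ} (ht : ∀ k, 0 < t k)
    (ht0 : Tendsto t atTop (𝓝 0)) :
    ENNReal.ofReal (‖fderiv ℝ f y‖ ^ 2 / 2) ≤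
      liminf (fun k => ENNReal.ofReal ((supConv (t k) f y - f y) / t k)) atTop := by
  obtain ⟨v, hv, hlv⟩ := exists_norm_sq_eq_apply (fderiv ℝ f y)
  have hline := (hf.hasFDerivAt.hasLineDerivAt v).tendsto_slope_zero
  have hlim : Tendsto (fun k => (t k)⁻¹ • (f (y + t k • v) - f y) - ‖v‖ ^ 2 / 2) atTop
      (𝓝 (‖fderiv ℝ f y‖ ^ 2 / 2)) := by
    have h1 : Tendsto t atTop (𝓝[≠] 0) :=
      tendsto_nhdsWithin_iff.2 ⟨ht0, Eventually.of_forall fun k => (ht k).ne'⟩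
    have h2 := (hline.comp h1).sub_const (‖v‖ ^ 2 / 2)
    rw [hlv, hv] at h2
    convert h2 using 2
    · simp [hv]
    · ring
  have h3 := (ENNReal.tendsto_ofReal hlim).liminf_eq
  rw [← h3]
  refine liminf_le_liminf (Eventually.of_forall fun k => ENNReal.ofReal_le_ofReal ?_)
  -- Test the supremum with the point reached by moving along the gradient for time `t`.
  have h4 := le_supConv (ht k) hB y (y + t k • v)
  rw [add_sub_cancel_left, norm_smul, Real.norm_eq_abs, abs_of_pos (ht k)] at h4
  have hk := ht k
  rw [le_div_iff₀ hk, smul_eq_mul, sub_mul, mul_assoc, inv_mul_eq_div, mul_comm (f _ - _)] at *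
  have h5 : (t k * ‖v‖) ^ 2 / (2 * t k) = ‖v‖ ^ 2 / 2 * t k := by field_simp
  rw [h5] at h4
  have h6 : t k * (f (y + t k • v) - f y) / t k = f (y + t k • v) - f y := by field_simp
  rw [h6]
  linarith

/-- The sup-convolution of a Lipschitz function grows at most at the rate `|∇f|² / 2`. -/
theorem limsup_supConv_sub_div_le {L : ℝ≥0} (hL : LipschitzWith L f)
    {y : EuclideanSpace ℝ (Fin n)}
    (hf : DifferentiableAt ℝ f y) {t : ℕ → ℝ} (ht : ∀ k, 0 < t k)
    (ht0 : Tendsto t atTop (𝓝 0)) :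
    limsup (fun k => ENNReal.ofReal ((supConv (t k) f y - f y) / t k)) atTop ≤
      ENNReal.ofReal (‖fderiv ℝ f y‖ ^ 2 / 2) := by
  set D := ‖fderiv ℝ f y‖ with hD
  have key : ∀ ε : ℝ, 0 < ε → limsup (fun k => ENNReal.ofReal ((supConv (t k) f y - f y) / t k))
      atTop ≤ ENNReal.ofReal ((D + ε) ^ 2 / 2) := by
    intro ε hε
    obtain ⟨δ, hδ, hball⟩ := Metric.eventually_nhds_iff.1
      (hf.hasFDerivAt.isLittleO.bound hε)
    have hev : ∀ᶠ k in atTop, 2 * L * t k ≤ δ := by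
      have : Tendsto (fun k => 2 * (L : ℝ) * t k) atTop (𝓝 (2 * L * 0)) := ht0.const_mul _
      rw [mul_zero] at this
      exact (this.eventually_lt_const hδ).mono fun k hk => hk.le
    refine limsup_le_of_le ?_ (hev.mono fun k hk => ENNReal.ofReal_le_ofReal ?_)
    · isBoundedDefault
    have htk := ht k
    rw [div_le_iff₀ htk, sub_le_iff_le_add]
    refine ciSup_le fun z => ?_
    have hnorm := norm_nonneg (z - y)
    -- Near `y`, use the derivative at `y`. Away from `y`, the penalty beats the Lipschitz bound.
    rcases lt_or_ge (dist z y) δ with hz | hz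
    · have h1 := hball hz
      have h2 : f z - f y ≤ (D + ε) * ‖z - y‖ := by
        have h3 := (abs_le.1 h1).2
        have h4 := (le_abs_self _).trans ((fderiv ℝ f y).le_opNorm (z - y))
        linarith
      have h5 : (D + ε) * ‖z - y‖ - ‖z - y‖ ^ 2 / (2 * t k) ≤ (D + ε) ^ 2 / 2 * t k := by
        have : (D + ε) ^ 2 / 2 * t k - ((D + ε) * ‖z - y‖ - ‖z - y‖ ^ 2 / (2 * t k)) =
            ((D + ε) * t k - ‖z - y‖) ^ 2 / (2 * t k) := by field_simp; ring
        have : 0 ≤ ((D + ε) * t k - ‖z - y‖) ^ 2 / (2 * t k) := by positivity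
        linarith
      linarith
    · have h1 : f z - f y ≤ L * ‖z - y‖ := by
        have := hL.dist_le_mul z y
        rw [Real.dist_eq, dist_eq_norm] at this
        exact (le_abs_self _).trans this
      rw [dist_eq_norm] at hz
      have h2 : L * ‖z - y‖ ≤ ‖z - y‖ ^ 2 / (2 * t k) := by
        rw [le_div_iff₀ (by positivity)]
        nlinarith
      have h3 : 0 ≤ (D + ε) ^ 2 / 2 * t k := by positivity
      linarith
  have hlim : Tendsto (fun ε : ℝ => ENNReal.ofReal ((D + ε) ^ 2 / 2)) (𝓝[>] 0)
      (𝓝 (ENNReal.ofReal (D ^ 2 / 2))) := by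
    have : Tendsto (fun ε : ℝ => (D + ε) ^ 2 / 2) (𝓝 0) (𝓝 ((D + 0) ^ 2 / 2)) :=
      Continuous.tendsto (by fun_prop) 0
    rw [add_zero] at this
    exact (ENNReal.tendsto_ofReal this).mono_left nhdsWithin_le_nhds
  exact ge_of_tendsto hlim (eventually_mem_nhdsWithin.mono fun ε hε => key ε hε)

/-- The difference quotients of the sup-convolution of a Lipschitz function of compact support are
dominated by a constant on a bounded set. -/
theorem supConv_sub_div_le_indicator {L : ℝ≥0} (hL : LipschitzWith L f) (h0 : 0 ≤ f)
    (ht : 0 < t) (htL : 2 * L * t ≤ 1) (y : EuclideanSpace ℝ (Fin n)) :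
    ENNReal.ofReal ((supConv t f y - f y) / t) ≤
      (cthickening 1 (tsupport f)).indicator (fun _ => ENNReal.ofReal ((L : ℝ) ^ 2 / 2)) y := by
  have hlip : ∀ z, f z - f y ≤ L * ‖z - y‖ := fun z => by
    have := hL.dist_le_mul z y
    rw [Real.dist_eq, dist_eq_norm] at this
    exact (le_abs_self _).trans this
  by_cases hy : y ∈ cthickening 1 (tsupport f)
  · rw [Set.indicator_of_mem hy]
    refine ENNReal.ofReal_le_ofReal ?_
    rw [div_le_iff₀ ht, sub_le_iff_le_add]
    refine ciSup_le fun z => ?_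
    have : (L : ℝ) ^ 2 / 2 * t - (L * ‖z - y‖ - ‖z - y‖ ^ 2 / (2 * t)) =
        (L * t - ‖z - y‖) ^ 2 / (2 * t) := by field_simp; ring
    have : 0 ≤ (L * t - ‖z - y‖) ^ 2 / (2 * t) := by positivity
    linarith [hlip z]
  · rw [Set.indicator_of_notMem hy]
    refine (ENNReal.ofReal_eq_zero.2 ?_).le
    refine div_nonpos_of_nonpos_of_nonneg (sub_nonpos.2 (ciSup_le fun z => ?_)) ht.le
    have hsq : 0 ≤ ‖z - y‖ ^ 2 / (2 * t) := by positivity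
    by_cases hz : z ∈ tsupport f
    · have h1 : 1 < ‖z - y‖ := by
        by_contra! hle
        refine hy (mem_cthickening_of_dist_le y z 1 _ hz ?_)
        rwa [dist_comm, dist_eq_norm]
      have h2 : L * ‖z - y‖ ≤ ‖z - y‖ ^ 2 / (2 * t) := by
        rw [le_div_iff₀ (by positivity)]
        nlinarith
      linarith [hlip z]
    · have := h0 y
      rw [image_eq_zero_of_notMem_tsupport hz]
      simp only [Pi.zero_apply] at this
      linarith

end supConv

/-- The Pólya–Szegő inequality for Lipschitz functions of compact support. Half of the energy of
`f` is the derivative at `t = 0` of the integral of the sup-convolution of `f`, by dominated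
convergence; half of the energy of the rearrangement is at most the corresponding lower derivative,
by Fatou's lemma. Rearrangement preserves the integral and does not increase that of the
sup-convolution. -/
theorem polya_szego {n : ℕ} (hn : 1 ≤ n) {f : EuclideanSpace ℝ (Fin n) → ℝ} (hf : IsBump f)
    {L : ℝ≥0} (hL : LipschitzWith L f) :
    ∫⁻ y, ENNReal.ofReal (‖fderiv ℝ (schwarz f) y‖ ^ 2) ≤
      ∫⁻ y, ENNReal.ofReal (‖fderiv ℝ f y‖ ^ 2) := by
  obtain ⟨B, -, hB⟩ := hf.exists_bound
  have hBs := hf.schwarz_le hn hB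
  have hLs := hf.lipschitzWith_schwarz hn hL
  set t : ℕ → ℝ := fun k => (2 * (L : ℝ) + 1)⁻¹ * (1 / ((k : ℝ) + 1)) with ht_def
  have hL1 : 0 < 2 * (L : ℝ) + 1 := by positivity
  have ht : ∀ k, 0 < t k := fun k => by simp only [ht_def]; positivity
  have ht0 : Tendsto t atTop (𝓝 0) := by
    have := (tendsto_one_div_add_atTop_nhds_zero_nat (𝕜 := ℝ)).const_mul (2 * (L : ℝ) + 1)⁻¹
    rwa [mul_zero] at this
  have htL : ∀ k, 2 * L * t k ≤ 1 := fun k => by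
    have h1 : 1 / ((k : ℝ) + 1) ≤ 1 := by
      rw [div_le_one (by positivity)]; linarith [(Nat.cast_nonneg k : (0 : ℝ) ≤ k)]
    have h2 : t k ≤ (2 * (L : ℝ) + 1)⁻¹ * 1 := by simp only [ht_def]; gcongr
    calc 2 * L * t k ≤ (2 * L + 1) * ((2 * (L : ℝ) + 1)⁻¹ * 1) := by
          gcongr
          linarith
      _ = 1 := by field_simp
  -- the increments of the integrals of the sup-convolutions
  have hdiff : ∀ (g : EuclideanSpace ℝ (Fin n) → ℝ), Continuous g → (0 ≤ g) →
      (∀ y, g y ≤ B) → (∫⁻ y, ENNReal.ofReal (g y) ≠ ⊤) → ∀ k,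
      ∫⁻ y, ENNReal.ofReal ((supConv (t k) g y - g y) / t k) =
        ((∫⁻ y, ENNReal.ofReal (supConv (t k) g y)) - ∫⁻ y, ENNReal.ofReal (g y)) *
          ENNReal.ofReal (t k)⁻¹ := by
    intro g hg hg0 hgB hgI k
    rw [← lintegral_sub hg.measurable.ennreal_ofReal hgI
      (Eventually.of_forall fun y => ENNReal.ofReal_le_ofReal (self_le_supConv (ht k) hgB y)),
      ← lintegral_mul_const' _ _ ENNReal.ofReal_ne_top]
    refine lintegral_congr fun y => ?_
    rw [div_eq_mul_inv, ENNReal.ofReal_mul (sub_nonneg.2 (self_le_supConv (ht k) hgB y)),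
      ENNReal.ofReal_sub _ (hg0 y)]
  have hfI : ∫⁻ y, ENNReal.ofReal (f y) ≠ ⊤ := by
    rw [← ofReal_integral_eq_lintegral_ofReal
      (hf.continuous.integrable_of_hasCompactSupport hf.compact) (Eventually.of_forall hf.nonneg)]
    exact ENNReal.ofReal_ne_top
  have hI : ∫⁻ y, ENNReal.ofReal (schwarz f y) = ∫⁻ y, ENNReal.ofReal (f y) := by
    simpa using lintegral_schwarz_rpow hn hf.rearrangeable hf.continuous.aemeasurable one_pos
  have hstep : ∀ k, ∫⁻ y, ENNReal.ofReal ((supConv (t k) (schwarz f) y - schwarz f y) / t k) ≤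
      ∫⁻ y, ENNReal.ofReal ((supConv (t k) f y - f y) / t k) := by
    intro k
    rw [hdiff _ hLs.continuous (hf.schwarz_nonneg hn) hBs (hI ▸ hfI) k,
      hdiff f hf.continuous hf.nonneg hB hfI k, hI]
    exact mul_le_mul_left (tsub_le_tsub_right (lintegral_supConv_schwarz_le hn hf (ht k) hB) _) _
  have hmain : ∫⁻ y, ENNReal.ofReal (‖fderiv ℝ (schwarz f) y‖ ^ 2 / 2) ≤
      ∫⁻ y, ENNReal.ofReal (‖fderiv ℝ f y‖ ^ 2 / 2) := by
    calc _ ≤ ∫⁻ y, liminf (fun k =>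
            ENNReal.ofReal ((supConv (t k) (schwarz f) y - schwarz f y) / t k)) atTop := by
          refine lintegral_mono_ae ?_
          filter_upwards [hLs.ae_differentiableAt] with y hy
          exact le_liminf_supConv_sub_div hBs hy ht ht0
      _ ≤ liminf (fun k => ∫⁻ y,
            ENNReal.ofReal ((supConv (t k) (schwarz f) y - schwarz f y) / t k)) atTop :=
          lintegral_liminf_le fun k => (((measurable_supConv (ht k) hBs).sub
            hLs.continuous.measurable).div_const _).ennreal_ofReal
      _ ≤ liminf (fun k => ∫⁻ y, ENNReal.ofReal ((supConv (t k) f y - f y) / t k)) atTop :=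
          liminf_le_liminf (Eventually.of_forall hstep)
      _ ≤ limsup (fun k => ∫⁻ y, ENNReal.ofReal ((supConv (t k) f y - f y) / t k)) atTop :=
          liminf_le_limsup
      _ ≤ ∫⁻ y, limsup (fun k => ENNReal.ofReal ((supConv (t k) f y - f y) / t k)) atTop := by
          refine limsup_lintegral_le _ (fun k => (((measurable_supConv (ht k) hB).sub
            hf.continuous.measurable).div_const _).ennreal_ofReal)
            (fun k => Eventually.of_forall fun y =>
              supConv_sub_div_le_indicator hL hf.nonneg (ht k) (htL k) y) ?_
          rw [lintegral_indicator_const isClosed_cthickening.measurableSet]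
          exact ENNReal.mul_ne_top ENNReal.ofReal_ne_top
            (IsCompact.cthickening hf.compact).measure_lt_top.ne
      _ ≤ _ := by
          refine lintegral_mono_ae ?_
          filter_upwards [hL.ae_differentiableAt] with y hy
          exact limsup_supConv_sub_div_le hL hy ht ht0
  have e : ∀ x : ℝ, ENNReal.ofReal (x ^ 2 / 2) = ENNReal.ofReal (x ^ 2) * ENNReal.ofReal (1 / 2) :=
    fun x => by rw [← ENNReal.ofReal_mul (sq_nonneg x)]; ring_nf
  simp only [e] at hmain
  rw [lintegral_mul_const' _ _ ENNReal.ofReal_ne_top,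
    lintegral_mul_const' _ _ ENNReal.ofReal_ne_top] at hmain
  exact (ENNReal.mul_le_mul_iff_left (by simp) ENNReal.ofReal_ne_top).1 hmain

/-! ### The Dirichlet energy of symmetrized Lipschitz functions -/

section FlatProduct

variable {n : ℕ} {X : Type*} [NormedAddCommGroup X]
  {f : X × EuclideanSpace ℝ (Fin n) → ℝ}

theorem isBump_fibre (hc : Continuous f) (hf : HasCompactSupport f) (h0 : 0 ≤ f) (x : X) :
    IsBump fun y => f (x, y) := by
  refine ⟨by fun_prop, ?_, fun y => h0 (x, y)⟩
  refine HasCompactSupport.intro (hf.image continuous_snd) fun y hy => ?_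
  by_contra h
  exact hy ⟨(x, y), subset_tsupport f h, rfl⟩

/-- The Steiner symmetrization of a Lipschitz function of compact support is Lipschitz. -/
theorem lipschitzWith_steiner (hn : 1 ≤ n) {L : ℝ≥0} (hL : LipschitzWith L f)
    (hf : HasCompactSupport f) (h0 : 0 ≤ f) : LipschitzWith (2 * L) (steiner f) := by
  have hb := isBump_fibre hL.continuous hf h0
  refine LipschitzWith.of_le_add_mul _ ?_
  rintro ⟨x, y⟩ ⟨x', y'⟩
  have h1 : steiner f (x, y) ≤ steiner f (x', y) + L * dist x x' := by
    refine (hb x).schwarz_le_add hn (hb x') (fun y => ?_) y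
    have := hL.dist_le_mul (x, y) (x', y)
    rw [Real.dist_eq, Prod.dist_eq, dist_self, max_eq_left dist_nonneg] at this
    linarith [le_abs_self (f (x, y) - f (x', y))]
  have hLy : LipschitzWith L fun y => f (x', y) := by
    refine LipschitzWith.of_dist_le_mul fun y y' => ?_
    have := hL.dist_le_mul (x', y) (x', y')
    rwa [Prod.dist_eq, dist_self, max_eq_right dist_nonneg] at this
  have h2 : steiner f (x', y) ≤ steiner f (x', y') + L * dist y y' := by
    have := ((hb x').lipschitzWith_schwarz hn hLy).dist_le_mul y y'
    rw [Real.dist_eq] at this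
    rw [steiner_eq_schwarz, steiner_eq_schwarz]
    linarith [le_abs_self (schwarz (fun y => f (x', y)) y - schwarz (fun y => f (x', y)) y')]
  have h3 : dist x x' ≤ dist (x, y) (x', y') := le_max_left _ _
  have h4 : dist y y' ≤ dist (x, y) (x', y') := le_max_right _ _
  have h5 := mul_le_mul_of_nonneg_left h3 L.2
  have h6 := mul_le_mul_of_nonneg_left h4 L.2
  push_cast
  simp only [NNReal.val_eq_coe] at h5 h6
  linarith

variable [NormedSpace ℝ X]

theorem tendsto_slope_sq {g : X × EuclideanSpace ℝ (Fin n) → ℝ}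
    {q : X × EuclideanSpace ℝ (Fin n)} (hg : DifferentiableAt ℝ g q) (v : X) :
    Tendsto (fun k : ℕ => ENNReal.ofReal ((g (q.1 + (1 / ((k : ℝ) + 1)) • v, q.2) - g q) ^ 2) *
        ENNReal.ofReal (((k : ℝ) + 1) ^ 2)) atTop
      (𝓝 (ENNReal.ofReal (fderiv ℝ g q (v, 0) ^ 2))) := by
  have hline := (hg.hasFDerivAt.hasLineDerivAt (v, 0)).tendsto_slope_zero
  have h1 : Tendsto (fun k : ℕ => 1 / ((k : ℝ) + 1)) atTop (𝓝[≠] 0) :=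
    tendsto_nhdsWithin_iff.2 ⟨tendsto_one_div_add_atTop_nhds_zero_nat,
      Eventually.of_forall fun k => by simp only [Set.mem_compl_iff, Set.mem_singleton_iff]; positivity⟩
  have h2 := ENNReal.tendsto_ofReal ((hline.comp h1).pow 2)
  refine h2.congr fun k => ?_
  have hk : (0 : ℝ) < (k : ℝ) + 1 := by positivity
  rw [← ENNReal.ofReal_mul (sq_nonneg _)]
  congr 1
  have : q + (1 / ((k : ℝ) + 1)) • ((v, 0) : X × EuclideanSpace ℝ (Fin n)) =
      (q.1 + (1 / ((k : ℝ) + 1)) • v, q.2) := by ext1 <;> simp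
  simp only [Function.comp_apply, this, smul_eq_mul]
  field_simp

/-- The squared length of the gradient along a fibre, in coordinates. -/
theorem sum_fderiv_fibre_sq {g : X × EuclideanSpace ℝ (Fin n) → ℝ}
    {x : X} {y : EuclideanSpace ℝ (Fin n)} (hg : DifferentiableAt ℝ g (x, y)) :
    ∑ j, fderiv ℝ g (x, y) (0, EuclideanSpace.basisFun (Fin n) ℝ j) ^ 2 =
      ‖fderiv ℝ (fun y => g (x, y)) y‖ ^ 2 := by
  have h1 : HasFDerivAt (fun y => g (x, y))
      ((fderiv ℝ g (x, y)).comp (ContinuousLinearMap.inr ℝ X _)) y :=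
    hg.hasFDerivAt.comp y (hasFDerivAt_prodMk_right x y)
  set l := (fderiv ℝ g (x, y)).comp (ContinuousLinearMap.inr ℝ X (EuclideanSpace ℝ (Fin n)))
  rw [h1.fderiv, ← (InnerProductSpace.toDual ℝ (EuclideanSpace ℝ (Fin n))).symm.norm_map l,
    ← (EuclideanSpace.basisFun (Fin n) ℝ).sum_sq_norm_inner_left]
  refine Finset.sum_congr rfl fun j _ => ?_
  rw [InnerProductSpace.toDual_symm_apply, Real.norm_eq_abs, sq_abs]
  rfl

variable [FiniteDimensional ℝ X] [MeasurableSpace X] [BorelSpace X]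
  (τ : Measure X) [τ.IsAddHaarMeasure]

/-- Symmetrization does not increase the derivatives in the directions of the base: it contracts
`L²`-distances between fibres, hence difference quotients. -/
theorem ae_lintegral_fderiv_steiner_base_le (hn : 1 ≤ n) {L : ℝ≥0} (hL : LipschitzWith L f)
    (hf : HasCompactSupport f) (h0 : 0 ≤ f) :
    ∀ᵐ x ∂τ, ∀ v : X, ∫⁻ y, ENNReal.ofReal (fderiv ℝ (steiner f) (x, y) (v, 0) ^ 2) ≤
      ∫⁻ y, ENNReal.ofReal (fderiv ℝ f (x, y) (v, 0) ^ 2) := by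
  have hb := isBump_fibre hL.continuous hf h0
  have hLs := lipschitzWith_steiner hn hL hf h0
  filter_upwards [Measure.ae_ae_of_ae_prod (hL.ae_differentiableAt (μ := τ.prod volume)),
    Measure.ae_ae_of_ae_prod (hLs.ae_differentiableAt (μ := τ.prod volume))] with x hx hxs v
  have hfin : ∀ x, ∫⁻ y, ENNReal.ofReal (f (x, y) ^ (2 : ℝ)) ≠ ⊤ := fun x => by
    have := lintegral_sq_ne_top_of_memLp
      ((hb x).continuous.memLp_of_hasCompactSupport (μ := volume) (p := 2) (hb x).compact)
    simpa using this
  set K := Prod.snd '' tsupport f with hK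
  have hKc : IsCompact K := hf.image continuous_snd
  have hfK : ∀ x, ∀ y ∉ K, f (x, y) = 0 := fun x y hy => by
    by_contra h
    exact hy ⟨(x, y), subset_tsupport f h, rfl⟩
  -- For `f`, the difference quotients converge in `L²` of the fibre, by domination.
  have hlim : Tendsto (fun k : ℕ => ∫⁻ y, ENNReal.ofReal
        ((f (x + (1 / ((k : ℝ) + 1)) • v, y) - f (x, y)) ^ 2) * ENNReal.ofReal (((k : ℝ) + 1) ^ 2))
      atTop (𝓝 (∫⁻ y, ENNReal.ofReal (fderiv ℝ f (x, y) (v, 0) ^ 2))) := by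
    refine tendsto_lintegral_of_dominated_convergence
      (K.indicator fun _ => ENNReal.ofReal ((L * ‖v‖) ^ 2)) (fun k => ?_) (fun k => ?_) ?_ ?_
    · have h1 := (hb (x + (1 / ((k : ℝ) + 1)) • v)).continuous
      have h2 := (hb x).continuous
      exact (((h1.sub h2).pow 2).measurable.ennreal_ofReal).mul_const _
    · refine Eventually.of_forall fun y => ?_
      dsimp only
      by_cases hy : y ∈ K
      · rw [Set.indicator_of_mem hy, ← ENNReal.ofReal_mul (sq_nonneg _)]
        refine ENNReal.ofReal_le_ofReal ?_
        have hk : (0 : ℝ) < (k : ℝ) + 1 := by positivity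
        have h1 := hL.dist_le_mul (x + (1 / ((k : ℝ) + 1)) • v, y) (x, y)
        rw [Real.dist_eq, Prod.dist_eq, dist_self, max_eq_left dist_nonneg, dist_eq_norm,
          add_sub_cancel_left, norm_smul, Real.norm_of_nonneg (by positivity)] at h1
        have h2 : |f (x + (1 / ((k : ℝ) + 1)) • v, y) - f (x, y)| * ((k : ℝ) + 1) ≤ L * ‖v‖ := by
          calc _ ≤ (L * (1 / ((k : ℝ) + 1) * ‖v‖)) * ((k : ℝ) + 1) := by gcongr
            _ = L * ‖v‖ := by field_simp
        rw [← sq_abs, ← mul_pow]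
        gcongr
      · simp [hfK _ y hy]
    · rw [lintegral_indicator_const hKc.measurableSet]
      exact ENNReal.mul_ne_top ENNReal.ofReal_ne_top hKc.measure_lt_top.ne
    · filter_upwards [hx] with y hy using tendsto_slope_sq hy v
  calc ∫⁻ y, ENNReal.ofReal (fderiv ℝ (steiner f) (x, y) (v, 0) ^ 2)
      ≤ ∫⁻ y, liminf (fun k : ℕ => ENNReal.ofReal
        ((steiner f (x + (1 / ((k : ℝ) + 1)) • v, y) - steiner f (x, y)) ^ 2) *
          ENNReal.ofReal (((k : ℝ) + 1) ^ 2)) atTop := by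
        refine lintegral_mono_ae ?_
        filter_upwards [hxs] with y hy
        exact (tendsto_slope_sq hy v).liminf_eq.ge
    _ ≤ liminf (fun k : ℕ => ∫⁻ y, ENNReal.ofReal
        ((steiner f (x + (1 / ((k : ℝ) + 1)) • v, y) - steiner f (x, y)) ^ 2) *
          ENNReal.ofReal (((k : ℝ) + 1) ^ 2)) atTop := by
        refine lintegral_liminf_le fun k => ?_
        have h1 : Continuous fun y => steiner f (x + (1 / ((k : ℝ) + 1)) • v, y) :=
          hLs.continuous.comp (by fun_prop)
        have h2 : Continuous fun y => steiner f (x, y) := hLs.continuous.comp (by fun_prop)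
        exact (((h1.sub h2).pow 2).measurable.ennreal_ofReal).mul_const _
    _ ≤ liminf (fun k : ℕ => ∫⁻ y, ENNReal.ofReal
        ((f (x + (1 / ((k : ℝ) + 1)) • v, y) - f (x, y)) ^ 2) *
          ENNReal.ofReal (((k : ℝ) + 1) ^ 2)) atTop := by
        refine liminf_le_liminf (Eventually.of_forall fun k => ?_)
        rw [lintegral_mul_const' _ _ ENNReal.ofReal_ne_top,
          lintegral_mul_const' _ _ ENNReal.ofReal_ne_top]
        refine mul_le_mul_left ?_ _
        set x' := x + (1 / ((k : ℝ) + 1)) • v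
        simp only [steiner_eq_schwarz]
        exact lintegral_schwarz_sub_sq_le hn (hb x').rearrangeable (hb x).rearrangeable
          (hb x').continuous.measurable (hb x).continuous.measurable (hb x').nonneg (hb x).nonneg
          (hfin x') (hfin x)
    _ = _ := hlim.liminf_eq

/-- Symmetrization does not increase the energy in the directions of the fibres, by the Pólya–Szegő
inequality on almost every fibre. -/
theorem ae_lintegral_fderiv_steiner_fibre_le (hn : 1 ≤ n) {L : ℝ≥0} (hL : LipschitzWith L f)
    (hf : HasCompactSupport f) (h0 : 0 ≤ f) :
    ∀ᵐ x ∂τ, ∫⁻ y, ENNReal.ofReal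
        (∑ j, fderiv ℝ (steiner f) (x, y) (0, EuclideanSpace.basisFun (Fin n) ℝ j) ^ 2) ≤
      ∫⁻ y, ENNReal.ofReal (∑ j, fderiv ℝ f (x, y) (0, EuclideanSpace.basisFun (Fin n) ℝ j) ^ 2) := by
  have hb := isBump_fibre hL.continuous hf h0
  have hLs := lipschitzWith_steiner hn hL hf h0
  filter_upwards [Measure.ae_ae_of_ae_prod (hL.ae_differentiableAt (μ := τ.prod volume)),
    Measure.ae_ae_of_ae_prod (hLs.ae_differentiableAt (μ := τ.prod volume))] with x hx hxs
  have hLy : LipschitzWith L fun y => f (x, y) := by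
    refine LipschitzWith.of_dist_le_mul fun y y' => ?_
    have := hL.dist_le_mul (x, y) (x, y')
    rwa [Prod.dist_eq, dist_self, max_eq_right dist_nonneg] at this
  refine (lintegral_congr_ae (hxs.mono fun y hy => ?_)).trans_le
    ((polya_szego hn (hb x) hLy).trans_eq (lintegral_congr_ae (hx.mono fun y hy => ?_)))
  · simp only [sum_fderiv_fibre_sq hy, steiner_eq_schwarz]
  · simp only [sum_fderiv_fibre_sq hy]

end FlatProduct

/-! ### Riemannian metrics in charts -/

section Chart

variable {E : Type*} [NormedAddCommGroup E] [NormedSpace ℝ E] {H : Type*} [TopologicalSpace H]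
  {I : ModelWithCorners ℝ E H} [I.Boundaryless] {N : Type*} [TopologicalSpace N] [ChartedSpace H N]
  [IsManifold I ∞ N]

theorem mdifferentiableAt_extChartAt_symm {p : N} {z : E} (hz : z ∈ (extChartAt I p).target) :
    MDifferentiableAt 𝓘(ℝ, E) I (extChartAt I p).symm z :=
  have : IsManifold I 1 N := IsManifold.of_le (n := ∞) (by exact_mod_cast le_top)
  (mdifferentiableOn_extChartAt_symm z hz).mdifferentiableAt
    ((isOpen_extChartAt_target p).mem_nhds hz)

theorem mfderiv_extChartAt_symm_isInvertible {p : N} {z : E}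
    (hz : z ∈ (extChartAt I p).target) :
    (mfderiv 𝓘(ℝ, E) I (extChartAt I p).symm z).IsInvertible := by
  have : IsManifold I 1 N := IsManifold.of_le (n := ∞) (by exact_mod_cast le_top)
  have := isInvertible_mfderivWithin_extChartAt_symm hz
  rwa [I.range_eq_univ, mfderivWithin_univ] at this

theorem continuousOn_mfderiv_extChartAt_symm (p : N) (v : E) :
    ContinuousOn (fun z => (⟨(extChartAt I p).symm z,
      mfderiv 𝓘(ℝ, E) I (extChartAt I p).symm z v⟩ : TangentBundle I N))
      (extChartAt I p).target := by
  have ho := isOpen_extChartAt_target (I := I) p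
  have h := (contMDiffOn_extChartAt_symm (I := I) (n := ∞) p).continuousOn_tangentMapWithin
    (by exact_mod_cast le_top) ho.uniqueMDiffOn
  have h2 : Continuous fun z : E => (⟨z, v⟩ : TangentBundle 𝓘(ℝ, E) E) := by
    have := (tangentBundleModelSpaceHomeomorph 𝓘(ℝ, E)).symm.continuous.comp
      (Continuous.prodMk continuous_id (continuous_const (y := v)))
    exact this
  have h3 := h.comp h2.continuousOn (s := (extChartAt I p).target) fun z hz => hz
  refine h3.congr fun z hz => ?_
  simp only [Function.comp_apply, tangentMapWithin, mfderivWithin_of_isOpen ho hz]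

/-- The metric field underlying a Riemannian metric. -/
noncomputable def metricField (gM : ContMDiffRiemannianMetric I ∞ E (fun x : N => TangentSpace I x)) :
    MetricField I N := fun x v w => gM.inner x v w

variable (gM : ContMDiffRiemannianMetric I ∞ E (fun x : N => TangentSpace I x))

theorem continuousOn_metric_mfderiv (p : N) (v w : E) :
    ContinuousOn (fun z => metricField gM ((extChartAt I p).symm z)
      (mfderiv 𝓘(ℝ, E) I (extChartAt I p).symm z v) (mfderiv 𝓘(ℝ, E) I (extChartAt I p).symm z w))
      (extChartAt I p).target := by
  let _ : RiemannianBundle (fun x : N => TangentSpace I x) := ⟨gM.toRiemannianMetric⟩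
  have : IsContinuousRiemannianBundle E (fun x : N => TangentSpace I x) :=
    ⟨⟨gM.inner, gM.contMDiff.continuous, fun _ _ _ ↦ rfl⟩⟩
  exact ContinuousOn.inner_bundle (continuousOn_mfderiv_extChartAt_symm p v)
    (continuousOn_mfderiv_extChartAt_symm p w)

/-- The derivative of the inverse of the chart at `p`, as a map on the model space. -/
noncomputable def chartD (I : ModelWithCorners ℝ E H) (p : N) (z : E) : E →L[ℝ] E :=
  mfderiv 𝓘(ℝ, E) I (extChartAt I p).symm z

/-- The transition map from the chart at `p` to the chart at `q`. -/
noncomputable def transition (I : ModelWithCorners ℝ E H) (p q : N) (z : E) : E :=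
  extChartAt I q ((extChartAt I p).symm z)

/-- The set of the points of the chart at `p` which lie in the domain of the chart at `q`. -/
def overlap (I : ModelWithCorners ℝ E H) (p q : N) : Set E :=
  (extChartAt I p).target ∩ (extChartAt I p).symm ⁻¹' (extChartAt I q).source

theorem isOpen_overlap (p q : N) : IsOpen (overlap I p q) :=
  (continuousOn_extChartAt_symm p).isOpen_inter_preimage (isOpen_extChartAt_target p)
    (isOpen_extChartAt_source q)

theorem transition_mem_overlap {p q : N} {z : E} (hz : z ∈ overlap I p q) :
    transition I p q z ∈ overlap I q p := by
  refine ⟨(extChartAt I q).map_source hz.2, ?_⟩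
  rw [Set.mem_preimage, transition, (extChartAt I q).left_inv hz.2]
  exact (extChartAt I p).map_target hz.1

theorem symm_transition {p q : N} {z : E} (hz : z ∈ overlap I p q) :
    (extChartAt I q).symm (transition I p q z) = (extChartAt I p).symm z :=
  (extChartAt I q).left_inv hz.2

theorem transition_transition {p q : N} {z : E} (hz : z ∈ overlap I p q) :
    transition I q p (transition I p q z) = z := by
  rw [transition, symm_transition hz, (extChartAt I p).right_inv hz.1]

theorem contDiffOn_transition (p q : N) :
    ContDiffOn ℝ ∞ (transition I p q) (overlap I p q) := by
  rw [← contMDiffOn_iff_contDiffOn]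
  have h1 := contMDiffOn_extChartAt_symm (I := I) (n := ∞) p
  have h2 : ContMDiffOn I 𝓘(ℝ, E) ∞ (extChartAt I q) (extChartAt I q).source := by
    rw [extChartAt_source]
    exact contMDiffOn_extChartAt
  exact h2.comp (h1.mono Set.inter_subset_left) fun z hz => hz.2

theorem chartD_transition {p q : N} {z : E} (hz : z ∈ overlap I p q) :
    chartD I p z = (chartD I q (transition I p q z)).comp (fderiv ℝ (transition I p q) z) := by
  have h1 := (mdifferentiableAt_extChartAt_symm (transition_mem_overlap hz).1).hasMFDerivAt
  have h2 := (((contDiffOn_transition p q).contDiffAt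
    ((isOpen_overlap p q).mem_nhds hz)).differentiableAt (by simp)).mdifferentiableAt.hasMFDerivAt
  have h3 := (h1.comp z h2).congr_of_eventuallyEq (f₁ := (extChartAt I p).symm)
    (Filter.eventuallyEq_of_mem ((isOpen_overlap p q).mem_nhds hz) fun w hw =>
      (symm_transition hw).symm)
  have h4 := h3.mfderiv
  rw [mfderiv_eq_fderiv] at h4
  exact h4

theorem chartD_isInvertible {p : N} {z : E} (hz : z ∈ (extChartAt I p).target) :
    (chartD I p z).IsInvertible := mfderiv_extChartAt_symm_isInvertible hz

theorem metricField_congr {x y : N} (h : x = y) (v w : E) :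
    metricField gM x v w = metricField gM y v w := by subst h; rfl

/-- The metric at `x` as a bilinear map on the model space. -/
noncomputable def metricBilin (x : N) : E →L[ℝ] E →L[ℝ] ℝ := gM.inner x

theorem metricField_eq (x : N) (v w : E) : metricField gM x v w = metricBilin gM x v w := rfl

theorem metricBilin_symm (x : N) (v w : E) : metricBilin gM x v w = metricBilin gM x w v :=
  gM.symm x v w

theorem metricBilin_pos (x : N) {v : E} (hv : v ≠ 0) : 0 < metricBilin gM x v v :=
  gM.pos x v hv

theorem metricBilin_self_nonneg (x : N) (v : E) : 0 ≤ metricBilin gM x v v := by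
  by_cases hv : v = 0
  · simp [hv]
  · exact (metricBilin_pos gM x hv).le

section Gram

variable {ι : Type*} [Fintype ι] [DecidableEq ι] (b : Module.Basis ι ℝ E)

theorem gramMatrix_apply (p : N) (z : E) (i j : ι) : gramMatrix (metricField gM) b p z i j =
    metricBilin gM ((extChartAt I p).symm z) (chartD I p z (b i)) (chartD I p z (b j)) := rfl

theorem metricBilin_chartD (p : N) (z v w : E) :
    metricBilin gM ((extChartAt I p).symm z) (chartD I p z v) (chartD I p z w) =
      (b.repr v : ι → ℝ) ⬝ᵥ (gramMatrix (metricField gM) b p z).mulVec (b.repr w) := by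
  conv_lhs => rw [← b.sum_repr v, ← b.sum_repr w]
  simp only [map_sum, map_smul, sum_apply, smul_apply,
    dotProduct, Matrix.mulVec, gramMatrix_apply, smul_eq_mul, Finset.mul_sum]
  rw [Finset.sum_comm]
  refine Finset.sum_congr rfl fun i _ => Finset.sum_congr rfl fun j _ => ?_
  ring

theorem gramMatrix_posDef {p : N} {z : E} (hz : z ∈ (extChartAt I p).target) :
    (gramMatrix (metricField gM) b p z).PosDef := by
  refine Matrix.PosDef.of_dotProduct_mulVec_pos ?_ fun x hx => ?_
  · ext i j
    rw [Matrix.conjTranspose_apply, gramMatrix_apply, gramMatrix_apply, metricBilin_symm]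
    simp
  · set v : E := b.equivFun.symm x with hv
    have hxv : (b.repr v : ι → ℝ) = x := by
      rw [hv, ← b.equivFun_apply, LinearEquiv.apply_symm_apply]
    have h := metricBilin_chartD gM b p z v v
    rw [hxv] at h
    rw [star_trivial, ← h]
    refine metricBilin_pos gM _ fun h0 => hx ?_
    have : v = 0 := (chartD_isInvertible hz).injective (by rw [h0, map_zero])
    rw [← hxv, this]
    simp

theorem continuousOn_gramMatrix (p : N) (i j : ι) :
    ContinuousOn (fun z => gramMatrix (metricField gM) b p z i j) (extChartAt I p).target :=
  continuousOn_metric_mfderiv gM p (b i) (b j)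

theorem continuousOn_gramMatrix' (p : N) :
    ContinuousOn (gramMatrix (metricField gM) b p) (extChartAt I p).target :=
  continuousOn_pi.2 fun i => continuousOn_pi.2 fun j => continuousOn_gramMatrix gM b p i j

theorem continuousOn_sqrt_det_gramMatrix (p : N) :
    ContinuousOn (fun z => Real.sqrt (gramMatrix (metricField gM) b p z).det)
      (extChartAt I p).target :=
  ((continuous_id.matrix_det).comp_continuousOn (continuousOn_gramMatrix' gM b p)).sqrt

theorem sqrt_det_gramMatrix_pos {p : N} {z : E} (hz : z ∈ (extChartAt I p).target) :
    0 < Real.sqrt (gramMatrix (metricField gM) b p z).det :=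
  Real.sqrt_pos.2 (gramMatrix_posDef gM b hz).det_pos

theorem gramMatrix_transition {p q : N} {z : E} (hz : z ∈ overlap I p q) :
    gramMatrix (metricField gM) b p z =
      (LinearMap.toMatrix b b (fderiv ℝ (transition I p q) z).toLinearMap).transpose *
        gramMatrix (metricField gM) b q (transition I p q z) *
          LinearMap.toMatrix b b (fderiv ℝ (transition I p q) z).toLinearMap := by
  ext i j
  rw [gramMatrix_apply, chartD_transition hz, ← metricField_eq,
    metricField_congr gM (symm_transition hz).symm, metricField_eq]
  simp only [ContinuousLinearMap.comp_apply]
  rw [metricBilin_chartD gM b]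
  simp only [dotProduct, Matrix.mulVec, Matrix.mul_apply, Matrix.transpose_apply,
    LinearMap.toMatrix_apply, Finset.mul_sum, Finset.sum_mul, ContinuousLinearMap.coe_coe]
  rw [Finset.sum_comm]
  refine Finset.sum_congr rfl fun k _ => Finset.sum_congr rfl fun l _ => ?_
  ring

theorem sqrt_det_gramMatrix_transition {p q : N} {z : E} (hz : z ∈ overlap I p q) :
    Real.sqrt (gramMatrix (metricField gM) b p z).det =
      |(fderiv ℝ (transition I p q) z).det| *
        Real.sqrt (gramMatrix (metricField gM) b q (transition I p q z)).det := by
  rw [gramMatrix_transition gM b hz, Matrix.det_mul, Matrix.det_mul, Matrix.det_transpose,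
    LinearMap.det_toMatrix, mul_right_comm, ← sq, Real.sqrt_mul (sq_nonneg _), Real.sqrt_sq_eq_abs]

end Gram

end Chart

/-! ### The Riemannian volume in charts -/

/-- A measure is the supremum of its restrictions to the sets of a countable cover. -/
theorem iSup_restrict_eq {α ι : Type*} [MeasurableSpace α] (μ : Measure α) {U : ι → Set α}
    {s : Set ι} (hs : s.Countable)
    (hU : ⋃ i ∈ s, U i = Set.univ) : ⨆ i, μ.restrict (U i) = μ := by
  have hle : ⨆ i, μ.restrict (U i) ≤ μ := iSup_le fun i => Measure.restrict_le_self
  refine le_antisymm hle ?_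
  have : Countable s := hs.to_subtype
  have hU' : ⋃ i : s, U i = Set.univ := by rw [← hU, Set.iUnion_subtype]
  refine le_of_eq ((Measure.ext_iff_of_iUnion_eq_univ hU').2 fun i => le_antisymm ?_ ?_)
  · have h := Measure.restrict_mono (s := U i) subset_rfl
      (le_iSup (fun i => μ.restrict (U i)) i.1)
    refine le_trans (Measure.le_iff.2 fun t ht => ?_) h
    rw [Measure.restrict_apply ht, Measure.restrict_apply ht]
    have : t ∩ U i = t ∩ U i ∩ U i := by rw [Set.inter_assoc, Set.inter_self]
    conv_lhs => rw [this]
    exact Measure.le_restrict_apply _ _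
  · exact Measure.restrict_mono subset_rfl hle

/-- Measures on the sets of a cover which agree on the overlaps are the restrictions of their
supremum. -/
theorem iSup_restrict_of_compatible {α ι : Type*} [MeasurableSpace α] {μ : ι → Measure α}
    {U : ι → Set α} {s : Set ι} (hs : s.Countable) (hU : ⋃ i ∈ s, U i = Set.univ)
    (hm : ∀ i, MeasurableSet (U i)) (hμ : ∀ i, μ i (U i)ᶜ = 0)
    (h : ∀ i j, (μ i).restrict (U j) = (μ j).restrict (U i)) (i : ι) :
    (⨆ j, μ j).restrict (U i) = μ i := by
  rcases s.eq_empty_or_nonempty with rfl | hne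
  · have : IsEmpty α := by
      rw [← Set.univ_eq_empty_iff, ← hU]; simp
    exact Measure.ext fun t _ => by rw [Set.eq_empty_of_isEmpty t]; simp
  obtain ⟨e, he⟩ := hs.exists_eq_range hne
  have hcov : ⋃ k, U (e k) = Set.univ := by
    rw [← hU, he, Set.biUnion_range]
  -- Glue the measures along a partition which refines the cover.
  set A : ℕ → Set α := disjointed fun k => U (e k) with hA
  have hAm : ∀ k, MeasurableSet (A k) := fun k => .disjointed (fun k => hm _) k
  have hAcov : ⋃ k, A k = Set.univ := by rw [hA, iUnion_disjointed, hcov]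
  have hAU : ∀ k, A k ⊆ U (e k) := fun k => disjointed_subset _ k
  set ν : Measure α := Measure.sum fun k => (μ (e k)).restrict (A k) with hν
  have hself : ∀ j, (μ j).restrict (U j) = μ j := fun j =>
    Measure.restrict_eq_self_of_ae_mem (mem_ae_iff.2 (hμ j))
  have hνU : ∀ j, ν.restrict (U j) = μ j := by
    intro j
    rw [hν, Measure.restrict_sum _ (hm j)]
    have : ∀ k, ((μ (e k)).restrict (A k)).restrict (U j) = (μ j).restrict (A k) := by
      intro k
      have h1 : U j ∩ A k = A k ∩ U j := Set.inter_comm _ _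
      rw [Measure.restrict_restrict (hm j), h1, ← Measure.restrict_restrict (hAm k), h,
        Measure.restrict_restrict (hAm k), Set.inter_eq_left.2 (hAU k)]
    simp only [this]
    rw [← Measure.restrict_iUnion (disjoint_disjointed _) hAm, hAcov, Measure.restrict_univ]
  have : ⨆ j, μ j = ν := by
    rw [← iSup_restrict_eq ν hs hU]
    simp only [hνU]
  rw [this, hνU]

section Volume

variable {E : Type*} [NormedAddCommGroup E] [NormedSpace ℝ E] {H : Type*} [TopologicalSpace H]
  {I : ModelWithCorners ℝ E H} [I.Boundaryless] {N : Type*} [TopologicalSpace N] [ChartedSpace H N]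
  [IsManifold I ∞ N] [FiniteDimensional ℝ E] [MeasurableSpace E] [BorelSpace E]
  [MeasurableSpace N] [BorelSpace N]
  (gM : ContMDiffRiemannianMetric I ∞ E (fun x : N => TangentSpace I x))
  {ι : Type*} [Fintype ι] [DecidableEq ι] (b : Module.Basis ι ℝ E)

/-- The set is the part of a Borel set that lies in the domain of a chart, read in coordinates. -/
theorem measurableSet_inter_preimage_symm (p : N) {s : Set N} (hs : MeasurableSet s) :
    MeasurableSet ((extChartAt I p).target ∩ (extChartAt I p).symm ⁻¹' s) := by
  classical
  have hΩ := (isOpen_extChartAt_target (I := I) p).measurableSet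
  have h : Measurable ((extChartAt I p).target.piecewise (extChartAt I p).symm fun _ => p) :=
    (continuousOn_extChartAt_symm p).measurable_piecewise continuousOn_const hΩ
  have e : (extChartAt I p).target ∩ (extChartAt I p).symm ⁻¹' s =
      (extChartAt I p).target ∩ ((extChartAt I p).target.piecewise (extChartAt I p).symm
        fun _ => p) ⁻¹' s := by
    ext z
    refine and_congr_right fun hz => ?_
    rw [Set.mem_preimage, Set.mem_preimage, Set.piecewise_eq_of_mem _ _ _ hz]
  rw [e]
  exact hΩ.inter (h hs)

theorem chartVolume_apply (g : MetricField I N) (p : N) {s : Set N} (hs : MeasurableSet s) :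
    chartVolume g b p s = ∫⁻ z in (extChartAt I p).target ∩ (extChartAt I p).symm ⁻¹' s,
      ENNReal.ofReal (Real.sqrt (gramMatrix g b p z).det) ∂b.addHaar := by
  have hΩ := (isOpen_extChartAt_target (I := I) p).measurableSet
  have hae : AEMeasurable (extChartAt I p).symm (b.addHaar.restrict (extChartAt I p).target) :=
    (continuousOn_extChartAt_symm p).aemeasurable hΩ
  rw [chartVolume, Measure.map_apply_of_aemeasurable
    (hae.mono_ac (withDensity_absolutelyContinuous _ _)) hs, withDensity_apply',
    Measure.restrict_restrict' hΩ, Set.inter_comm]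

theorem chartVolume_compl_source (g : MetricField I N) (p : N) :
    chartVolume g b p (extChartAt I p).sourceᶜ = 0 := by
  rw [chartVolume_apply b g p (isOpen_extChartAt_source p).measurableSet.compl]
  have : (extChartAt I p).target ∩ (extChartAt I p).symm ⁻¹' (extChartAt I p).sourceᶜ = ∅ := by
    ext z
    simp only [Set.mem_inter_iff, Set.mem_preimage, Set.mem_compl_iff, Set.mem_empty_iff_false,
      iff_false, not_and, not_not]
    exact fun hz => (extChartAt I p).map_target hz
  rw [this]
  simp

/-- The measures `√det(g_ij) dz` agree on overlaps, by the change of variables formula. -/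
theorem chartVolume_restrict (p q : N) :
    (chartVolume (metricField gM) b p).restrict (extChartAt I q).source =
      (chartVolume (metricField gM) b q).restrict (extChartAt I p).source := by
  ext s hs
  have hp := (isOpen_extChartAt_source (I := I) p).measurableSet
  have hq := (isOpen_extChartAt_source (I := I) q).measurableSet
  rw [Measure.restrict_apply hs, Measure.restrict_apply hs, chartVolume_apply b _ p (hs.inter hq),
    chartVolume_apply b _ q (hs.inter hp)]
  set A := (extChartAt I p).target ∩ (extChartAt I p).symm ⁻¹' (s ∩ (extChartAt I q).source)
  set A' := (extChartAt I q).target ∩ (extChartAt I q).symm ⁻¹' (s ∩ (extChartAt I p).source)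
  have hA : MeasurableSet A := measurableSet_inter_preimage_symm p (hs.inter hq)
  have hAo : A ⊆ overlap I p q := fun z hz => ⟨hz.1, hz.2.2⟩
  have himage : transition I p q '' A = A' := by
    ext w
    constructor
    · rintro ⟨z, hz, rfl⟩
      have h := transition_mem_overlap (hAo hz)
      refine ⟨h.1, ?_, h.2⟩
      rw [symm_transition (hAo hz)]
      exact hz.2.1
    · intro hw
      have hwo : w ∈ overlap I q p := ⟨hw.1, hw.2.2⟩
      have h := transition_mem_overlap hwo
      refine ⟨transition I q p w, ⟨h.1, ?_, h.2⟩, transition_transition hwo⟩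
      rw [symm_transition hwo]
      exact hw.2.1
  rw [← himage, lintegral_image_eq_lintegral_abs_det_fderiv_mul b.addHaar hA
    (f' := fun z => fderiv ℝ (transition I p q) z)]
  · refine setLIntegral_congr_fun hA fun z hz => ?_
    rw [sqrt_det_gramMatrix_transition gM b (hAo hz), ENNReal.ofReal_mul (abs_nonneg _)]
  · intro z hz
    exact ((((contDiffOn_transition p q).contDiffAt
      ((isOpen_overlap p q).mem_nhds (hAo hz))).differentiableAt
        (by simp)).hasFDerivAt).hasFDerivWithinAt
  · intro z hz w hw hzw
    rw [← transition_transition (hAo hz), hzw, transition_transition (hAo hw)]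

variable [SecondCountableTopology N]

theorem exists_countable_cover_source :
    ∃ s : Set N, s.Countable ∧ ⋃ p ∈ s, (extChartAt I p).source = Set.univ :=
  TopologicalSpace.countable_cover_nhds fun p => extChartAt_source_mem_nhds p

/-- In the domain of a chart, the Riemannian volume is `√det(g_ij) dz`. -/
theorem riemannianVolume_restrict (p : N) :
    (riemannianVolume (metricField gM) b).restrict (extChartAt I p).source =
      chartVolume (metricField gM) b p := by
  obtain ⟨s, hs, hcov⟩ := exists_countable_cover_source (I := I) (N := N)
  exact iSup_restrict_of_compatible hs hcov
    (fun p => (isOpen_extChartAt_source (I := I) p).measurableSet)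
    (fun p => chartVolume_compl_source b _ p) (fun p q => chartVolume_restrict gM b p q) p

theorem sFinite_chartVolume (g : MetricField I N) (p : N) : SFinite (chartVolume g b p) := by
  unfold chartVolume
  infer_instance

theorem sFinite_riemannianVolume : SFinite (riemannianVolume (metricField gM) b) := by
  obtain ⟨s, hs, hcov⟩ := exists_countable_cover_source (I := I) (N := N)
  rcases s.eq_empty_or_nonempty with rfl | hne
  · have : IsEmpty N := by
      rw [← Set.univ_eq_empty_iff, ← hcov]; simp
    have : riemannianVolume (metricField gM) b = 0 :=
      Measure.ext fun t _ => by rw [Set.eq_empty_of_isEmpty t]; simp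
    rw [this]
    infer_instance
  obtain ⟨e, he⟩ := hs.exists_eq_range hne
  have hcov' : ⋃ k, (extChartAt I (e k)).source = Set.univ := by
    rw [← hcov, he, Set.biUnion_range]
  set A : ℕ → Set N := disjointed fun k => (extChartAt I (e k)).source with hA
  have hAm : ∀ k, MeasurableSet (A k) :=
    fun k => .disjointed (fun k => (isOpen_extChartAt_source _).measurableSet) k
  have hsum : riemannianVolume (metricField gM) b =
      Measure.sum fun k => (chartVolume (metricField gM) b (e k)).restrict (A k) := by
    conv_lhs => rw [← Measure.restrict_univ (μ := riemannianVolume (metricField gM) b), ← hcov',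
      ← iUnion_disjointed, Measure.restrict_iUnion (disjoint_disjointed _) hAm]
    congr 1
    funext k
    rw [← riemannianVolume_restrict, Measure.restrict_restrict (hAm k),
      Set.inter_eq_left.2 (disjointed_subset _ k)]
  have := fun k => sFinite_chartVolume b (metricField gM) (e k)
  rw [hsum]
  infer_instance

end Volume

section ChartVolume

variable {E : Type*} [NormedAddCommGroup E] [NormedSpace ℝ E] {H : Type*} [TopologicalSpace H]
  {I : ModelWithCorners ℝ E H} [I.Boundaryless] {N : Type*} [TopologicalSpace N] [ChartedSpace H N]
  [IsManifold I ∞ N] [FiniteDimensional ℝ E] [MeasurableSpace E] [BorelSpace E]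
  [MeasurableSpace N] [BorelSpace N]
  {ι : Type*} [Fintype ι] [DecidableEq ι] (b : Module.Basis ι ℝ E) (g : MetricField I N) (p : N)

theorem aemeasurable_extChartAt_symm :
    AEMeasurable (extChartAt I p).symm (b.addHaar.restrict (extChartAt I p).target) :=
  (continuousOn_extChartAt_symm p).aemeasurable (isOpen_extChartAt_target p).measurableSet

theorem lintegral_chartVolume
    (hρ : ContinuousOn (fun z => Real.sqrt (gramMatrix g b p z).det) (extChartAt I p).target)
    {h : N → ℝ≥0∞} (hh : AEMeasurable h (chartVolume g b p)) :
    ∫⁻ x, h x ∂chartVolume g b p = ∫⁻ z in (extChartAt I p).target,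
      ENNReal.ofReal (Real.sqrt (gramMatrix g b p z).det) * h ((extChartAt I p).symm z)
        ∂b.addHaar := by
  have hac := (aemeasurable_extChartAt_symm b p (I := I)).mono_ac
    (withDensity_absolutelyContinuous _
      (fun z => ENNReal.ofReal (Real.sqrt (gramMatrix g b p z).det)))
  have hρ' := (hρ.aemeasurable (μ := b.addHaar)
    (isOpen_extChartAt_target p).measurableSet).ennreal_ofReal
  rw [chartVolume, lintegral_map' hh hac]
  exact lintegral_withDensity_eq_lintegral_mul₀' hρ' (hh.comp_aemeasurable hac)

/-- Null sets of the coordinate space are null sets of the manifold, for any metric field. -/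
theorem ae_chartVolume_of_ae {P : E → Prop}
    (h : ∀ᵐ z ∂b.addHaar, z ∈ (extChartAt I p).target → P z) :
    ∀ᵐ x ∂chartVolume g b p, P (extChartAt I p x) := by
  obtain ⟨Z, hZ, hZm, hZ0⟩ := exists_measurable_superset_of_null (ae_iff.1 h)
  have hsrc := (isOpen_extChartAt_source (I := I) p).measurableSet
  have hm : MeasurableSet ((extChartAt I p).source ∩ extChartAt I p ⁻¹' Z) := by
    classical
    have hme : Measurable ((extChartAt I p).source.piecewise (extChartAt I p) fun _ => (0 : E)) :=
      (continuousOn_extChartAt p).measurable_piecewise continuousOn_const hsrc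
    have e : (extChartAt I p).source ∩ extChartAt I p ⁻¹' Z = (extChartAt I p).source ∩
        ((extChartAt I p).source.piecewise (extChartAt I p) fun _ => (0 : E)) ⁻¹' Z := by
      ext x
      refine and_congr_right fun hx => ?_
      rw [Set.mem_preimage, Set.mem_preimage, Set.piecewise_eq_of_mem _ _ _ hx]
    rw [e]
    exact hsrc.inter (hme hZm)
  have h1 : chartVolume g b p ((extChartAt I p).source ∩ extChartAt I p ⁻¹' Z) = 0 := by
    rw [chartVolume_apply b g p hm]
    refine setLIntegral_measure_zero _ _ (measure_mono_null ?_ hZ0)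
    rintro z ⟨hz, -, hz'⟩
    rwa [Set.mem_preimage, (extChartAt I p).right_inv hz] at hz'
  filter_upwards [measure_eq_zero_iff_ae_notMem.1 h1,
    mem_ae_iff.2 (chartVolume_compl_source b g p)] with x hx hxs
  by_contra hP
  refine hx ⟨hxs, hZ ?_⟩
  simp only [Set.mem_ofPred_eq, Classical.not_imp]
  exact ⟨(extChartAt I p).map_source hxs, hP⟩

/-- Null sets of the manifold are null sets in coordinates, since the density is positive. -/
theorem ae_of_ae_chartVolume
    (hρ : ContinuousOn (fun z => Real.sqrt (gramMatrix g b p z).det) (extChartAt I p).target)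
    (hpos : ∀ z ∈ (extChartAt I p).target, 0 < Real.sqrt (gramMatrix g b p z).det)
    {P : N → Prop} (h : ∀ᵐ x ∂chartVolume g b p, P x) :
    ∀ᵐ z ∂b.addHaar, z ∈ (extChartAt I p).target → P ((extChartAt I p).symm z) := by
  have hΩ := (isOpen_extChartAt_target (I := I) p).measurableSet
  have hac := (aemeasurable_extChartAt_symm b p (I := I)).mono_ac
    (withDensity_absolutelyContinuous _
      (fun z => ENNReal.ofReal (Real.sqrt (gramMatrix g b p z).det)))
  have hρ' := (hρ.aemeasurable (μ := b.addHaar) hΩ).ennreal_ofReal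
  have h1 := ae_of_ae_map hac h
  rw [ae_withDensity_iff' hρ', ae_restrict_iff' hΩ] at h1
  filter_upwards [h1] with z hz hzt
  exact hz hzt (by simpa using hpos z hzt)

end ChartVolume

/-! ### Weak derivatives and mollification -/

section WeakDeriv

open scoped Convolution

variable {Z : Type*} [NormedAddCommGroup Z] [NormedSpace ℝ Z] [FiniteDimensional ℝ Z]
  [MeasurableSpace Z] [BorelSpace Z] (μ : Measure Z) [μ.IsAddHaarMeasure]

/-- On the open set `O`, the function `w` is the weak derivative of `u` in the direction `v`. -/
def WeakDeriv (O : Set Z) (v : Z) (u w : Z → ℝ) : Prop :=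
  ∀ ψ : Z → ℝ, ContDiff ℝ ∞ ψ → HasCompactSupport ψ → tsupport ψ ⊆ O →
    ∫ z, u z * fderiv ℝ ψ z v ∂μ = - ∫ z, w z * ψ z ∂μ

variable {μ}

theorem LocallyIntegrableOn.integrable_mul_of_tsupport_subset {O : Set Z} {u h : Z → ℝ}
    (hu : LocallyIntegrableOn u O μ) (hh : Continuous h) (hc : HasCompactSupport h)
    (hO : tsupport h ⊆ O) : Integrable (fun z => u z * h z) μ := by
  have h1 : IntegrableOn (fun z => u z * h z) (tsupport h) μ :=
    (hu.integrableOn_compact_subset hO hc).mul_continuousOn hh.continuousOn hc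
  rwa [integrableOn_iff_integrable_of_support_subset] at h1
  intro z hz
  refine subset_tsupport h ?_
  rw [Function.mem_support] at hz ⊢
  exact right_ne_zero_of_mul hz

/-- The product rule for a weak derivative on `O` and a smooth function supported in `O`. The
product is weakly differentiable on the whole space. -/
theorem WeakDeriv.mul {O : Set Z} {v : Z} {u w η : Z → ℝ} (h : WeakDeriv μ O v u w)
    (hu : LocallyIntegrableOn u O μ) (hw : LocallyIntegrableOn w O μ)
    (hη : ContDiff ℝ ∞ η) (hO : tsupport η ⊆ O) :
    WeakDeriv μ Set.univ v (fun z => η z * u z) (fun z => fderiv ℝ η z v * u z + η z * w z) := by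
  intro ψ hψ hψc _
  have hdη := hη.differentiable (by simp)
  have hdψ := hψ.differentiable (by simp)
  have hcη : Continuous fun z => fderiv ℝ η z v :=
    (hη.continuous_fderiv (by simp)).clm_apply continuous_const
  have hcψ : Continuous fun z => fderiv ℝ ψ z v :=
    (hψ.continuous_fderiv (by simp)).clm_apply continuous_const
  have hsub : tsupport (fun z => η z * ψ z) ⊆ O :=
    (closure_mono (Function.support_mul_subset_left η ψ)).trans hO
  -- Use `η ψ` as a test function for `u`.
  have hkey := h (fun z => η z * ψ z) (hη.mul hψ) hψc.mul_left hsub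
  have e1 : ∀ z, fderiv ℝ (fun z => η z * ψ z) z v =
      η z * fderiv ℝ ψ z v + fderiv ℝ η z v * ψ z := by
    intro z
    rw [fderiv_fun_mul (hdη z) (hdψ z)]
    simp [mul_comm]
  have i1 : Integrable (fun z => u z * (η z * fderiv ℝ ψ z v)) μ := by
    refine LocallyIntegrableOn.integrable_mul_of_tsupport_subset hu (hη.continuous.mul hcψ)
      (hψc.fderiv_apply (𝕜 := ℝ) v).mul_left ?_
    exact (closure_mono (Function.support_mul_subset_left η _)).trans hO
  have i2 : Integrable (fun z => u z * (fderiv ℝ η z v * ψ z)) μ := by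
    refine LocallyIntegrableOn.integrable_mul_of_tsupport_subset hu (hcη.mul hψ.continuous)
      hψc.mul_left ?_
    refine ((closure_mono (Function.support_mul_subset_left _ ψ)).trans ?_).trans hO
    exact tsupport_fderiv_apply_subset ℝ v
  have i3 : Integrable (fun z => w z * (η z * ψ z)) μ :=
    LocallyIntegrableOn.integrable_mul_of_tsupport_subset hw (hη.continuous.mul hψ.continuous)
      hψc.mul_left hsub
  simp only [e1, mul_add] at hkey
  rw [integral_add i1 i2] at hkey
  have e2 : ∫ z, (fderiv ℝ η z v * u z + η z * w z) * ψ z ∂μ =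
      (∫ z, u z * (fderiv ℝ η z v * ψ z) ∂μ) + ∫ z, w z * (η z * ψ z) ∂μ := by
    rw [← integral_add i2 i3]
    exact integral_congr_ae (.of_forall fun z => by ring)
  have e3 : ∫ z, η z * u z * fderiv ℝ ψ z v ∂μ = ∫ z, u z * (η z * fderiv ℝ ψ z v) ∂μ :=
    integral_congr_ae (.of_forall fun z => by ring)
  rw [e2, e3]
  linarith

/-- Mollification commutes with weak derivatives. -/
theorem fderiv_convolution_of_weakDeriv {v : Z} {u w φ : Z → ℝ}
    (h : WeakDeriv μ Set.univ v u w) (hu : LocallyIntegrable u μ)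
    (hφ : ContDiff ℝ ∞ φ) (hφc : HasCompactSupport φ) (x : Z) :
    fderiv ℝ (φ ⋆[ContinuousLinearMap.lsmul ℝ ℝ, μ] u) x v =
      (φ ⋆[ContinuousLinearMap.lsmul ℝ ℝ, μ] w) x := by
  have hφ1 : ContDiff ℝ 1 φ := hφ.of_le (by simp)
  rw [(hφc.hasFDerivAt_convolution_left (ContinuousLinearMap.lsmul ℝ ℝ) hφ1 hu x).fderiv,
    convolution_def]
  have hint : Integrable (fun t => ((ContinuousLinearMap.precompL Z
      (ContinuousLinearMap.lsmul ℝ ℝ : ℝ →L[ℝ] ℝ →L[ℝ] ℝ)) (fderiv ℝ φ t)) (u (x - t))) μ :=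
    (HasCompactSupport.convolutionExists_left
      (L := ContinuousLinearMap.precompL Z (ContinuousLinearMap.lsmul ℝ ℝ : ℝ →L[ℝ] ℝ →L[ℝ] ℝ))
      (hφc.fderiv (𝕜 := ℝ)) (hφ1.continuous_fderiv (by simp)) hu x).integrable
  rw [ContinuousLinearMap.integral_apply hint, convolution_eq_swap]
  have hψ : ContDiff ℝ ∞ fun s => φ (x - s) := hφ.comp (contDiff_const.sub contDiff_id)
  have hψc : HasCompactSupport fun s => φ (x - s) :=
    hφc.comp_homeomorph (Homeomorph.subLeft x)
  -- Use the reflected translate of `φ` as a test function.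
  have hk := h (fun s => φ (x - s)) hψ hψc (Set.subset_univ _)
  have e1 : ∀ s, fderiv ℝ (fun s => φ (x - s)) s v = - fderiv ℝ φ (x - s) v := by
    intro s
    have : HasFDerivAt (fun s => φ (x - s)) ((fderiv ℝ φ (x - s)).comp (-.id ℝ Z)) s := by
      refine ((hφ.differentiable (by simp)) (x - s)).hasFDerivAt.comp s ?_
      exact (hasFDerivAt_id s).const_sub x
    rw [this.fderiv]
    simp
  simp only [e1, mul_neg, integral_neg, neg_inj] at hk
  have e2 : ∫ t, (((ContinuousLinearMap.precompL Z
      (ContinuousLinearMap.lsmul ℝ ℝ : ℝ →L[ℝ] ℝ →L[ℝ] ℝ)) (fderiv ℝ φ t)) (u (x - t))) v ∂μ =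
      ∫ s, u s * fderiv ℝ φ (x - s) v ∂μ := by
    rw [← integral_sub_left_eq_self _ μ x]
    refine integral_congr_ae (.of_forall fun s => ?_)
    simp [ContinuousLinearMap.precompL_apply, mul_comm]
  rw [e2, hk]
  exact integral_congr_ae (.of_forall fun s => by simp [mul_comm])

/-- Translations act continuously on `L²`. -/
theorem exists_eLpNorm_translate_sub_le {u : Z → ℝ} (hu : MemLp u 2 μ) {ε : ℝ≥0∞} (hε : ε ≠ 0) :
    ∃ δ > 0, ∀ t : Z, ‖t‖ < δ → eLpNorm (fun x => u (x - t) - u x) 2 μ ≤ ε := by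
  have hmp : ∀ t : Z, MeasurePreserving (fun x => x - t) μ μ :=
    fun t => measurePreserving_sub_right μ t
  let G : C(Z, C(Z, Z)) := (ContinuousMap.mk (fun q : Z × Z => q.2 - q.1)
    (continuous_snd.sub continuous_fst)).curry
  have hc : Continuous fun t : Z => Lp.compMeasurePreserving (G t) (hmp t) (hu.toLp u) :=
    (continuous_const (y := hu.toLp u)).compMeasurePreservingLp G.continuous hmp (by simp)
  have h0 : Tendsto (fun t : Z => edist (Lp.compMeasurePreserving (G t) (hmp t) (hu.toLp u))
      (Lp.compMeasurePreserving (G 0) (hmp 0) (hu.toLp u))) (𝓝 0) (𝓝 0) := by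
    have := hc.edist (continuous_const (y := Lp.compMeasurePreserving (G 0) (hmp 0) (hu.toLp u)))
    simpa using this.tendsto 0
  have h1 := h0.eventually (ge_mem_nhds (pos_iff_ne_zero.2 hε))
  obtain ⟨δ, hδ, hδ'⟩ := Metric.eventually_nhds_iff.1 h1
  refine ⟨δ, hδ, fun t ht => ?_⟩
  have h2 := hδ' (y := t) (by simpa using ht)
  have h3 := (Lp.edist_toLp_toLp _ _ (hu.comp_measurePreserving (hmp t))
    (hu.comp_measurePreserving (hmp 0))).symm.trans_le h2
  refine le_trans (le_of_eq ?_) h3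
  congr 1
  funext x
  simp

/-- Jensen's inequality for the square. -/
theorem sq_lintegral_le {α : Type*} [MeasurableSpace α] (P : Measure α) [IsProbabilityMeasure P]
    {f : α → ℝ≥0∞} (hf : AEMeasurable f P) : (∫⁻ a, f a ∂P) ^ 2 ≤ ∫⁻ a, f a ^ 2 ∂P := by
  have h := ENNReal.lintegral_mul_le_Lp_mul_Lq P Real.HolderConjugate.two_two hf
    (aemeasurable_const (b := (1 : ℝ≥0∞)))
  simp only [Pi.mul_apply, mul_one, lintegral_const, measure_univ, ENNReal.rpow_two, one_pow,
    ENNReal.one_rpow] at h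
  calc (∫⁻ a, f a ∂P) ^ 2 ≤ ((∫⁻ a, f a ^ 2 ∂P) ^ (1 / 2 : ℝ)) ^ 2 := by gcongr
    _ = _ := by
      rw [← ENNReal.rpow_natCast, ← ENNReal.rpow_mul]
      norm_num

/-- A mollification is an average of translates, hence as close to `u` in `L²` as the translates
are. -/
theorem eLpNorm_convolution_sub_le {u : Z → ℝ} (hu : MemLp u 2 μ) {ε : ℝ≥0∞} {δ : ℝ}
    (hδ : ∀ t : Z, ‖t‖ < δ → eLpNorm (fun x => u (x - t) - u x) 2 μ ≤ ε)
    (φ : ContDiffBump (0 : Z)) (hφ : φ.rOut ≤ δ) :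
    eLpNorm (fun x => (φ.normed μ ⋆[ContinuousLinearMap.lsmul ℝ ℝ, μ] u) x - u x) 2 μ ≤ ε := by
  wlog hum : Measurable u generalizing u with H
  · have hae := hu.1.aemeasurable.ae_eq_mk
    have hum := hu.1.aemeasurable.measurable_mk
    have hu' := hu.ae_eq hae
    have hq : ∀ t : Z, (fun x => u (x - t)) =ᵐ[μ] fun x => hu.1.aemeasurable.mk u (x - t) :=
      fun t => (measurePreserving_sub_right μ t).quasiMeasurePreserving.ae_eq_comp hae
    have := H hu' (fun t ht => (eLpNorm_congr_ae ((hq t).symm.sub hae.symm)).trans_le (hδ t ht))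
      hum
    refine le_trans (le_of_eq (eLpNorm_congr_ae ?_)) this
    filter_upwards [hae] with x hx
    rw [← hx, convolution_congr _ (Filter.EventuallyEq.refl _ _) hae]
  have hloc : LocallyIntegrable u μ := hu.locallyIntegrable (by norm_num)
  set P : Measure Z := μ.withDensity fun t => ENNReal.ofReal (φ.normed μ t) with hP
  have hφm : Measurable fun t => ENNReal.ofReal (φ.normed μ t) :=
    (φ.continuous_normed.measurable).ennreal_ofReal
  have : IsProbabilityMeasure P := by
    constructor
    rw [hP, withDensity_apply _ .univ, Measure.restrict_univ,
      ← ofReal_integral_eq_lintegral_ofReal φ.integrable_normed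
        (.of_forall fun t => φ.nonneg_normed t), φ.integral_normed, ENNReal.ofReal_one]
  have hm : Measurable fun q : Z × Z => u (q.1 - q.2) - u q.1 :=
    (hum.comp (measurable_fst.sub measurable_snd)).sub (hum.comp measurable_fst)
  have hpt : ∀ x, ‖(φ.normed μ ⋆[ContinuousLinearMap.lsmul ℝ ℝ, μ] u) x - u x‖ₑ ^ 2 ≤
      ∫⁻ t, ‖u (x - t) - u x‖ₑ ^ 2 ∂P := by
    intro x
    have i1 : Integrable (fun t => φ.normed μ t * u (x - t)) μ :=
      (HasCompactSupport.convolutionExists_left (L := ContinuousLinearMap.lsmul ℝ ℝ)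
        φ.hasCompactSupport_normed φ.continuous_normed hloc x).integrable
    have i2 : Integrable (fun t => φ.normed μ t * u x) μ := φ.integrable_normed.mul_const _
    have e : (φ.normed μ ⋆[ContinuousLinearMap.lsmul ℝ ℝ, μ] u) x - u x =
        ∫ t, φ.normed μ t * (u (x - t) - u x) ∂μ := by
      simp only [mul_sub]
      rw [integral_sub i1 i2, integral_mul_const, φ.integral_normed, one_mul, convolution_def]
      rfl
    refine le_trans (pow_le_pow_left' ?_ 2) (sq_lintegral_le P (f := fun t => ‖u (x - t) - u x‖ₑ)
      (hm.comp measurable_prodMk_left).enorm.aemeasurable)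
    have hmx : Measurable fun t => ‖u (x - t) - u x‖ₑ := (hm.comp measurable_prodMk_left).enorm
    rw [e, hP, lintegral_withDensity_eq_lintegral_mul _ hφm hmx]
    refine (enorm_integral_le_lintegral_enorm _).trans (lintegral_mono fun t => ?_)
    simp only [Pi.mul_apply, enorm_mul]
    rw [Real.enorm_of_nonneg (φ.nonneg_normed t)]
  have hsq : ∀ f : Z → ℝ, eLpNorm f 2 μ = (∫⁻ x, ‖f x‖ₑ ^ 2 ∂μ) ^ (1 / 2 : ℝ) := by
    intro f
    rw [eLpNorm_eq_lintegral_rpow_enorm_toReal (by simp) (by simp)]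
    simp
  have hsq' : ∀ t : Z, ‖t‖ < δ → ∫⁻ x, ‖u (x - t) - u x‖ₑ ^ 2 ∂μ ≤ ε ^ 2 := by
    intro t ht
    have := hδ t ht
    rw [hsq] at this
    calc _ = ((∫⁻ x, ‖u (x - t) - u x‖ₑ ^ 2 ∂μ) ^ (1 / 2 : ℝ)) ^ 2 := by
          rw [← ENNReal.rpow_natCast, ← ENNReal.rpow_mul]
          norm_num
      _ ≤ _ := by gcongr
  have hP' : ∀ᵐ t ∂P, ‖t‖ < δ := by
    rw [hP, ae_withDensity_iff hφm]
    refine .of_forall fun t ht => ?_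
    have : t ∈ Function.support (φ.normed μ) := by
      intro h0
      simp [h0] at ht
    rw [φ.support_normed_eq, mem_ball_zero_iff] at this
    exact this.trans_le hφ
  rw [hsq]
  calc (∫⁻ x, ‖(φ.normed μ ⋆[ContinuousLinearMap.lsmul ℝ ℝ, μ] u) x - u x‖ₑ ^ 2 ∂μ) ^ (1 / 2 : ℝ)
      ≤ (∫⁻ x, ∫⁻ t, ‖u (x - t) - u x‖ₑ ^ 2 ∂P ∂μ) ^ (1 / 2 : ℝ) := by
        gcongr with x
        exact hpt x
    _ = (∫⁻ t, ∫⁻ x, ‖u (x - t) - u x‖ₑ ^ 2 ∂μ ∂P) ^ (1 / 2 : ℝ) := by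
        rw [lintegral_lintegral_swap]
        exact (hm.enorm.pow_const 2).aemeasurable
    _ ≤ (∫⁻ _, ε ^ 2 ∂P) ^ (1 / 2 : ℝ) := by
        refine ENNReal.rpow_le_rpow (lintegral_mono_ae ?_) (by norm_num)
        filter_upwards [hP'] with t ht using hsq' t ht
    _ = ε := by
        rw [lintegral_const, measure_univ, mul_one, ← ENNReal.rpow_natCast, ← ENNReal.rpow_mul]
        norm_num

/-- Functions of compact support are approximated by mollification. -/
theorem exists_smooth_near_of_hasCompactSupport {κ : Type*} [Finite κ] {v : κ → Z} {u : Z → ℝ}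
    {w : κ → Z → ℝ} (hu : MemLp u 2 μ) (huc : HasCompactSupport u) (hw : ∀ i, MemLp (w i) 2 μ)
    (h : ∀ i, WeakDeriv μ Set.univ (v i) u (w i)) {ε : ℝ≥0∞} (hε : ε ≠ 0) :
    ∃ f : Z → ℝ, ContDiff ℝ ∞ f ∧ HasCompactSupport f ∧ eLpNorm (fun z => f z - u z) 2 μ ≤ ε ∧
      ∀ i, eLpNorm (fun z => fderiv ℝ f z (v i) - w i z) 2 μ ≤ ε := by
  have hloc : LocallyIntegrable u μ := hu.locallyIntegrable (by norm_num)
  obtain ⟨δ₀, hδ₀, h0⟩ := exists_eLpNorm_translate_sub_le hu hε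
  choose δ hδ hi using fun i => exists_eLpNorm_translate_sub_le (hw i) hε
  obtain ⟨r, hr, hr0, hri⟩ : ∃ r > 0, r ≤ δ₀ ∧ ∀ i, r ≤ δ i := by
    have h1 : ∀ᶠ r : ℝ in 𝓝[>] 0, r ≤ δ₀ :=
      mem_nhdsWithin_of_mem_nhds (Iic_mem_nhds hδ₀)
    have h2 : ∀ᶠ r : ℝ in 𝓝[>] 0, ∀ i, r ≤ δ i :=
      eventually_all.2 fun i => mem_nhdsWithin_of_mem_nhds (Iic_mem_nhds (hδ i))
    obtain ⟨r, hr⟩ := (h1.and (h2.and self_mem_nhdsWithin)).exists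
    exact ⟨r, hr.2.2, hr.1, hr.2.1⟩
  let φ : ContDiffBump (0 : Z) := ⟨r / 2, r, by positivity, by linarith⟩
  refine ⟨φ.normed μ ⋆[ContinuousLinearMap.lsmul ℝ ℝ, μ] u,
    φ.hasCompactSupport_normed.contDiff_convolution_left _ φ.contDiff_normed hloc,
    φ.hasCompactSupport_normed.convolution _ huc, eLpNorm_convolution_sub_le hu h0 φ hr0,
    fun i => ?_⟩
  simp only [fderiv_convolution_of_weakDeriv (h i) hloc φ.contDiff_normed
    φ.hasCompactSupport_normed]
  exact eLpNorm_convolution_sub_le (hw i) (hi i) φ (hri i)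

theorem tendsto_eLpNorm_zero_of_dominated {α : Type*} [MeasurableSpace α] {ν : Measure α}
    {F : ℕ → α → ℝ} {G : α → ℝ} (hF : ∀ k, AEStronglyMeasurable (F k) ν) (hG : MemLp G 2 ν)
    (hb : ∀ k z, |F k z| ≤ |G z|) (hlim : ∀ z, Tendsto (fun k => F k z) atTop (𝓝 0)) :
    Tendsto (fun k => eLpNorm (F k) 2 ν) atTop (𝓝 0) := by
  simp only [eLpNorm_two_eq_lintegral_sq]
  have h := tendsto_lintegral_of_dominated_convergence' (μ := ν)
    (F := fun k z => ENNReal.ofReal (F k z ^ 2)) (f := fun _ => 0)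
    (fun z => ENNReal.ofReal (G z ^ 2)) (fun k => ((hF k).aemeasurable.pow_const 2).ennreal_ofReal)
    (fun k => .of_forall fun z => ENNReal.ofReal_le_ofReal (sq_le_sq.2 (hb k z)))
    (lintegral_sq_ne_top_of_memLp hG) (.of_forall fun z => by
      simpa using ENNReal.tendsto_ofReal ((hlim z).pow 2))
  simpa using h.ennrpow_const (1 / 2 : ℝ)

/-- Smooth functions with compact support are dense in the Sobolev space `H¹` of a vector space:
a function is first cut off and then mollified. -/
theorem exists_smooth_near {κ : Type*} [Finite κ] {v : κ → Z} {u : Z → ℝ}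
    {w : κ → Z → ℝ} (hu : MemLp u 2 μ) (hw : ∀ i, MemLp (w i) 2 μ)
    (h : ∀ i, WeakDeriv μ Set.univ (v i) u (w i)) {ε : ℝ≥0∞} (hε : ε ≠ 0) :
    ∃ f : Z → ℝ, ContDiff ℝ ∞ f ∧ HasCompactSupport f ∧ eLpNorm (fun z => f z - u z) 2 μ ≤ ε ∧
      ∀ i, eLpNorm (fun z => fderiv ℝ f z (v i) - w i z) 2 μ ≤ ε := by
  -- The cutoff functions `η k z = θ (z / (k + 1))` tend to `1`, and their derivatives to `0`.
  let θ : ContDiffBump (0 : Z) := ⟨1, 2, one_pos, one_lt_two⟩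
  set c : ℕ → ℝ := fun k => 1 / ((k : ℝ) + 1) with hcdef
  have hc0 : Tendsto c atTop (𝓝 0) := tendsto_one_div_add_atTop_nhds_zero_nat
  have hcpos : ∀ k, 0 < c k := fun k => by positivity
  have hc1 : ∀ k, c k ≤ 1 := fun k => by
    rw [hcdef]
    simp only
    rw [div_le_one (by positivity)]
    linarith [Nat.cast_nonneg (α := ℝ) k]
  set η : ℕ → Z → ℝ := fun k z => θ (c k • z) with hη
  have hηs : ∀ k, ContDiff ℝ ∞ (η k) := fun k => θ.contDiff.comp (contDiff_const_smul (c k))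
  have hηc : ∀ k, HasCompactSupport (η k) := fun k =>
    θ.hasCompactSupport.comp_homeomorph (Homeomorph.smulOfNeZero (c k) (hcpos k).ne')
  have hη1 : ∀ k z, |η k z - 1| ≤ 1 := fun k z => by
    rw [abs_le]
    constructor <;> linarith [θ.nonneg' (c k • z), θ.le_one (x := c k • z)]
  have hηlim : ∀ z, Tendsto (fun k => η k z) atTop (𝓝 1) := by
    intro z
    have h1 : Tendsto (fun k => c k • z) atTop (𝓝 ((0 : ℝ) • z)) := hc0.smul_const z
    have h2 := (θ.continuous.tendsto ((0 : ℝ) • z)).comp h1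
    have h3 : θ ((0 : ℝ) • z) = 1 := θ.one_of_mem_closedBall (by simp [θ])
    rwa [h3] at h2
  obtain ⟨C, hC⟩ : ∃ C, ∀ z, ‖fderiv ℝ θ z‖ ≤ C :=
    (θ.hasCompactSupport.fderiv (𝕜 := ℝ)).exists_bound_of_continuous
      (θ.contDiff.continuous_fderiv (n := ∞) (by simp))
  have hC0 : 0 ≤ C := (norm_nonneg _).trans (hC 0)
  have hdη : ∀ k z x, fderiv ℝ (η k) z x = c k * fderiv ℝ θ (c k • z) x := by
    intro k z x
    have h1 : HasFDerivAt (η k) ((fderiv ℝ θ (c k • z)).comp (c k • .id ℝ Z)) z :=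
      ((θ.contDiff (n := 1)).differentiable (by simp) (c k • z)).hasFDerivAt.comp z
        ((hasFDerivAt_id z).const_smul (c k))
    rw [h1.fderiv]
    simp
  have hdb : ∀ k z x, |fderiv ℝ (η k) z x| ≤ c k * (C * ‖x‖) := by
    intro k z x
    rw [hdη, abs_mul, abs_of_pos (hcpos k)]
    exact mul_le_mul_of_nonneg_left ((fderiv ℝ θ (c k • z)).le_of_opNorm_le (hC _) x)
      (hcpos k).le
  have hdm : ∀ k x, Continuous fun z => fderiv ℝ (η k) z x := fun k x =>
    ((hηs k).continuous_fderiv (by simp)).clm_apply continuous_const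
  have hε2 : ε / 2 ≠ 0 := (ENNReal.half_pos hε).ne'
  have key : ∀ x : Z, ∀ y : Z → ℝ, MemLp y 2 μ → Tendsto (fun k => eLpNorm (fun z =>
      (fderiv ℝ (η k) z x * u z + η k z * y z) - y z) 2 μ) atTop (𝓝 0) := by
    intro x y hy
    refine tendsto_eLpNorm_zero_of_dominated (G := fun z => C * ‖x‖ * |u z| + |y z|) ?_
      ((hu.abs.const_mul _).add hy.abs) ?_ ?_
    · exact fun k => (((hdm k x).aestronglyMeasurable.mul hu.1).add
        ((hηs k).continuous.aestronglyMeasurable.mul hy.1)).sub hy.1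
    · intro k z
      have e : fderiv ℝ (η k) z x * u z + η k z * y z - y z =
        fderiv ℝ (η k) z x * u z + (η k z - 1) * y z := by ring
      rw [e, abs_of_nonneg (by positivity : 0 ≤ C * ‖x‖ * |u z| + |y z|)]
      refine (abs_add_le _ _).trans ?_
      rw [abs_mul, abs_mul]
      refine add_le_add (mul_le_mul_of_nonneg_right ((hdb k z x).trans ?_) (abs_nonneg _))
        (mul_le_of_le_one_left (abs_nonneg _) (hη1 k z))
      exact mul_le_of_le_one_left (by positivity) (hc1 k)
    · intro z
      have h1 : Tendsto (fun k => fderiv ℝ (η k) z x) atTop (𝓝 0) := by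
        refine squeeze_zero_norm (fun k => hdb k z x) ?_
        simpa using hc0.mul_const (C * ‖x‖)
      have := ((h1.mul_const (u z)).add ((hηlim z).mul_const (y z))).sub_const (y z)
      simpa using this
  have key0 : Tendsto (fun k => eLpNorm (fun z => η k z * u z - u z) 2 μ) atTop (𝓝 0) := by
    have := key 0 u hu
    simpa using this
  have hev : ∀ᶠ k in atTop, eLpNorm (fun z => η k z * u z - u z) 2 μ ≤ ε / 2 ∧
      ∀ i, eLpNorm (fun z => (fderiv ℝ (η k) z (v i) * u z + η k z * w i z) - w i z) 2 μ
        ≤ ε / 2 :=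
    (key0.eventually (ge_mem_nhds (pos_iff_ne_zero.2 hε2))).and
      (eventually_all.2 fun i =>
        (key (v i) (w i) (hw i)).eventually (ge_mem_nhds (pos_iff_ne_zero.2 hε2)))
  obtain ⟨k, hk0, hk⟩ := hev.exists
  have hηu : MemLp (fun z => η k z * u z) 2 μ :=
    hu.of_le ((hηs k).continuous.aestronglyMeasurable.mul hu.1) (.of_forall fun z => by
      rw [norm_mul]
      refine mul_le_of_le_one_left (norm_nonneg _) ?_
      rw [Real.norm_of_nonneg (θ.nonneg' _)]
      exact θ.le_one)
  have hηw : ∀ i, MemLp (fun z => fderiv ℝ (η k) z (v i) * u z + η k z * w i z) 2 μ := by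
    intro i
    refine ((hu.abs.const_mul (C * ‖v i‖)).add (hw i).abs).of_le
      (((hdm k _).aestronglyMeasurable.mul hu.1).add
        ((hηs k).continuous.aestronglyMeasurable.mul (hw i).1)) (.of_forall fun z => ?_)
    change _ ≤ ‖C * ‖v i‖ * |u z| + |w i z|‖
    rw [Real.norm_eq_abs, Real.norm_eq_abs,
      abs_of_nonneg (by positivity : 0 ≤ C * ‖v i‖ * |u z| + |w i z|)]
    refine (abs_add_le _ _).trans ?_
    rw [abs_mul, abs_mul]
    refine add_le_add (mul_le_mul_of_nonneg_right ((hdb k z _).trans ?_) (abs_nonneg _))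
        (mul_le_of_le_one_left (abs_nonneg _) ?_)
    · exact mul_le_of_le_one_left (by positivity) (hc1 k)
    · rw [abs_of_nonneg (θ.nonneg' _)]
      exact θ.le_one
  have hloc : ∀ {y : Z → ℝ}, MemLp y 2 μ → LocallyIntegrableOn y Set.univ μ := fun hy =>
    (hy.locallyIntegrable (by norm_num)).locallyIntegrableOn _
  obtain ⟨f, hf, hfc, hf0, hfi⟩ := exists_smooth_near_of_hasCompactSupport hηu
    (hηc k).mul_right hηw (fun i => (h i).mul (hloc hu) (hloc (hw i)) (hηs k)
      (Set.subset_univ _)) hε2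
  have hfs : ∀ i, Continuous fun z => fderiv ℝ f z (v i) := fun i =>
    (hf.continuous_fderiv (by simp)).clm_apply continuous_const
  refine ⟨f, hf, hfc, ?_, fun i => ?_⟩
  · have e : (fun z => f z - u z) =
        (fun z => f z - η k z * u z) + fun z => η k z * u z - u z := by
      funext z; simp
    rw [e]
    refine (eLpNorm_add_le (hf.continuous.aestronglyMeasurable.sub hηu.1) (hηu.1.sub hu.1)
      (by norm_num)).trans ?_
    exact (add_le_add hf0 hk0).trans_eq (ENNReal.add_halves ε)
  · have e : (fun z => fderiv ℝ f z (v i) - w i z) =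
        (fun z => fderiv ℝ f z (v i) - (fderiv ℝ (η k) z (v i) * u z + η k z * w i z)) +
          fun z => (fderiv ℝ (η k) z (v i) * u z + η k z * w i z) - w i z := by
      funext z; simp
    rw [e]
    refine (eLpNorm_add_le ((hfs i).aestronglyMeasurable.sub (hηw i).1)
      ((hηw i).1.sub (hw i).1) (by norm_num)).trans ?_
    exact (add_le_add (hfi i) (hk i)).trans_eq (ENNReal.add_halves ε)

end WeakDeriv

/-! ### Weak limits and quadratic forms in `L²` -/

section WeakLimit

variable {α : Type*} [MeasurableSpace α] {μ : Measure α}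

theorem integral_mul_eq_inner {f g : α → ℝ} (hf : MemLp f 2 μ) (hg : MemLp g 2 μ) :
    ∫ x, f x * g x ∂μ = inner ℝ (hf.toLp f) (hg.toLp g) := by
  rw [L2.inner_def]
  refine integral_congr_ae ?_
  filter_upwards [hf.coeFn_toLp, hg.coeFn_toLp] with x hx hx'
  simp [hx, hx', mul_comm]

/-- Bounded sequences in `L²` converge weakly along ultrafilters. -/
theorem exists_weak_limit (𝒰 : Ultrafilter ℕ) {D : ℕ → α → ℝ} (hD : ∀ k, MemLp (D k) 2 μ)
    {C : ℝ≥0} (hC : ∀ k, eLpNorm (D k) 2 μ ≤ C) :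
    ∃ W : α → ℝ, MemLp W 2 μ ∧ ∀ h : α → ℝ, MemLp h 2 μ →
      Tendsto (fun k => ∫ x, D k x * h x ∂μ) 𝒰 (𝓝 (∫ x, W x * h x ∂μ)) := by
  set T : ℕ → WeakDual ℝ (Lp ℝ 2 μ) := fun k =>
    StrongDual.toWeakDual (InnerProductSpace.toDual ℝ (Lp ℝ 2 μ) ((hD k).toLp (D k))) with hT
  have hmem : ∀ k, T k ∈ WeakDual.toStrongDual ⁻¹' closedBall (0 : StrongDual ℝ (Lp ℝ 2 μ)) C := by
    intro k
    rw [Set.mem_preimage, mem_closedBall_zero_iff]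
    change ‖InnerProductSpace.toDual ℝ (Lp ℝ 2 μ) ((hD k).toLp (D k))‖ ≤ C
    rw [LinearIsometryEquiv.norm_map, Lp.norm_toLp]
    exact ENNReal.toReal_le_of_le_ofReal C.2 (by simpa using hC k)
  obtain ⟨ℓ, -, hℓ⟩ := (WeakDual.isCompact_closedBall (𝕜 := ℝ) 0 (C : ℝ)).ultrafilter_le_nhds
    (𝒰.map T) (by
      rw [le_principal_iff]
      exact Filter.mem_map.2 (Filter.univ_mem' hmem))
  set w := (InnerProductSpace.toDual ℝ (Lp ℝ 2 μ)).symm (WeakDual.toStrongDual ℓ) with hw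
  refine ⟨w, Lp.memLp w, fun h hh => ?_⟩
  have h1 : Tendsto T 𝒰 (𝓝 ℓ) := hℓ
  have h2 := ((WeakDual.eval_continuous (𝕜 := ℝ) (hh.toLp h)).tendsto ℓ).comp h1
  have e1 : ∀ k, ∫ x, D k x * h x ∂μ = T k (hh.toLp h) := by
    intro k
    rw [integral_mul_eq_inner (hD k) hh]
    rfl
  have e2 : ∫ x, w x * h x ∂μ = ℓ (hh.toLp h) := by
    rw [integral_mul_eq_inner (Lp.memLp w) hh, Lp.toLp_coeFn]
    have : ℓ (hh.toLp h) = InnerProductSpace.toDual ℝ (Lp ℝ 2 μ) w (hh.toLp h) := by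
      rw [hw, LinearIsometryEquiv.apply_symm_apply]
      rfl
    rw [this]
    rfl
  simp only [e1, e2]
  exact h2

theorem tendsto_integral_mul_of_eLpNorm {ι : Type*} {l : Filter ι} {F G : ι → α → ℝ} {f g : α → ℝ}
    (hF : ∀ k, MemLp (F k) 2 μ) (hf : MemLp f 2 μ) (hG : ∀ k, MemLp (G k) 2 μ) (hg : MemLp g 2 μ)
    (h : Tendsto (fun k => eLpNorm (F k - f) 2 μ) l (𝓝 0))
    (h' : Tendsto (fun k => eLpNorm (G k - g) 2 μ) l (𝓝 0)) :
    Tendsto (fun k => ∫ x, F k x * G k x ∂μ) l (𝓝 (∫ x, f x * g x ∂μ)) := by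
  simp only [fun k => integral_mul_eq_inner (hF k) (hG k), integral_mul_eq_inner hf hg]
  exact ((Lp.tendsto_Lp_iff_tendsto_eLpNorm'' F hF f hf).2 h).inner
    ((Lp.tendsto_Lp_iff_tendsto_eLpNorm'' G hG g hg).2 h')

theorem MemLp.bdd_mul_two {B f : α → ℝ} (hf : MemLp f 2 μ) (hB : AEStronglyMeasurable B μ) {C : ℝ}
    (hC : ∀ x, |B x| ≤ C) : MemLp (fun x => B x * f x) 2 μ := by
  refine (hf.const_mul C).of_le (hB.mul hf.1) (.of_forall fun x => ?_)
  rw [norm_mul, norm_mul]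
  exact mul_le_mul_of_nonneg_right ((hC x).trans (le_abs_self C)) (norm_nonneg _)

variable {κ : Type*} [Fintype κ] {B : α → Matrix κ κ ℝ}

theorem memLp_sum_coeff (hB : ∀ i j, Measurable fun x => B x i j) {C : ℝ}
    (hC : ∀ x i j, |B x i j| ≤ C) {w : κ → α → ℝ} (hw : ∀ i, MemLp (w i) 2 μ) (i : κ) :
    MemLp (fun x => ∑ j, B x i j * w j x) 2 μ :=
  memLp_finsetSum _ fun j _ => MemLp.bdd_mul_two (hw j) (hB i j).aestronglyMeasurable
    fun x => hC x i j

/-- The function `x ↦ B_x(v(x), w(x))` for a field `B` of matrices and two families `v`, `w` of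
functions, the components of vector fields. -/
def bilinField (B : α → Matrix κ κ ℝ) (v w : κ → α → ℝ) (x : α) : ℝ :=
  ∑ i, v i x * ∑ j, B x i j * w j x

theorem integrable_bilinField (hB : ∀ i j, Measurable fun x => B x i j) {C : ℝ}
    (hC : ∀ x i j, |B x i j| ≤ C) {v w : κ → α → ℝ} (hv : ∀ i, MemLp (v i) 2 μ)
    (hw : ∀ i, MemLp (w i) 2 μ) : Integrable (bilinField B v w) μ :=
  integrable_finsetSum _ fun i _ => (hv i).integrable_mul (memLp_sum_coeff hB hC hw i)

theorem integral_bilinField (hB : ∀ i j, Measurable fun x => B x i j) {C : ℝ}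
    (hC : ∀ x i j, |B x i j| ≤ C) {v w : κ → α → ℝ} (hv : ∀ i, MemLp (v i) 2 μ)
    (hw : ∀ i, MemLp (w i) 2 μ) :
    ∫ x, bilinField B v w x ∂μ = ∑ i, ∫ x, v i x * ∑ j, B x i j * w j x ∂μ :=
  integral_finsetSum _ fun i _ => (hv i).integrable_mul (memLp_sum_coeff hB hC hw i)

/-- The inequality `2 B(v, w) - B(w, w) ≤ B(v, v)`, which is `B(v - w, v - w) ≥ 0`. -/
theorem bilinField_sub_nonneg {x : α} (hB : (B x).PosSemidef) (v w : κ → α → ℝ) :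
    2 * bilinField B v w x - bilinField B w w x ≤ bilinField B v v x := by
  have hs : bilinField B v w x = bilinField B w v x := by
    unfold bilinField
    simp only [Finset.mul_sum]
    rw [Finset.sum_comm]
    refine Finset.sum_congr rfl fun i _ => Finset.sum_congr rfl fun j _ => ?_
    have : B x j i = B x i j := by simpa using hB.isHermitian.apply i j
    rw [this]
    ring
  have h := hB.dotProduct_mulVec_nonneg (fun i => v i x - w i x)
  have e : star (fun i => v i x - w i x) ⬝ᵥ (B x).mulVec (fun i => v i x - w i x) =
      bilinField B v v x - bilinField B v w x - (bilinField B w v x - bilinField B w w x) := by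
    simp only [bilinField, dotProduct, Matrix.mulVec, star_trivial, ← Finset.sum_sub_distrib]
    refine Finset.sum_congr rfl fun i _ => ?_
    rw [← mul_sub, ← mul_sub, ← sub_mul, ← Finset.sum_sub_distrib]
    congr 1
    exact Finset.sum_congr rfl fun j _ => by ring
  rw [e] at h
  linarith

/-- Nonnegative quadratic forms are lower semicontinuous for weak convergence. -/
theorem integral_bilinField_le_of_weak_limit (𝒰 : Ultrafilter ℕ)
    (hB : ∀ i j, Measurable fun x => B x i j) {C : ℝ} (hC : ∀ x i j, |B x i j| ≤ C)
    (hpos : ∀ x, (B x).PosSemidef) {V : ℕ → κ → α → ℝ} {W : κ → α → ℝ}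
    (hV : ∀ k i, MemLp (V k i) 2 μ) (hW : ∀ i, MemLp (W i) 2 μ)
    (hlim : ∀ i, ∀ h : α → ℝ, MemLp h 2 μ →
      Tendsto (fun k => ∫ x, V k i x * h x ∂μ) 𝒰 (𝓝 (∫ x, W i x * h x ∂μ)))
    {b : ℕ → ℝ} {L : ℝ} (hb : ∀ k, ∫ x, bilinField B (V k) (V k) x ∂μ ≤ b k)
    (hbL : Tendsto b 𝒰 (𝓝 L)) : ∫ x, bilinField B W W x ∂μ ≤ L := by
  have h1 : Tendsto (fun k => ∫ x, bilinField B (V k) W x ∂μ) 𝒰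
      (𝓝 (∫ x, bilinField B W W x ∂μ)) := by
    simp only [fun k => integral_bilinField hB hC (hV k) hW, integral_bilinField hB hC hW hW]
    exact tendsto_finsetSum _ fun i _ => hlim i _ (memLp_sum_coeff hB hC hW i)
  -- Pass to the limit in `2 B(V k, W) - B(W, W) ≤ B(V k, V k)`.
  have h2 := (h1.const_mul 2).sub_const (∫ x, bilinField B W W x ∂μ)
  have h3 := le_of_tendsto_of_tendsto' h2 hbL fun k => ?_
  · linarith
  refine le_trans ?_ (hb k)
  rw [← integral_const_mul, ← integral_sub ((integrable_bilinField hB hC (hV k) hW).const_mul 2)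
    (integrable_bilinField hB hC hW hW)]
  exact integral_mono (((integrable_bilinField hB hC (hV k) hW).const_mul 2).sub
    (integrable_bilinField hB hC hW hW)) (integrable_bilinField hB hC (hV k) (hV k))
    fun x => bilinField_sub_nonneg (hpos x) _ _

theorem tendsto_integral_bilinField {ι : Type*} {l : Filter ι}
    (hB : ∀ i j, Measurable fun x => B x i j) {C : ℝ} (hC : ∀ x i j, |B x i j| ≤ C)
    {V : ι → κ → α → ℝ} {W : κ → α → ℝ}
    (hV : ∀ k i, MemLp (V k i) 2 μ) (hW : ∀ i, MemLp (W i) 2 μ)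
    (hlim : ∀ i, Tendsto (fun k => eLpNorm (V k i - W i) 2 μ) l (𝓝 0)) :
    Tendsto (fun k => ∫ x, bilinField B (V k) (V k) x ∂μ) l
      (𝓝 (∫ x, bilinField B W W x ∂μ)) := by
  simp only [fun k => integral_bilinField hB hC (hV k) (hV k), integral_bilinField hB hC hW hW]
  refine tendsto_finsetSum _ fun i _ => tendsto_integral_mul_of_eLpNorm (fun k => hV k i) (hW i)
    (fun k => memLp_sum_coeff hB hC (hV k) i) (memLp_sum_coeff hB hC hW i) (hlim i) ?_
  have hz : Tendsto (fun k => ∑ j, ENNReal.ofReal C * eLpNorm (V k j - W j) 2 μ) l (𝓝 0) := by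
    have := tendsto_finsetSum (Finset.univ : Finset κ) fun j _ =>
      ENNReal.Tendsto.const_mul (hlim j) (Or.inr (ENNReal.ofReal_ne_top (r := C)))
    simpa using this
  refine tendsto_of_tendsto_of_tendsto_of_le_of_le tendsto_const_nhds hz
    (fun _ => zero_le) fun k => ?_
  have e : ((fun x => ∑ j, B x i j * V k j x) - fun x => ∑ j, B x i j * W j x) =
      ∑ j, fun x => B x i j * (V k j - W j) x := by
    funext x
    simp only [Pi.sub_apply, Finset.sum_apply, ← Finset.sum_sub_distrib, mul_sub]
  simp only [e]
  refine (eLpNorm_sum_le (fun j _ => (hB i j).aestronglyMeasurable.mul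
    ((hV k j).sub (hW j)).1) (by norm_num)).trans (Finset.sum_le_sum fun j _ => ?_)
  exact eLpNorm_le_mul_eLpNorm_of_ae_le_mul (.of_forall fun x => by
    rw [Pi.mul_apply, norm_mul]
    exact mul_le_mul_of_nonneg_right (hC x i j) (norm_nonneg _)) 2

end WeakLimit

/-! ### Symmetrization and energy on `X × ℝⁿ` -/

/-- Lipschitz functions have weak derivatives, the ones which exist almost everywhere. -/
theorem LipschitzWith.weakDeriv {Z : Type*} [NormedAddCommGroup Z] [NormedSpace ℝ Z]
    [FiniteDimensional ℝ Z] [MeasurableSpace Z] [BorelSpace Z] {μ : Measure Z} [μ.IsAddHaarMeasure]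
    {F : Z → ℝ} {L : ℝ≥0} (hF : LipschitzWith L F) (v : Z) :
    WeakDeriv μ Set.univ v F fun z => fderiv ℝ F z v := by
  intro ψ hψ hψc _
  obtain ⟨D, hD⟩ := (hψ.of_le (by simp) : ContDiff ℝ 1 ψ).lipschitzWith_of_hasCompactSupport hψc (by simp)
  have h := hF.integral_lineDeriv_mul_eq (μ := μ) hD hψc v
  have e1 : ∫ z, lineDeriv ℝ F z v * ψ z ∂μ = ∫ z, fderiv ℝ F z v * ψ z ∂μ := by
    refine integral_congr_ae ?_
    filter_upwards [hF.ae_differentiableAt (μ := μ)] with z hz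
    rw [hz.lineDeriv_eq_fderiv]
  have e2 : ∫ z, lineDeriv ℝ ψ z (-v) * F z ∂μ = - ∫ z, F z * fderiv ℝ ψ z v ∂μ := by
    rw [← integral_neg]
    refine integral_congr_ae (.of_forall fun z => ?_)
    simp only
    rw [((hψ.differentiable (by simp)) z).lineDeriv_eq_fderiv, map_neg]
    ring
  rw [e1, e2] at h
  linarith

theorem LipschitzWith.abs_comp {Z : Type*} [PseudoMetricSpace Z] {f : Z → ℝ} {L : ℝ≥0}
    (hf : LipschitzWith L f) : LipschitzWith L fun z => |f z| :=
  LipschitzWith.of_dist_le_mul fun z z' =>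
    (abs_abs_sub_abs_le (f z) (f z')).trans (hf.dist_le_mul z z')

section Flat

open scoped MatrixOrder

variable {X : Type*} [NormedAddCommGroup X] [NormedSpace ℝ X] {n : ℕ} {ι : Type*}

/-- The vectors `(b i, 0)` and `(0, e_j)` of `X × ℝⁿ`. -/
noncomputable def frameVec (b : ι → X) : ι ⊕ Fin n → X × EuclideanSpace ℝ (Fin n) :=
  Sum.elim (fun i => (b i, 0)) fun j => (0, EuclideanSpace.basisFun (Fin n) ℝ j)

/-- The derivatives of `|f|` are not larger than those of `f`. At a zero of `f`, the function `|f|`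
has a minimum, and `fderiv` is `0` there whether or not `|f|` is differentiable. -/
theorem fderiv_abs_sq_le {Z : Type*} [NormedAddCommGroup Z] [NormedSpace ℝ Z] {f : Z → ℝ} {z : Z}
    (hf : DifferentiableAt ℝ f z) (v : Z) :
    fderiv ℝ (fun z => |f z|) z v ^ 2 ≤ fderiv ℝ f z v ^ 2 := by
  rcases eq_or_ne (f z) 0 with h0 | h0
  · have : IsLocalMin (fun z => |f z|) z := .of_forall fun w => by simp [h0]
    rw [this.fderiv_eq_zero]
    simpa using sq_nonneg _
  · have h := (hasDerivAt_abs h0).comp_hasFDerivAt z hf.hasFDerivAt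
    have e : fderiv ℝ (fun z => |f z|) z = _ := h.fderiv
    rw [e]
    rcases lt_or_gt_of_ne h0 with h | h <;> simp [h]

variable [Fintype ι] [DecidableEq ι]

/-- The quadratic form with matrix `A` in the directions of `X` and `c` times the Euclidean form in
the directions of `ℝⁿ`. -/
noncomputable def splitMatrix (n : ℕ) (A : Matrix ι ι ℝ) (c : ℝ) : Matrix (ι ⊕ Fin n) (ι ⊕ Fin n) ℝ :=
  Matrix.fromBlocks A 0 0 (c • 1)

theorem splitMatrix_posSemidef {A : Matrix ι ι ℝ} (hA : A.PosSemidef) {c : ℝ} (hc : 0 ≤ c) :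
    (splitMatrix n A c).PosSemidef := by
  refine .of_dotProduct_mulVec_nonneg ?_ fun x => ?_
  · rw [splitMatrix, Matrix.isHermitian_fromBlocks_iff]
    refine ⟨hA.1, by simp, by simp, ?_⟩
    ext i j
    simp [Matrix.one_apply, eq_comm]
  · have h := hA.dotProduct_mulVec_nonneg (x ∘ Sum.inl)
    have e : star x ⬝ᵥ (splitMatrix n A c).mulVec x =
        star (x ∘ Sum.inl) ⬝ᵥ A.mulVec (x ∘ Sum.inl) + c * ∑ j, x (Sum.inr j) ^ 2 := by
      simp only [splitMatrix, Matrix.fromBlocks_mulVec, dotProduct, Fintype.sum_sum_type,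
        star_trivial, Function.comp_apply, Sum.elim_inl, Sum.elim_inr, Matrix.zero_mulVec, add_zero,
        zero_add, Matrix.smul_mulVec, Matrix.one_mulVec, Pi.smul_apply, smul_eq_mul,
        Finset.mul_sum]
      congr 1
      exact Finset.sum_congr rfl fun j _ => by ring
    rw [e]
    positivity

theorem bilinField_splitMatrix {α : Type*} (A : α → Matrix ι ι ℝ) (c : α → ℝ)
    (w : ι ⊕ Fin n → α → ℝ) (z : α) :
    bilinField (fun z => splitMatrix n (A z) (c z)) w w z =
      (∑ i, w (Sum.inl i) z * ∑ j, A z i j * w (Sum.inl j) z) +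
        c z * ∑ j, w (Sum.inr j) z ^ 2 := by
  simp only [bilinField, splitMatrix, Fintype.sum_sum_type, Matrix.fromBlocks_apply₁₁,
    Matrix.fromBlocks_apply₁₂, Matrix.fromBlocks_apply₂₁, Matrix.fromBlocks_apply₂₂,
    Matrix.zero_apply, zero_mul, Finset.sum_const_zero, add_zero, zero_add, Matrix.smul_apply,
    Matrix.one_apply, smul_eq_mul, mul_ite, mul_one, mul_zero, ite_mul, Finset.sum_ite_eq,
    Finset.mem_univ, if_true, Finset.mul_sum]
  congr 1
  exact Finset.sum_congr rfl fun j _ => by ring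

/-- The energy density is a sum of squares of derivatives in the directions of `X` and of `ℝⁿ`. -/
theorem bilinField_splitMatrix_fderiv (b : ι → X) (S : Matrix ι ι ℝ) (c : ℝ)
    (F : X × EuclideanSpace ℝ (Fin n) → ℝ) (q : X × EuclideanSpace ℝ (Fin n)) :
    bilinField (fun _ => splitMatrix n (star S * S) c)
        (fun i q => fderiv ℝ F q (frameVec b i)) (fun i q => fderiv ℝ F q (frameVec b i)) q =
      (∑ k, fderiv ℝ F q (∑ i, S k i • b i, 0) ^ 2) +
        c * ∑ j, fderiv ℝ F q (0, EuclideanSpace.basisFun (Fin n) ℝ j) ^ 2 := by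
  rw [bilinField_splitMatrix]
  congr 1
  have e : ∀ k, fderiv ℝ F q (∑ i, S k i • b i, 0) =
      ∑ i, S k i * fderiv ℝ F q (frameVec b (Sum.inl i)) := by
    intro k
    have : ((∑ i, S k i • b i, 0) : X × EuclideanSpace ℝ (Fin n)) =
        ∑ i, S k i • frameVec b (Sum.inl i) := by
      ext1
      · simp [frameVec, Prod.fst_sum]
      · simp [frameVec, Prod.snd_sum]
    rw [this, map_sum]
    simp
  simp only [e, sq, Finset.mul_sum, Matrix.mul_apply, Matrix.star_apply, star_trivial,
    Finset.sum_mul]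
  symm
  rw [Finset.sum_comm]
  refine (Finset.sum_congr rfl fun i _ => Finset.sum_comm).trans ?_
  rw [Finset.sum_comm]
  exact Finset.sum_congr rfl fun i _ => Finset.sum_congr rfl fun j _ =>
    Finset.sum_congr rfl fun k _ => by ring

variable [FiniteDimensional ℝ X] [MeasurableSpace X] [BorelSpace X] (τ : Measure X)
  [τ.IsAddHaarMeasure]

/-- For a smooth function of compact support, and over almost every point of `X`, symmetrization of
the absolute value does not increase the energy for any quadratic form `A` on the base and any
multiple `c` of the Euclidean form on the fibres, simultaneously. -/
theorem ae_lintegral_energy_steiner_le (hn : 1 ≤ n) (b : ι → X)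
    {f : X × EuclideanSpace ℝ (Fin n) → ℝ} (hf : ContDiff ℝ ∞ f) (hfc : HasCompactSupport f) :
    ∀ᵐ x ∂τ, ∀ (A : Matrix ι ι ℝ) (c : ℝ), A.PosSemidef → 0 ≤ c →
      ∫⁻ y, ENNReal.ofReal (bilinField (fun _ => splitMatrix n A c)
          (fun i q => fderiv ℝ (steiner fun q => |f q|) q (frameVec b i))
          (fun i q => fderiv ℝ (steiner fun q => |f q|) q (frameVec b i)) (x, y)) ≤
        ∫⁻ y, ENNReal.ofReal (bilinField (fun _ => splitMatrix n A c)
          (fun i q => fderiv ℝ f q (frameVec b i)) (fun i q => fderiv ℝ f q (frameVec b i))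
            (x, y)) := by
  obtain ⟨L, hL⟩ :=
    (hf.of_le (by simp) : ContDiff ℝ 1 f).lipschitzWith_of_hasCompactSupport hfc (by simp)
  have hLa : LipschitzWith L fun q => |f q| := by
    exact hL.abs_comp
  have hac : HasCompactSupport fun q => |f q| := hfc.comp_left abs_zero
  have ha0 : 0 ≤ fun q => |f q| := fun q => abs_nonneg _
  have hdf : ∀ q v, fderiv ℝ (fun q => |f q|) q v ^ 2 ≤ fderiv ℝ f q v ^ 2 := fun q v =>
    fderiv_abs_sq_le (hf.differentiable (by simp) q) v
  have hms : ∀ v x, Measurable fun y => fderiv ℝ (steiner fun q => |f q|) (x, y) v := fun v x =>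
    (measurable_fderiv_apply_const ℝ _ v).comp measurable_prodMk_left
  have hmf : ∀ v x, Measurable fun y => fderiv ℝ f (x, y) v := fun v x =>
    (measurable_fderiv_apply_const ℝ _ v).comp measurable_prodMk_left
  filter_upwards [ae_lintegral_fderiv_steiner_base_le τ hn hLa hac ha0,
    ae_lintegral_fderiv_steiner_fibre_le τ hn hLa hac ha0] with x hx hx' A c hA hc
  -- Writing `A = Sᵀ S`, the energy becomes a sum of squares of derivatives, which are estimated one
  -- by one.
  obtain ⟨S, rfl⟩ := CStarAlgebra.nonneg_iff_eq_star_mul_self.1 hA.nonneg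
  simp only [bilinField_splitMatrix_fderiv]
  have hsplit : ∀ F : X × EuclideanSpace ℝ (Fin n) → ℝ,
      (∀ v x, Measurable fun y => fderiv ℝ F (x, y) v) →
      ∫⁻ y, ENNReal.ofReal ((∑ k, fderiv ℝ F (x, y) (∑ i, S k i • b i, 0) ^ 2) +
        c * ∑ j, fderiv ℝ F (x, y) (0, EuclideanSpace.basisFun (Fin n) ℝ j) ^ 2) =
      (∑ k, ∫⁻ y, ENNReal.ofReal (fderiv ℝ F (x, y) (∑ i, S k i • b i, 0) ^ 2)) +
        ENNReal.ofReal c * ∫⁻ y, ENNReal.ofReal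
          (∑ j, fderiv ℝ F (x, y) (0, EuclideanSpace.basisFun (Fin n) ℝ j) ^ 2) := by
    intro F hF
    rw [← lintegral_finsetSum _ fun k _ => ((hF _ x).pow_const 2).ennreal_ofReal,
      ← lintegral_const_mul _ (Finset.measurable_fun_sum _
        fun j _ => (hF _ x).pow_const 2).ennreal_ofReal,
      ← lintegral_add_left (Finset.measurable_fun_sum _
        fun k _ => ((hF _ x).pow_const 2).ennreal_ofReal)]
    refine lintegral_congr fun y => ?_
    rw [ENNReal.ofReal_add (Finset.sum_nonneg fun _ _ => sq_nonneg _)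
      (mul_nonneg hc (Finset.sum_nonneg fun _ _ => sq_nonneg _)),
      ENNReal.ofReal_sum_of_nonneg fun _ _ => sq_nonneg _, ENNReal.ofReal_mul hc]
  rw [hsplit _ hms, hsplit _ hmf]
  refine add_le_add (Finset.sum_le_sum fun k _ => (hx _).trans (lintegral_mono fun y =>
    ENNReal.ofReal_le_ofReal (hdf _ _))) (mul_le_mul' le_rfl (hx'.trans (lintegral_mono fun y =>
      ENNReal.ofReal_le_ofReal (Finset.sum_le_sum fun j _ => hdf _ _))))

/-- Symmetrization does not increase the energy with coefficients which depend on the base point. -/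
theorem lintegral_energy_steiner_le (hn : 1 ≤ n) (b : ι → X)
    {f : X × EuclideanSpace ℝ (Fin n) → ℝ} (hf : ContDiff ℝ ∞ f) (hfc : HasCompactSupport f)
    {A : X → Matrix ι ι ℝ} (hAm : ∀ i j, Measurable fun x => A x i j) {c : X → ℝ}
    (hcm : Measurable c) (hA : ∀ x, (A x).PosSemidef) (hc : ∀ x, 0 ≤ c x) :
    ∫⁻ q, ENNReal.ofReal (bilinField (fun q => splitMatrix n (A q.1) (c q.1))
          (fun i q => fderiv ℝ (steiner fun q => |f q|) q (frameVec b i))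
          (fun i q => fderiv ℝ (steiner fun q => |f q|) q (frameVec b i)) q) ∂(τ.prod volume) ≤
      ∫⁻ q, ENNReal.ofReal (bilinField (fun q => splitMatrix n (A q.1) (c q.1))
          (fun i q => fderiv ℝ f q (frameVec b i)) (fun i q => fderiv ℝ f q (frameVec b i)) q)
            ∂(τ.prod volume) := by
  have hm : ∀ F : X × EuclideanSpace ℝ (Fin n) → ℝ, Measurable fun q =>
      ENNReal.ofReal (bilinField (fun q => splitMatrix n (A q.1) (c q.1))
          (fun i q => fderiv ℝ F q (frameVec b i)) (fun i q => fderiv ℝ F q (frameVec b i)) q) := by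
    intro F
    refine Measurable.ennreal_ofReal ?_
    have he := bilinField_splitMatrix (fun q : X × EuclideanSpace ℝ (Fin n) => A q.1)
      (fun q => c q.1) fun i q => fderiv ℝ F q (frameVec b i)
    rw [funext he]
    have h1 : ∀ i, Measurable fun q => fderiv ℝ F q (frameVec b i) := fun i =>
      measurable_fderiv_apply_const ℝ F _
    refine (Finset.measurable_fun_sum _ fun i _ => (h1 _).mul (Finset.measurable_fun_sum _
      fun j _ => ((hAm i j).comp measurable_fst).mul (h1 _))).add
      ((hcm.comp measurable_fst).mul (Finset.measurable_fun_sum _ fun j _ => (h1 _).pow_const 2))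
  rw [lintegral_prod _ (hm _).aemeasurable, lintegral_prod _ (hm _).aemeasurable]
  refine lintegral_mono_ae ?_
  filter_upwards [ae_lintegral_energy_steiner_le τ hn b hf hfc] with x hx
  exact hx (A x) (c x) (hA x) (hc x)

theorem integral_energy_steiner_le (hn : 1 ≤ n) (b : ι → X)
    {f : X × EuclideanSpace ℝ (Fin n) → ℝ} (hf : ContDiff ℝ ∞ f) (hfc : HasCompactSupport f)
    {A : X → Matrix ι ι ℝ} (hAm : ∀ i j, Measurable fun x => A x i j) {c : X → ℝ}
    (hcm : Measurable c) (hA : ∀ x, (A x).PosSemidef) (hc : ∀ x, 0 ≤ c x)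
    (hi : Integrable (bilinField (fun q => splitMatrix n (A q.1) (c q.1))
      (fun i q => fderiv ℝ (steiner fun q => |f q|) q (frameVec b i))
      (fun i q => fderiv ℝ (steiner fun q => |f q|) q (frameVec b i))) (τ.prod volume))
    (hi' : Integrable (bilinField (fun q => splitMatrix n (A q.1) (c q.1))
      (fun i q => fderiv ℝ f q (frameVec b i)) (fun i q => fderiv ℝ f q (frameVec b i)))
      (τ.prod volume)) :
    ∫ q, bilinField (fun q => splitMatrix n (A q.1) (c q.1))
          (fun i q => fderiv ℝ (steiner fun q => |f q|) q (frameVec b i))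
          (fun i q => fderiv ℝ (steiner fun q => |f q|) q (frameVec b i)) q ∂(τ.prod volume) ≤
      ∫ q, bilinField (fun q => splitMatrix n (A q.1) (c q.1))
          (fun i q => fderiv ℝ f q (frameVec b i)) (fun i q => fderiv ℝ f q (frameVec b i)) q
            ∂(τ.prod volume) := by
  have hpos : ∀ F : X × EuclideanSpace ℝ (Fin n) → ℝ, ∀ q,
      0 ≤ bilinField (fun q => splitMatrix n (A q.1) (c q.1))
        (fun i q => fderiv ℝ F q (frameVec b i)) (fun i q => fderiv ℝ F q (frameVec b i)) q := by
    intro F q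
    exact (splitMatrix_posSemidef (hA q.1) (hc q.1)).dotProduct_mulVec_nonneg
      fun i => fderiv ℝ F q (frameVec b i)
  rw [integral_eq_lintegral_of_nonneg_ae (.of_forall (hpos _)) hi.1,
    integral_eq_lintegral_of_nonneg_ae (.of_forall (hpos _)) hi'.1]
  exact ENNReal.toReal_mono hi'.lintegral_lt_top.ne
    (lintegral_energy_steiner_le τ hn b hf hfc hAm hcm hA hc)

/-- The derivatives of the symmetrization are bounded in `L²` by those of the function. -/
theorem memLp_fderiv_steiner (hn : 1 ≤ n) (b : ι → X)
    {f : X × EuclideanSpace ℝ (Fin n) → ℝ} (hf : ContDiff ℝ ∞ f) (hfc : HasCompactSupport f)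
    (i : ι ⊕ Fin n) :
    MemLp (fun q => fderiv ℝ (steiner fun q => |f q|) q (frameVec b i)) 2 (τ.prod volume) ∧
      eLpNorm (fun q => fderiv ℝ (steiner fun q => |f q|) q (frameVec b i)) 2 (τ.prod volume) ≤
        ∑ i, eLpNorm (fun q => fderiv ℝ f q (frameVec b i)) 2 (τ.prod volume) := by
  have hdf : ∀ i, MemLp (fun q => fderiv ℝ f q (frameVec b i)) 2 (τ.prod volume) := fun i =>
    ((hf.continuous_fderiv (by simp)).clm_apply continuous_const).memLp_of_hasCompactSupport
      (hfc.fderiv_apply (𝕜 := ℝ) _)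
  have hle : eLpNorm (fun q => fderiv ℝ (steiner fun q => |f q|) q (frameVec b i)) 2
      (τ.prod volume) ≤ ∑ i, eLpNorm (fun q => fderiv ℝ f q (frameVec b i)) 2 (τ.prod volume) := by
    set D : ι ⊕ Fin n → X × EuclideanSpace ℝ (Fin n) → ℝ :=
      fun i q => |fderiv ℝ f q (frameVec b i)| with hD
    have h1 : eLpNorm (∑ i, D i) 2 (τ.prod volume) ≤
        ∑ i, eLpNorm (fun q => fderiv ℝ f q (frameVec b i)) 2 (τ.prod volume) := by
      refine (eLpNorm_sum_le (fun i _ => (hdf i).abs.1) (by norm_num)).trans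
        (Finset.sum_le_sum fun i _ => ?_)
      exact (eLpNorm_norm (fun q => fderiv ℝ f q (frameVec b i))).le
    refine le_trans ?_ h1
    rw [eLpNorm_two_eq_lintegral_sq, eLpNorm_two_eq_lintegral_sq]
    refine ENNReal.rpow_le_rpow ?_ (by norm_num)
    have h2 := lintegral_energy_steiner_le τ hn b hf hfc (A := fun _ => 1) (c := fun _ => 1)
      (fun i j => measurable_const) measurable_const (fun _ => Matrix.PosSemidef.one)
      (fun _ => zero_le_one)
    have e : ∀ F : X × EuclideanSpace ℝ (Fin n) → ℝ, ∀ q,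
        bilinField (fun _ => splitMatrix n (1 : Matrix ι ι ℝ) 1)
          (fun i q => fderiv ℝ F q (frameVec b i)) (fun i q => fderiv ℝ F q (frameVec b i)) q =
        ∑ i, fderiv ℝ F q (frameVec b i) ^ 2 := by
      intro F q
      rw [bilinField_splitMatrix (fun _ => 1) fun _ => 1, Fintype.sum_sum_type]
      simp [Matrix.one_apply, sq]
    simp only [e] at h2
    refine (lintegral_mono fun q => ENNReal.ofReal_le_ofReal ?_).trans (h2.trans
      (lintegral_mono fun q => ENNReal.ofReal_le_ofReal ?_))
    · exact Finset.single_le_sum (f := fun i =>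
        fderiv ℝ (steiner fun q => |f q|) q (frameVec b i) ^ 2) (fun _ _ => sq_nonneg _)
        (Finset.mem_univ i)
    · rw [Finset.sum_apply]
      refine le_trans (le_of_eq (Finset.sum_congr rfl fun i _ => (sq_abs _).symm))
        (Finset.sum_sq_le_sq_sum_of_nonneg fun i _ => abs_nonneg _)
  refine ⟨⟨(measurable_fderiv_apply_const ℝ _ _).aestronglyMeasurable, hle.trans_lt ?_⟩, hle⟩
  exact ENNReal.sum_lt_top.2 fun i _ => (hdf i).2

end Flat

section Flat

variable {X : Type*} [NormedAddCommGroup X] [NormedSpace ℝ X] {n : ℕ} {ι : Type*}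
  [Fintype ι] [DecidableEq ι] [FiniteDimensional ℝ X] [MeasurableSpace X] [BorelSpace X]
  (τ : Measure X) [τ.IsAddHaarMeasure]

/-- The Steiner symmetrization of `|w|`, for a function `w` with weak derivatives in `L²`, is the
weak limit of smooth functions `Φ k` of compact support whose derivatives converge weakly in `L²`.
The limits `W'` of the derivatives have smaller energy than the weak derivatives of `w`, for all
fields of quadratic forms which depend on the base point, simultaneously. Convergence is along an
ultrafilter, so that no subsequences have to be chosen. -/
theorem exists_weak_approx_steiner (hn : 1 ≤ n) (b : ι → X)
    {w : X × EuclideanSpace ℝ (Fin n) → ℝ} {W : ι ⊕ Fin n → X × EuclideanSpace ℝ (Fin n) → ℝ}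
    (hw : MemLp w 2 (τ.prod volume)) (hW : ∀ i, MemLp (W i) 2 (τ.prod volume))
    (hd : ∀ i, WeakDeriv (τ.prod volume) Set.univ (frameVec b i) w (W i))
    (𝒰 : Ultrafilter ℕ) (h𝒰 : ↑𝒰 ≤ (atTop : Filter ℕ)) :
    ∃ (Φ : ℕ → X × EuclideanSpace ℝ (Fin n) → ℝ)
      (W' : ι ⊕ Fin n → X × EuclideanSpace ℝ (Fin n) → ℝ),
      (∀ k, ContDiff ℝ ∞ (Φ k) ∧ HasCompactSupport (Φ k)) ∧
      (∀ i, MemLp (W' i) 2 (τ.prod volume)) ∧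
      (∀ h, MemLp h 2 (τ.prod volume) → Tendsto (fun k => ∫ q, Φ k q * h q ∂(τ.prod volume)) 𝒰
        (𝓝 (∫ q, steiner (fun q => |w q|) q * h q ∂(τ.prod volume)))) ∧
      (∀ i h, MemLp h 2 (τ.prod volume) → Tendsto (fun k => ∫ q, fderiv ℝ (Φ k) q (frameVec b i) *
        h q ∂(τ.prod volume)) 𝒰 (𝓝 (∫ q, W' i q * h q ∂(τ.prod volume)))) ∧
      ∀ (A : X → Matrix ι ι ℝ) (c : X → ℝ) (C : ℝ), (∀ i j, Measurable fun x => A x i j) →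
        Measurable c → (∀ x, (A x).PosSemidef) → (∀ x, 0 ≤ c x) → (∀ x i j, |A x i j| ≤ C) →
        (∀ x, c x ≤ C) →
        ∫ q, bilinField (fun q => splitMatrix n (A q.1) (c q.1)) W' W' q ∂(τ.prod volume) ≤
          ∫ q, bilinField (fun q => splitMatrix n (A q.1) (c q.1)) W W q ∂(τ.prod volume) := by
  set μ := τ.prod (volume : Measure (EuclideanSpace ℝ (Fin n))) with hμ
  set ε : ℕ → ℝ≥0∞ := fun k => ((k : ℝ≥0∞) + 1)⁻¹ with hε
  have hε0 : ∀ k, ε k ≠ 0 := fun k => by simp [hε]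
  have hε1 : ∀ k, ε k ≤ 1 := fun k => by simp [hε]
  have hεlim : Tendsto ε atTop (𝓝 0) := by
    have := (tendsto_add_atTop_iff_nat 1).2 ENNReal.tendsto_inv_nat_nhds_zero
    simpa [hε] using this
  -- Approximate `w` by smooth functions `f k` and symmetrize them. The resulting Lipschitz
  -- functions `F k` are again approximated by smooth functions `Φ k`.
  choose f hfs hfc hf hdf using fun k => exists_smooth_near hw hW hd (hε0 k)
  set F : ℕ → X × EuclideanSpace ℝ (Fin n) → ℝ := fun k => steiner fun q => |f k q| with hF
  have hfm : ∀ k, MemLp (f k) 2 μ := fun k =>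
    (hfs k).continuous.memLp_of_hasCompactSupport (hfc k)
  have hfd : ∀ k i, MemLp (fun q => fderiv ℝ (f k) q (frameVec b i)) 2 μ := fun k i =>
    (((hfs k).continuous_fderiv (by simp)).clm_apply
      continuous_const).memLp_of_hasCompactSupport ((hfc k).fderiv_apply (𝕜 := ℝ) _)
  have hFm : ∀ k, MemLp (F k) 2 μ := fun k =>
    memLp_steiner hn (hfm k).abs (.of_forall fun q => abs_nonneg _)
  have hFd : ∀ k i, MemLp (fun q => fderiv ℝ (F k) q (frameVec b i)) 2 μ := fun k i =>
    (memLp_fderiv_steiner τ hn b (hfs k) (hfc k) i).1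
  have hFw : ∀ k i, WeakDeriv μ Set.univ (frameVec b i) (F k)
      fun q => fderiv ℝ (F k) q (frameVec b i) := by
    intro k i
    obtain ⟨L, hL⟩ := ((hfs k).of_le (by simp) :
      ContDiff ℝ 1 (f k)).lipschitzWith_of_hasCompactSupport (hfc k) (by simp)
    have hLa : LipschitzWith L fun q => |f k q| := by
      exact hL.abs_comp
    exact (lipschitzWith_steiner hn hLa ((hfc k).comp_left abs_zero)
      fun q => abs_nonneg _).weakDeriv _
  choose Φ hΦs hΦc hΦ hdΦ using fun k => exists_smooth_near (hFm k) (hFd k) (hFw k) (hε0 k)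
  have hΦm : ∀ k, MemLp (Φ k) 2 μ := fun k =>
    (hΦs k).continuous.memLp_of_hasCompactSupport (hΦc k)
  have hΦd : ∀ k i, MemLp (fun q => fderiv ℝ (Φ k) q (frameVec b i)) 2 μ := fun k i =>
    (((hΦs k).continuous_fderiv (by simp)).clm_apply
      continuous_const).memLp_of_hasCompactSupport ((hΦc k).fderiv_apply (𝕜 := ℝ) _)
  have hsm : MemLp (steiner fun q => |w q|) 2 μ :=
    memLp_steiner hn hw.abs (.of_forall fun q => abs_nonneg _)
  -- the derivatives of the symmetrized approximations are bounded in `L²`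
  have hbound : ∀ i, ∃ W', MemLp W' 2 μ ∧ ∀ h, MemLp h 2 μ → Tendsto (fun k =>
      ∫ q, fderiv ℝ (F k) q (frameVec b i) * h q ∂μ) 𝒰 (𝓝 (∫ q, W' q * h q ∂μ)) := by
    intro i
    set C := ∑ i, (1 + eLpNorm (W i) 2 μ) with hC
    have hCt : C ≠ ⊤ := (ENNReal.sum_lt_top.2 fun i _ =>
      ENNReal.add_lt_top.2 ⟨ENNReal.one_lt_top, (hW i).2⟩).ne
    refine exists_weak_limit 𝒰 (fun k => hFd k i) (C := C.toNNReal) fun k => ?_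
    rw [ENNReal.coe_toNNReal hCt]
    refine (memLp_fderiv_steiner τ hn b (hfs k) (hfc k) i).2.trans
      (Finset.sum_le_sum fun j _ => ?_)
    have e : (fun q => fderiv ℝ (f k) q (frameVec b j)) =
        (fun q => fderiv ℝ (f k) q (frameVec b j) - W j q) + W j := by
      funext q; simp
    rw [e]
    exact (eLpNorm_add_le ((hfd k j).sub (hW j)).1 (hW j).1 (by norm_num)).trans
      (add_le_add ((hdf k j).trans (hε1 k)) le_rfl)
  choose W' hW' hlim using hbound
  have hst : Tendsto (fun k => eLpNorm (Φ k - steiner fun q => |w q|) 2 μ) atTop (𝓝 0) := by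
    have h2 : Tendsto (fun k => ε k + ε k) atTop (𝓝 0) := by simpa using hεlim.add hεlim
    refine tendsto_of_tendsto_of_tendsto_of_le_of_le tendsto_const_nhds h2 (fun _ => zero_le)
      fun k => ?_
    have e : Φ k - steiner (fun q => |w q|) =
        (fun q => Φ k q - F k q) + (F k - steiner fun q => |w q|) := by
      funext q; simp
    simp only [e]
    refine (eLpNorm_add_le ((hΦm k).sub (hFm k)).1 ((hFm k).sub hsm).1 (by norm_num)).trans
      (add_le_add (hΦ k) ?_)
    refine (eLpNorm_steiner_sub_le hn (hfm k).abs (.of_forall fun q => abs_nonneg _) hw.abs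
      (.of_forall fun q => abs_nonneg _)).trans (le_trans (eLpNorm_mono fun q => ?_) (hf k))
    exact abs_abs_sub_abs_le _ _
  have hconst : ∀ h : X × EuclideanSpace ℝ (Fin n) → ℝ,
      Tendsto (fun _ : ℕ => eLpNorm (h - h) 2 μ) 𝒰 (𝓝 0) := fun h => by simp
  refine ⟨Φ, W', fun k => ⟨hΦs k, hΦc k⟩, hW', fun h hh => ?_, fun i h hh => ?_, ?_⟩
  · exact tendsto_integral_mul_of_eLpNorm hΦm hsm (fun _ => hh) hh (hst.mono_left h𝒰) (hconst h)
  · have h1 : Tendsto (fun k => ∫ q, (fderiv ℝ (Φ k) q (frameVec b i) -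
        fderiv ℝ (F k) q (frameVec b i)) * h q ∂μ) 𝒰 (𝓝 (∫ q, (0 : ℝ) * h q ∂μ)) := by
      refine tendsto_integral_mul_of_eLpNorm (f := fun _ => (0 : ℝ))
        (fun k => (hΦd k i).sub (hFd k i)) MemLp.zero' (fun _ => hh) hh ?_ (hconst h)
      refine Tendsto.mono_left ?_ h𝒰
      refine tendsto_of_tendsto_of_tendsto_of_le_of_le tendsto_const_nhds hεlim
        (fun _ => zero_le) fun k => ?_
      refine le_trans (le_of_eq ?_) (hdΦ k i)
      congr 1
      funext q
      simp
    have h2 := h1.add (hlim i h hh)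
    simp only [zero_mul, integral_zero, zero_add] at h2
    refine h2.congr fun k => ?_
    have h3 := integral_add (((hΦd k i).sub (hFd k i)).integrable_mul hh)
      ((hFd k i).integrable_mul hh)
    refine h3.symm.trans (integral_congr_ae (.of_forall fun q => ?_))
    simp only [Pi.mul_apply, Pi.sub_apply]
    ring
  · intro A c C hAm hcm hA hc hAC hcC
    have hBm : ∀ i j, Measurable fun q : X × EuclideanSpace ℝ (Fin n) =>
        splitMatrix n (A q.1) (c q.1) i j := by
      rintro (i | i) (j | j)
      · exact (hAm i j).comp measurable_fst
      · exact measurable_const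
      · exact measurable_const
      · exact (hcm.comp measurable_fst).mul_const _
    have hBC : ∀ (q : X × EuclideanSpace ℝ (Fin n)) i j,
        |splitMatrix n (A q.1) (c q.1) i j| ≤ |C| := by
      rintro q (i | i) (j | j)
      · exact (hAC q.1 i j).trans (le_abs_self C)
      · simp [splitMatrix]
      · simp [splitMatrix]
      · simp only [splitMatrix, Matrix.fromBlocks_apply₂₂, Matrix.smul_apply, Matrix.one_apply,
          smul_eq_mul, mul_ite, mul_one, mul_zero]
        split_ifs
        · rw [abs_of_nonneg (hc _)]
          exact (hcC _).trans (le_abs_self C)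
        · simp
    refine integral_bilinField_le_of_weak_limit 𝒰 hBm hBC
      (fun q => splitMatrix_posSemidef (hA q.1) (hc q.1)) hFd hW' hlim
      (fun k => integral_energy_steiner_le τ hn b (hfs k) (hfc k) hAm hcm hA hc
        (integrable_bilinField hBm hBC (hFd k) (hFd k))
        (integrable_bilinField hBm hBC (hfd k) (hfd k))) ?_
    refine (tendsto_integral_bilinField hBm hBC hfd hW fun i => ?_).mono_left h𝒰
    exact tendsto_of_tendsto_of_tendsto_of_le_of_le tendsto_const_nhds hεlim
        (fun _ => zero_le) fun k => hdf k i

end Flat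

/-! ### Weak derivatives and diffeomorphisms -/

section Pullback

variable {Z : Type*} [NormedAddCommGroup Z] [NormedSpace ℝ Z] [FiniteDimensional ℝ Z]
  [MeasurableSpace Z] [BorelSpace Z] {μ : Measure Z} [μ.IsAddHaarMeasure]

/-- `T` is a smooth diffeomorphism of the open set `O` onto the open set `O'` with inverse `S`. -/
structure IsDiffeoOn (O O' : Set Z) (T S : Z → Z) : Prop where
  isOpen : IsOpen O
  isOpen' : IsOpen O'
  contDiffOn : ContDiffOn ℝ ∞ T O
  contDiffOn_symm : ContDiffOn ℝ ∞ S O'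
  mapsTo : ∀ z ∈ O, T z ∈ O'
  mapsTo_symm : ∀ w ∈ O', S w ∈ O
  left_inv : ∀ z ∈ O, S (T z) = z
  right_inv : ∀ w ∈ O', T (S w) = w

namespace IsDiffeoOn

variable {O O' : Set Z} {T S : Z → Z} (h : IsDiffeoOn O O' T S)
include h

theorem hasFDerivAt {z : Z} (hz : z ∈ O) : HasFDerivAt T (fderiv ℝ T z) z :=
  ((h.contDiffOn.contDiffAt (h.isOpen.mem_nhds hz)).differentiableAt (by simp)).hasFDerivAt

theorem hasFDerivAt_symm {w : Z} (hw : w ∈ O') : HasFDerivAt S (fderiv ℝ S w) w :=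
  ((h.contDiffOn_symm.contDiffAt (h.isOpen'.mem_nhds hw)).differentiableAt (by simp)).hasFDerivAt

theorem continuousOn_fderiv_apply (e : Z) : ContinuousOn (fun z => fderiv ℝ T z e) O :=
  (h.contDiffOn.continuousOn_fderiv_of_isOpen h.isOpen (by simp)).clm_apply continuousOn_const

theorem continuousOn_abs_det : ContinuousOn (fun w => |(fderiv ℝ S w).det|) O' :=
  (ContinuousLinearMap.continuous_det.comp_continuousOn
    (h.contDiffOn_symm.continuousOn_fderiv_of_isOpen h.isOpen' (by simp))).abs

theorem injOn_symm : Set.InjOn S O' := fun w hw w' hw' e => by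
  rw [← h.right_inv w hw, e, h.right_inv w' hw']

theorem image_symm : S '' O' = O := by
  ext z
  constructor
  · rintro ⟨w, hw, rfl⟩
    exact h.mapsTo_symm w hw
  · exact fun hz => ⟨T z, h.mapsTo z hz, h.left_inv z hz⟩

/-- The pullback of a locally integrable function is locally integrable. -/
theorem integrableOn_comp {W : Z → ℝ} (hW : LocallyIntegrable W μ) {K : Set Z} (hK : IsCompact K)
    (hKO : K ⊆ O) : IntegrableOn (fun z => W (T z)) K μ := by
  have hTK : IsCompact (T '' K) := hK.image_of_continuousOn (h.contDiffOn.continuousOn.mono hKO)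
  have hTO : T '' K ⊆ O' := by
    rintro _ ⟨z, hz, rfl⟩
    exact h.mapsTo z (hKO hz)
  have hSK : S '' (T '' K) = K := by
    rw [Set.image_image]
    exact (Set.image_congr fun z hz => h.left_inv z (hKO hz)).trans (Set.image_id K)
  rw [← hSK, integrableOn_image_iff_integrableOn_abs_det_fderiv_smul μ hTK.measurableSet
    (fun w hw => (h.hasFDerivAt_symm (hTO hw)).hasFDerivWithinAt) (h.injOn_symm.mono hTO)]
  refine ((hW.integrableOn_isCompact hTK).continuousOn_smul
    (h.continuousOn_abs_det.mono hTO) hTK).congr_fun ?_ hTK.measurableSet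
  intro w hw
  simp only [h.right_inv w (hTO hw)]

theorem locallyIntegrableOn_comp {W : Z → ℝ} (hW : LocallyIntegrable W μ) :
    LocallyIntegrableOn (fun z => W (T z)) O μ :=
  (locallyIntegrableOn_iff h.isOpen.isLocallyClosed).2 fun _ hKO hK => h.integrableOn_comp hW hK hKO

/-- The density, with respect to the coordinates `w = T z`, of the measure `a dz`. -/
theorem exists_integral_comp_mul {a : Z → ℝ} (ha : Continuous a) (hac : HasCompactSupport a)
    (haO : tsupport a ⊆ O) : ∃ a' : Z → ℝ, MemLp a' 2 μ ∧
      ∀ f : Z → ℝ, ∫ z, f (T z) * a z ∂μ = ∫ w, f w * a' w ∂μ := by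
  -- The density of the change of variables formula.
  set d : Z → ℝ := fun w => |(fderiv ℝ S w).det| * a (S w) with hd
  have hTK : IsCompact (T '' tsupport a) :=
    hac.isCompact.image_of_continuousOn (h.contDiffOn.continuousOn.mono haO)
  have hTO : T '' tsupport a ⊆ O' := by
    rintro _ ⟨z, hz, rfl⟩
    exact h.mapsTo z (haO hz)
  have hdc : ContinuousOn d O' :=
    h.continuousOn_abs_det.mul (ha.comp_continuousOn h.contDiffOn_symm.continuousOn)
  have hzero : ∀ w ∈ O', w ∉ T '' tsupport a → d w = 0 := by
    intro w hw hwT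
    have : a (S w) = 0 := by
      by_contra h0
      exact hwT ⟨S w, subset_tsupport a h0, h.right_inv w hw⟩
    simp [hd, this]
  refine ⟨(T '' tsupport a).indicator d, ?_, fun f => ?_⟩
  · rw [memLp_indicator_iff_restrict hTK.measurableSet]
    have : IsFiniteMeasure (μ.restrict (T '' tsupport a)) :=
      ⟨by simpa using hTK.measure_lt_top⟩
    obtain ⟨C, hC⟩ := hTK.exists_bound_of_continuousOn (hdc.mono hTO)
    exact MemLp.of_bound ((hdc.mono hTO).aestronglyMeasurable hTK.measurableSet) C
      ((ae_restrict_iff' hTK.measurableSet).2 (.of_forall hC))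
  · calc ∫ z, f (T z) * a z ∂μ = ∫ z in O, f (T z) * a z ∂μ := by
          refine (setIntegral_eq_integral_of_forall_compl_eq_zero fun z hz => ?_).symm
          have : a z = 0 := by
            by_contra h0
            exact hz (haO (subset_tsupport a h0))
          simp [this]
      _ = ∫ w in O', |(fderiv ℝ S w).det| • (f (T (S w)) * a (S w)) ∂μ := by
          conv_lhs => rw [← h.image_symm]
          exact integral_image_eq_integral_abs_det_fderiv_smul μ h.isOpen'.measurableSet
            (fun w hw => (h.hasFDerivAt_symm hw).hasFDerivWithinAt) h.injOn_symm _
      _ = ∫ w in O', f w * (T '' tsupport a).indicator d w ∂μ := by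
          refine setIntegral_congr_fun h.isOpen'.measurableSet fun w hw => ?_
          simp only [smul_eq_mul, h.right_inv w hw]
          by_cases hwT : w ∈ T '' tsupport a
          · rw [Set.indicator_of_mem hwT]
            simp only [hd]
            ring
          · rw [Set.indicator_of_notMem hwT]
            have := hzero w hw hwT
            simp only [hd] at this
            linear_combination f w * this
      _ = _ := by
          refine setIntegral_eq_integral_of_forall_compl_eq_zero fun w hw => ?_
          rw [Set.indicator_of_notMem fun hwT => hw (hTO hwT), mul_zero]

/-- Continuity of a coefficient of the derivative of `T`, cut off inside `O`. -/
theorem continuous_fderiv_mul {ψ : Z → ℝ} (hψ : Continuous ψ) (hO : tsupport ψ ⊆ O)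
    (ℓ : Z →L[ℝ] ℝ) (e : Z) : Continuous fun z => ℓ (fderiv ℝ T z e) * ψ z := by
  refine continuous_of_tsupport fun z hz => ?_
  have hz' : z ∈ O := hO (closure_mono (Function.support_mul_subset_right _ ψ) hz)
  exact ((ℓ.continuous.comp_continuousOn (h.continuousOn_fderiv_apply e)).continuousAt
    (h.isOpen.mem_nhds hz')).mul hψ.continuousAt

/-- The chain rule for the weak derivatives of a function `v`, which is the weak limit of smooth
functions, and a diffeomorphism. -/
theorem weakDeriv_comp {κ β : Type*} [Fintype κ] (b : Module.Basis κ ℝ Z) {l : Filter β} [l.NeBot]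
    {Φ : β → Z → ℝ} (hΦ : ∀ k, ContDiff ℝ ∞ (Φ k)) {v : Z → ℝ} {W : κ → Z → ℝ}
    (hW : ∀ i, MemLp (W i) 2 μ)
    (hv : ∀ g, MemLp g 2 μ → Tendsto (fun k => ∫ z, Φ k z * g z ∂μ) l (𝓝 (∫ z, v z * g z ∂μ)))
    (hvW : ∀ i g, MemLp g 2 μ → Tendsto (fun k => ∫ z, fderiv ℝ (Φ k) z (b i) * g z ∂μ) l
      (𝓝 (∫ z, W i z * g z ∂μ))) (e : Z) :
    WeakDeriv μ O e (fun z => v (T z)) fun z => ∑ i, b.repr (fderiv ℝ T z e) i * W i (T z) := by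
  intro ψ hψ hψc hψO
  set ℓ : κ → Z →L[ℝ] ℝ := fun i => LinearMap.toContinuousLinearMap (b.coord i) with hℓ
  have hℓb : ∀ i x, b.repr x i = ℓ i x := fun i x => rfl
  have hdψ : Continuous fun z => fderiv ℝ ψ z e :=
    (hψ.continuous_fderiv (by simp)).clm_apply continuous_const
  have hdψO : tsupport (fun z => fderiv ℝ ψ z e) ⊆ O :=
    (tsupport_fderiv_apply_subset ℝ e).trans hψO
  obtain ⟨a, ha, hae⟩ := h.exists_integral_comp_mul (μ := μ) hdψ (hψc.fderiv_apply (𝕜 := ℝ) e) hdψO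
  have hci := fun i => h.continuous_fderiv_mul hψ.continuous hψO (ℓ i) e
  have hcc : ∀ i, HasCompactSupport fun z => ℓ i (fderiv ℝ T z e) * ψ z := fun i => hψc.mul_left
  have hcO : ∀ i, tsupport (fun z => ℓ i (fderiv ℝ T z e) * ψ z) ⊆ O := fun i =>
    (closure_mono (Function.support_mul_subset_right _ ψ)).trans hψO
  choose a' ha' hae' using fun i => h.exists_integral_comp_mul (μ := μ) (hci i) (hcc i) (hcO i)
  have hsum : ∀ G : κ → Z → ℝ, (∀ i, LocallyIntegrable (G i) μ) →
      ∫ z, (∑ i, b.repr (fderiv ℝ T z e) i * G i (T z)) * ψ z ∂μ =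
        ∑ i, ∫ z, G i z * a' i z ∂μ := by
    intro G hG
    simp only [← hae']
    rw [← integral_finsetSum _ fun i _ =>
      LocallyIntegrableOn.integrable_mul_of_tsupport_subset (h.locallyIntegrableOn_comp (hG i))
        (hci i) (hcc i) (hcO i)]
    refine integral_congr_ae (.of_forall fun z => ?_)
    simp only [Finset.sum_mul, hℓb]
    exact Finset.sum_congr rfl fun i _ => by ring
  -- Integration by parts and the classical chain rule for `Φ k ∘ T`, in the coordinates `w = T z`.
  have hcl : ∀ k, ∫ z, Φ k z * a z ∂μ = - ∑ i, ∫ z, fderiv ℝ (Φ k) z (b i) * a' i z ∂μ := by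
    intro k
    have hdk : ∀ i, Continuous fun z => fderiv ℝ (Φ k) z (b i) := fun i =>
      ((hΦ k).continuous_fderiv (by simp)).clm_apply continuous_const
    have hchain : ∀ z ∈ O, fderiv ℝ (fun z => Φ k (T z)) z e =
        ∑ i, b.repr (fderiv ℝ T z e) i * fderiv ℝ (Φ k) (T z) (b i) := by
      intro z hz
      have h1 : HasFDerivAt (fun z => Φ k (T z)) ((fderiv ℝ (Φ k) (T z)).comp (fderiv ℝ T z)) z :=
        (((hΦ k).differentiable (by simp)) (T z)).hasFDerivAt.comp z (h.hasFDerivAt hz)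
      rw [h1.fderiv, ContinuousLinearMap.comp_apply]
      have h2 := congrArg (fderiv ℝ (Φ k) (T z)) (b.sum_repr (fderiv ℝ T z e))
      rw [map_sum] at h2
      rw [← h2]
      simp
    have hψ0 : ∀ z, z ∉ O → ψ z = 0 := fun z hz => by
      by_contra h0
      exact hz (hψO (subset_tsupport ψ h0))
    have hlocΦ : LocallyIntegrableOn (fun z => Φ k (T z)) O μ :=
      h.locallyIntegrableOn_comp (hΦ k).continuous.locallyIntegrable
    have e2 : ∫ z, fderiv ℝ (fun z => Φ k (T z)) z e * ψ z ∂μ =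
        ∫ z, (∑ i, b.repr (fderiv ℝ T z e) i * fderiv ℝ (Φ k) (T z) (b i)) * ψ z ∂μ := by
      refine integral_congr_ae (.of_forall fun z => ?_)
      by_cases hz : z ∈ O
      · simp only [hchain z hz]
      · simp [hψ0 z hz]
    rw [← hae, ← hsum _ fun i => (hdk i).locallyIntegrable, ← e2]
    refine integral_mul_fderiv_eq_neg_fderiv_mul_of_integrable ?_
      (LocallyIntegrableOn.integrable_mul_of_tsupport_subset hlocΦ hdψ (hψc.fderiv_apply (𝕜 := ℝ) e) hdψO)
      (LocallyIntegrableOn.integrable_mul_of_tsupport_subset hlocΦ hψ.continuous hψc hψO)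
      (fun z hz => ?_) fun z _ => hψ.differentiable (by simp) z
    · have : Integrable (fun z => ∑ i, fderiv ℝ (Φ k) (T z) (b i) *
          (ℓ i (fderiv ℝ T z e) * ψ z)) μ :=
        integrable_finsetSum _ fun i _ =>
          LocallyIntegrableOn.integrable_mul_of_tsupport_subset
            (h.locallyIntegrableOn_comp (hdk i).locallyIntegrable) (hci i) (hcc i) (hcO i)
      refine this.congr (.of_forall fun z => ?_)
      by_cases hz : z ∈ O
      · simp only [hchain z hz, Finset.sum_mul, hℓb]
        exact Finset.sum_congr rfl fun i _ => by ring
      · simp [hψ0 z hz]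
    · exact (((hΦ k).differentiable (by simp)) (T z)).comp z
        (h.hasFDerivAt (hψO hz)).differentiableAt
  have hlim : Tendsto (fun k => - ∑ i, ∫ z, fderiv ℝ (Φ k) z (b i) * a' i z ∂μ) l
      (𝓝 (- ∑ i, ∫ z, W i z * a' i z ∂μ)) :=
    (tendsto_finsetSum _ fun i _ => hvW i _ (ha' i)).neg
  rw [hae, hsum _ fun i => (hW i).locallyIntegrable (by norm_num)]
  refine tendsto_nhds_unique (hv a ha) ?_
  simpa only [hcl] using hlim

end IsDiffeoOn

end Pullback

/-! ### Charts, metric and volume of `M × ℝⁿ` -/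

section Transition

variable {E : Type*} [NormedAddCommGroup E] [NormedSpace ℝ E] {H : Type*} [TopologicalSpace H]
  {I : ModelWithCorners ℝ E H} [I.Boundaryless] {N : Type*} [TopologicalSpace N] [ChartedSpace H N]
  [IsManifold I ∞ N]

/-- The transition maps of the manifold are diffeomorphisms of the overlaps. -/
theorem isDiffeoOn_transition (p q : N) :
    IsDiffeoOn (overlap I p q) (overlap I q p) (transition I p q) (transition I q p) :=
  ⟨isOpen_overlap p q, isOpen_overlap q p, contDiffOn_transition p q, contDiffOn_transition q p,
    fun _ => transition_mem_overlap, fun _ => transition_mem_overlap,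
    fun _ => transition_transition, fun _ => transition_transition⟩

end Transition

section Product

variable {m n : ℕ} {M : Type*} [TopologicalSpace M] [ChartedSpace (EuclideanSpace ℝ (Fin m)) M]

theorem extChartAt_prod_source (p : M × EuclideanSpace ℝ (Fin n)) :
    (extChartAt ((𝓡 m).prod (𝓡 n)) p).source = (extChartAt (𝓡 m) p.1).source ×ˢ Set.univ := by
  rw [extChartAt_prod, extChartAt_model_space_eq_id]
  rfl

theorem extChartAt_prod_target (p : M × EuclideanSpace ℝ (Fin n)) :
    (extChartAt ((𝓡 m).prod (𝓡 n)) p).target = (extChartAt (𝓡 m) p.1).target ×ˢ Set.univ := by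
  rw [extChartAt_prod, extChartAt_model_space_eq_id]
  rfl

theorem extChartAt_prod_apply (p q : M × EuclideanSpace ℝ (Fin n)) :
    extChartAt ((𝓡 m).prod (𝓡 n)) p q = (extChartAt (𝓡 m) p.1 q.1, q.2) := by
  rw [extChartAt_prod, extChartAt_model_space_eq_id]
  rfl

theorem extChartAt_prod_symm_apply (p : M × EuclideanSpace ℝ (Fin n))
    (z : EuclideanSpace ℝ (Fin m) × EuclideanSpace ℝ (Fin n)) :
    (extChartAt ((𝓡 m).prod (𝓡 n)) p).symm z = ((extChartAt (𝓡 m) p.1).symm z.1, z.2) := by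
  rw [extChartAt_prod, extChartAt_model_space_eq_id]
  rfl

variable [IsManifold (𝓡 m) ∞ M]

/-- The charts of `M × ℝⁿ` are products of charts of `M` and the identity. -/
theorem chartD_prod (p : M × EuclideanSpace ℝ (Fin n))
    {z : EuclideanSpace ℝ (Fin m) × EuclideanSpace ℝ (Fin n)}
    (hz : z ∈ (extChartAt ((𝓡 m).prod (𝓡 n)) p).target)
    (v : EuclideanSpace ℝ (Fin m) × EuclideanSpace ℝ (Fin n)) :
    chartD ((𝓡 m).prod (𝓡 n)) p z v = (chartD (𝓡 m) p.1 z.1 v.1, v.2) := by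
  rw [extChartAt_prod_target] at hz
  have h1 := (mdifferentiableAt_extChartAt_symm (I := 𝓡 m) hz.1).hasMFDerivAt
  have h2 : HasMFDerivAt 𝓘(ℝ, EuclideanSpace ℝ (Fin n)) (𝓡 n)
      (id : EuclideanSpace ℝ (Fin n) → EuclideanSpace ℝ (Fin n)) z.2 (.id ℝ _) := hasMFDerivAt_id _
  have e : ⇑(extChartAt ((𝓡 m).prod (𝓡 n)) p).symm =
      Prod.map (extChartAt (𝓡 m) p.1).symm (id : EuclideanSpace ℝ (Fin n) → _) := by
    funext w
    rw [extChartAt_prod_symm_apply]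
    rfl
  have h3 : HasMFDerivAt 𝓘(ℝ, EuclideanSpace ℝ (Fin m) × EuclideanSpace ℝ (Fin n))
      ((𝓡 m).prod (𝓡 n)) (Prod.map (extChartAt (𝓡 m) p.1).symm id) z
      ((chartD (𝓡 m) p.1 z.1).prodMap (.id ℝ (EuclideanSpace ℝ (Fin n)))) := by
    have h5 := h1.prodMap h2
    rw [h2.mfderiv] at h5
    rw [modelWithCornersSelf_prod, ← chartedSpaceSelf_prod]
    exact h5
  have h4 : chartD ((𝓡 m).prod (𝓡 n)) p z = (chartD (𝓡 m) p.1 z.1).prodMap (.id ℝ _) := by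
    rw [← h3.mfderiv, ← e]
    rfl
  rw [h4]
  rfl

variable (gM : ContMDiffRiemannianMetric (𝓡 m) ∞ (EuclideanSpace ℝ (Fin m))
      (fun x : M => TangentSpace (𝓡 m) x))

/-- The product metric as a bilinear form on the model space. -/
noncomputable def prodBilin (n : ℕ) (x : M) :
    (EuclideanSpace ℝ (Fin m) × EuclideanSpace ℝ (Fin n)) →ₗ[ℝ]
      (EuclideanSpace ℝ (Fin m) × EuclideanSpace ℝ (Fin n)) →ₗ[ℝ] ℝ :=
  LinearMap.mk₂ ℝ (fun v w => metricBilin gM x v.1 w.1 + inner ℝ v.2 w.2)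
    (fun v v' w => by simp [inner_add_left]; ring) (fun c v w => by simp [inner_smul_left]; ring)
    (fun v w w' => by simp [inner_add_right]; ring) (fun c v w => by simp [inner_smul_right]; ring)

theorem prodBilin_apply (x : M) (v w : EuclideanSpace ℝ (Fin m) × EuclideanSpace ℝ (Fin n)) :
    prodBilin gM n x v w = metricBilin gM x v.1 w.1 + inner ℝ v.2 w.2 := rfl

theorem prodBilin_symm (x : M) (v w : EuclideanSpace ℝ (Fin m) × EuclideanSpace ℝ (Fin n)) :
    prodBilin gM n x v w = prodBilin gM n x w v := by
  rw [prodBilin_apply, prodBilin_apply, metricBilin_symm, real_inner_comm]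

theorem prodBilin_self_nonneg (x : M) (v : EuclideanSpace ℝ (Fin m) × EuclideanSpace ℝ (Fin n)) :
    0 ≤ prodBilin gM n x v v :=
  add_nonneg (metricBilin_self_nonneg gM x v.1) real_inner_self_nonneg

theorem stdBasis_inl (i : Fin m) : stdBasis m n (Sum.inl i) =
    (EuclideanSpace.basisFun (Fin m) ℝ i, 0) := by
  simp [stdBasis]

theorem stdBasis_inr (j : Fin n) : stdBasis m n (Sum.inr j) =
    (0, EuclideanSpace.basisFun (Fin n) ℝ j) := by
  simp [stdBasis]

theorem stdBasis_eq_frameVec : ⇑(stdBasis m n) =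
    frameVec fun i => EuclideanSpace.basisFun (Fin m) ℝ i := by
  funext i
  rcases i with i | i
  · exact stdBasis_inl i
  · exact stdBasis_inr i

theorem addHaar_stdBasis : (stdBasis m n).addHaar = volume := by
  rw [stdBasis, Module.Basis.prod_addHaar, OrthonormalBasis.addHaar_eq_volume,
    OrthonormalBasis.addHaar_eq_volume]
  rfl

/-- The matrix of the product metric is block diagonal, with the identity as second block. -/
theorem gramMatrix_prod (p : M × EuclideanSpace ℝ (Fin n))
    {z : EuclideanSpace ℝ (Fin m) × EuclideanSpace ℝ (Fin n)}
    (hz : z ∈ (extChartAt ((𝓡 m).prod (𝓡 n)) p).target) :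
    gramMatrix (productMetric (metricField gM)) (stdBasis m n) p z =
      splitMatrix n (gramMatrix (metricField gM) (EuclideanSpace.basisFun (Fin m) ℝ).toBasis
        p.1 z.1) 1 := by
  have hcoord : ∀ i, coordVec ((𝓡 m).prod (𝓡 n)) (stdBasis m n) p z i =
      chartD ((𝓡 m).prod (𝓡 n)) p z (stdBasis m n i) := fun i => rfl
  have hfst : ((extChartAt ((𝓡 m).prod (𝓡 n)) p).symm z).1 = (extChartAt (𝓡 m) p.1).symm z.1 := by
    rw [extChartAt_prod_symm_apply]
  have key : ∀ i j, gramMatrix (productMetric (metricField gM)) (stdBasis m n) p z i j =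
      prodBilin gM n ((extChartAt (𝓡 m) p.1).symm z.1)
        (chartD ((𝓡 m).prod (𝓡 n)) p z (stdBasis m n i))
        (chartD ((𝓡 m).prod (𝓡 n)) p z (stdBasis m n j)) := by
    intro i j
    rw [← hfst]
    rfl
  ext i j
  rw [key, chartD_prod p hz, chartD_prod p hz, prodBilin_apply]
  rcases i with i | i <;> rcases j with j | j
  · simp only [stdBasis_inl, splitMatrix, Matrix.fromBlocks_apply₁₁, inner_zero_left, add_zero,
      gramMatrix_apply]
    simp
  · simp [stdBasis_inl, stdBasis_inr, splitMatrix]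
  · simp [stdBasis_inl, stdBasis_inr, splitMatrix]
  · simp only [stdBasis_inr, splitMatrix, Matrix.fromBlocks_apply₂₂, map_zero, zero_add, one_smul]
    rw [OrthonormalBasis.inner_eq_ite, Matrix.one_apply]

theorem det_splitMatrix_one {ι : Type*} [Fintype ι] [DecidableEq ι] (A : Matrix ι ι ℝ) :
    (splitMatrix n A 1).det = A.det := by
  rw [splitMatrix, Matrix.det_fromBlocks_zero₂₁]
  simp

theorem inv_splitMatrix_one {ι : Type*} [Fintype ι] [DecidableEq ι] {A : Matrix ι ι ℝ}
    (hA : IsUnit A.det) :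
    (splitMatrix n A 1)⁻¹ = splitMatrix n A⁻¹ 1 := by
  refine Matrix.inv_eq_right_inv ?_
  rw [splitMatrix, splitMatrix, Matrix.fromBlocks_multiply]
  simp [Matrix.mul_nonsing_inv A hA]

end Product

section LinearAlgebra

variable {V : Type*} [AddCommGroup V] [Module ℝ V] {κ : Type*} [Fintype κ] [DecidableEq κ]
  (β : V →ₗ[ℝ] V →ₗ[ℝ] ℝ) (e : Module.Basis κ ℝ V)

/-- A bilinear form in terms of the products of its argument with a basis. -/
theorem bilin_self_eq_inv_gram (hβ : ∀ v w, β v w = β w v) {Γ : Matrix κ κ ℝ}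
    (hΓ : ∀ i j, Γ i j = β (e i) (e j)) (hdet : IsUnit Γ.det) (v : V) :
    β v v = ∑ i, β v (e i) * ∑ j, Γ⁻¹ i j * β v (e j) := by
  set c : κ → ℝ := fun i => β v (e i) with hc
  set a : κ → ℝ := fun i => e.repr v i with ha
  have h1 : Γ.mulVec a = c := by
    funext i
    simp only [hc, Matrix.mulVec, dotProduct, hΓ, ha]
    have h0 : β (e i) (∑ j, e.repr v j • e j) = ∑ j, β (e i) (e j) * e.repr v j := by
      rw [map_sum]
      simp only [map_smul, smul_eq_mul, mul_comm]
    rw [hβ v (e i), ← h0, e.sum_repr]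
  have h2 : Γ⁻¹.mulVec c = a := by
    rw [← h1, Matrix.mulVec_mulVec, Matrix.nonsing_inv_mul Γ hdet, Matrix.one_mulVec]
  have h3 : ∀ i, ∑ j, Γ⁻¹ i j * c j = a i := fun i => congrFun h2 i
  change β v v = ∑ i, c i * ∑ j, Γ⁻¹ i j * c j
  simp only [h3]
  have : β v (∑ i, a i • e i) = ∑ i, c i * a i := by
    simp [hc, mul_comm]
  rw [← this, e.sum_repr v]

/-- The vector with given products with the vectors of a basis. -/
theorem bilin_sum_inv_gram (hβ : ∀ v w, β v w = β w v) {Γ : Matrix κ κ ℝ}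
    (hΓ : ∀ i j, Γ i j = β (e i) (e j)) (hdet : IsUnit Γ.det) (c : κ → ℝ) (i : κ) :
    β (∑ j, (Γ⁻¹.mulVec c) j • e j) (e i) = c i := by
  have h2 : Γ.mulVec (Γ⁻¹.mulVec c) = c := by
    rw [Matrix.mulVec_mulVec, Matrix.mul_nonsing_inv Γ hdet, Matrix.one_mulVec]
  conv_rhs => rw [← h2]
  rw [map_sum, LinearMap.sum_apply]
  simp only [map_smul, LinearMap.smul_apply, smul_eq_mul]
  conv_rhs => rw [Matrix.mulVec, dotProduct]
  exact Finset.sum_congr rfl fun j _ => by rw [hΓ, hβ (e i), mul_comm]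

end LinearAlgebra

section Measurability

variable {E : Type*} [NormedAddCommGroup E] [NormedSpace ℝ E] {H : Type*} [TopologicalSpace H]
  {I : ModelWithCorners ℝ E H} [I.Boundaryless] {N : Type*} [TopologicalSpace N] [ChartedSpace H N]
  [IsManifold I ∞ N] [FiniteDimensional ℝ E] [MeasurableSpace E] [BorelSpace E]
  [MeasurableSpace N] [BorelSpace N]
  {ι : Type*} [Fintype ι] [DecidableEq ι] (b : Module.Basis ι ℝ E) (g : MetricField I N) (p : N)

theorem aemeasurable_extChartAt_chartVolume :
    AEMeasurable (extChartAt I p) (chartVolume g b p) := by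
  have h := (continuousOn_extChartAt (I := I) p).aemeasurable (μ := chartVolume g b p)
    (isOpen_extChartAt_source p).measurableSet
  have e : (chartVolume g b p).restrict (extChartAt I p).source = chartVolume g b p :=
    Measure.restrict_eq_self_of_ae_mem (mem_ae_iff.2 (chartVolume_compl_source b g p))
  rwa [e] at h

theorem aemeasurable_of_chart {k : E → ℝ} {h : N → ℝ}
    (hk : AEMeasurable k (b.addHaar.restrict (extChartAt I p).target))
    (hh : ∀ x ∈ (extChartAt I p).source, h x = k (extChartAt I p x)) :
    AEMeasurable h (chartVolume g b p) := by
  refine (hk.measurable_mk.comp_aemeasurable (aemeasurable_extChartAt_chartVolume b g p)).congr ?_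
  have h1 := (ae_restrict_iff' (isOpen_extChartAt_target (I := I) p).measurableSet).1 hk.ae_eq_mk
  filter_upwards [ae_chartVolume_of_ae b g p h1,
    mem_ae_iff.2 (chartVolume_compl_source b g p)] with x hx hxs
  rw [hh x hxs, hx]
  rfl

end Measurability

section Volume

variable {m n : ℕ} {M : Type*} [TopologicalSpace M] [ChartedSpace (EuclideanSpace ℝ (Fin m)) M]
  [IsManifold (𝓡 m) ∞ M] [MeasurableSpace M] [BorelSpace M] [SecondCountableTopology M]
  (gM : ContMDiffRiemannianMetric (𝓡 m) ∞ (EuclideanSpace ℝ (Fin m))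
      (fun x : M => TangentSpace (𝓡 m) x))

theorem sqrt_det_gramMatrix_prod (p : M × EuclideanSpace ℝ (Fin n))
    {z : EuclideanSpace ℝ (Fin m) × EuclideanSpace ℝ (Fin n)}
    (hz : z ∈ (extChartAt ((𝓡 m).prod (𝓡 n)) p).target) :
    Real.sqrt (gramMatrix (productMetric (metricField gM)) (stdBasis m n) p z).det =
      Real.sqrt (gramMatrix (metricField gM) (EuclideanSpace.basisFun (Fin m) ℝ).toBasis
        p.1 z.1).det := by
  rw [gramMatrix_prod gM p hz, det_splitMatrix_one]

/-- In each chart, the volume of `M × ℝⁿ` is the product of the volume of `M` and Lebesgue measure.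
-/
theorem chartVolume_prod (p : M × EuclideanSpace ℝ (Fin n)) :
    chartVolume (productMetric (metricField gM)) (stdBasis m n) p =
      (chartVolume (metricField gM) (EuclideanSpace.basisFun (Fin m) ℝ).toBasis p.1).prod
        volume := by
  set b := (EuclideanSpace.basisFun (Fin m) ℝ).toBasis with hb
  set Ω := (extChartAt (𝓡 m) p.1).target with hΩ
  have hΩm : MeasurableSet Ω := (isOpen_extChartAt_target p.1).measurableSet
  set ρ : EuclideanSpace ℝ (Fin m) → ℝ≥0∞ := fun z =>
    ENNReal.ofReal (Real.sqrt (gramMatrix (metricField gM) b p.1 z).det) with hρ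
  have hcont := continuousOn_sqrt_det_gramMatrix gM b p.1
  classical
  set ρ' : EuclideanSpace ℝ (Fin m) → ℝ≥0∞ := Ω.piecewise ρ 0 with hρ'
  have hρ'm : Measurable ρ' := by
    refine ContinuousOn.measurable_piecewise ?_ continuousOn_const hΩm
    exact ENNReal.continuous_ofReal.comp_continuousOn hcont
  have hvol : b.addHaar = volume := OrthonormalBasis.addHaar_eq_volume _
  have : SFinite (chartVolume (metricField gM) b p.1) := sFinite_chartVolume b _ _
  ext S hS
  rw [chartVolume_apply _ _ _ hS, Measure.prod_apply hS, addHaar_stdBasis,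
    lintegral_chartVolume b _ p.1 hcont (measurable_measure_prodMk_left hS).aemeasurable, hvol]
  have hA := measurableSet_inter_preimage_symm (I := (𝓡 m).prod (𝓡 n)) p hS
  have e1 : ∫⁻ z in (extChartAt ((𝓡 m).prod (𝓡 n)) p).target ∩
      (extChartAt ((𝓡 m).prod (𝓡 n)) p).symm ⁻¹' S,
        ENNReal.ofReal (Real.sqrt (gramMatrix (productMetric (metricField gM)) (stdBasis m n)
          p z).det) = ∫⁻ z, ((extChartAt ((𝓡 m).prod (𝓡 n)) p).target ∩
      (extChartAt ((𝓡 m).prod (𝓡 n)) p).symm ⁻¹' S).indicator (fun z => ρ' z.1) z := by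
    rw [lintegral_indicator hA]
    refine setLIntegral_congr_fun hA fun z hz => ?_
    have hz1 : z.1 ∈ Ω := by
      have := hz.1
      rw [extChartAt_prod_target] at this
      exact this.1
    simp only [hρ', Set.piecewise_eq_of_mem _ _ _ hz1, hρ]
    rw [sqrt_det_gramMatrix_prod gM p hz.1]
  have hme : Measurable (((extChartAt ((𝓡 m).prod (𝓡 n)) p).target ∩
      (extChartAt ((𝓡 m).prod (𝓡 n)) p).symm ⁻¹' S).indicator fun z => ρ' z.1) :=
    (hρ'm.comp measurable_fst).indicator hA
  rw [e1, Measure.volume_eq_prod, lintegral_prod _ hme.aemeasurable, ← lintegral_indicator hΩm]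
  refine lintegral_congr fun z => ?_
  by_cases hz : z ∈ Ω
  · rw [Set.indicator_of_mem hz]
    have e2 : ∀ y : EuclideanSpace ℝ (Fin n), ((extChartAt ((𝓡 m).prod (𝓡 n)) p).target ∩
      (extChartAt ((𝓡 m).prod (𝓡 n)) p).symm ⁻¹' S).indicator (fun z => ρ' z.1) (z, y) =
        (Prod.mk ((extChartAt (𝓡 m) p.1).symm z) ⁻¹' S).indicator (fun _ => ρ z) y := by
      intro y
      rw [extChartAt_prod_target]
      by_cases hy : ((extChartAt (𝓡 m) p.1).symm z, y) ∈ S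
      · rw [Set.indicator_of_mem, Set.indicator_of_mem (by exact hy), hρ',
          Set.piecewise_eq_of_mem _ _ _ hz]
        exact ⟨⟨hz, Set.mem_univ _⟩, by rwa [Set.mem_preimage, extChartAt_prod_symm_apply]⟩
      · rw [Set.indicator_of_notMem, Set.indicator_of_notMem (by exact hy)]
        rintro ⟨-, h⟩
        rw [Set.mem_preimage, extChartAt_prod_symm_apply] at h
        exact hy h
    simp only [e2]
    rw [lintegral_indicator_const (measurable_prodMk_left hS)]
  · rw [Set.indicator_of_notMem hz]
    refine (lintegral_congr fun y => ?_).trans lintegral_zero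
    rw [Set.indicator_of_notMem]
    rw [extChartAt_prod_target]
    exact fun h => hz h.1.1

/-- Fubini's theorem applies to `M × ℝⁿ`: its Riemannian volume is a product measure. -/
theorem riemannianVolume_prod :
    riemannianVolume (productMetric (metricField gM)) (stdBasis m n) =
      (riemannianVolume (metricField gM) (EuclideanSpace.basisFun (Fin m) ℝ).toBasis).prod
        (volume : Measure (EuclideanSpace ℝ (Fin n))) := by
  set b := (EuclideanSpace.basisFun (Fin m) ℝ).toBasis with hb
  have : SFinite (riemannianVolume (metricField gM) b) := sFinite_riemannianVolume gM b
  obtain ⟨s, hs, hcov⟩ := exists_countable_cover_source (I := 𝓡 m) (N := M)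
  have h := iSup_restrict_eq ((riemannianVolume (metricField gM) b).prod
    (volume : Measure (EuclideanSpace ℝ (Fin n))))
    (U := fun p : M × EuclideanSpace ℝ (Fin n) => (extChartAt (𝓡 m) p.1).source ×ˢ Set.univ)
    (s := s ×ˢ {0}) (hs.prod (Set.countable_singleton 0)) (by
      ext ⟨x, y⟩
      simp only [Set.mem_iUnion, Set.mem_univ, iff_true]
      have hx : x ∈ ⋃ p ∈ s, (extChartAt (𝓡 m) p).source := hcov ▸ Set.mem_univ x
      simp only [Set.mem_iUnion] at hx
      obtain ⟨p, hp, hx⟩ := hx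
      exact ⟨(p, 0), ⟨hp, rfl⟩, hx, Set.mem_univ _⟩)
  rw [← h, riemannianVolume]
  congr 1
  funext p
  rw [← Measure.prod_restrict, riemannianVolume_restrict, Measure.restrict_univ, chartVolume_prod]

end Volume

/-! ### Locality of weak derivatives -/

section WeakDerivLocal

variable {Z : Type*} [NormedAddCommGroup Z] [NormedSpace ℝ Z] [FiniteDimensional ℝ Z]
  [MeasurableSpace Z] [BorelSpace Z] {μ : Measure Z} [μ.IsAddHaarMeasure]

theorem WeakDeriv.mono {O O' : Set Z} {v : Z} {u w : Z → ℝ} (h : WeakDeriv μ O v u w)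
    (hO : O' ⊆ O) : WeakDeriv μ O' v u w := fun ψ hψ hψc hψO => h ψ hψ hψc (hψO.trans hO)

theorem WeakDeriv.congr_ae {O : Set Z} {v : Z} {u u' w w' : Z → ℝ} (h : WeakDeriv μ O v u w)
    (hu : ∀ᵐ z ∂μ, z ∈ O → u z = u' z) (hw : ∀ᵐ z ∂μ, z ∈ O → w z = w' z) :
    WeakDeriv μ O v u' w' := by
  intro ψ hψ hψc hψO
  have h0 : ∀ (f : Z → ℝ), tsupport f ⊆ O → ∀ z, z ∉ O → f z = 0 := fun f hf z hz => by
    by_contra h0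
    exact hz (hf (subset_tsupport f h0))
  have e1 : ∫ z, u' z * fderiv ℝ ψ z v ∂μ = ∫ z, u z * fderiv ℝ ψ z v ∂μ := by
    refine integral_congr_ae ?_
    filter_upwards [hu] with z hz
    by_cases hzO : z ∈ O
    · rw [hz hzO]
    · rw [h0 (fun z => fderiv ℝ ψ z v) ((tsupport_fderiv_apply_subset ℝ v).trans hψO) z hzO]
      simp
  have e2 : ∫ z, w' z * ψ z ∂μ = ∫ z, w z * ψ z ∂μ := by
    refine integral_congr_ae ?_
    filter_upwards [hw] with z hz
    by_cases hzO : z ∈ O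
    · rw [hz hzO]
    · rw [h0 ψ hψO z hzO]
      simp
  rw [e1, e2, h ψ hψ hψc hψO]

theorem LocallyIntegrableOn.congr_ae {O : Set Z} (hO : IsOpen O) {u u' : Z → ℝ}
    (h : LocallyIntegrableOn u O μ) (hu : ∀ᵐ z ∂μ, z ∈ O → u z = u' z) :
    LocallyIntegrableOn u' O μ := by
  rw [locallyIntegrableOn_iff hO.isLocallyClosed] at h ⊢
  refine fun K hKO hK => (h K hKO hK).congr ?_
  exact (ae_restrict_iff' hK.measurableSet).2 (hu.mono fun z hz hzK => hz (hKO hzK))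

/-- Weak derivatives are unique almost everywhere. -/
theorem WeakDeriv.ae_eq {O : Set Z} (hO : IsOpen O) {v : Z} {u w w' : Z → ℝ}
    (h : WeakDeriv μ O v u w) (h' : WeakDeriv μ O v u w') (hw : LocallyIntegrableOn w O μ)
    (hw' : LocallyIntegrableOn w' O μ) : ∀ᵐ z ∂μ, z ∈ O → w z = w' z := by
  have := hO.ae_eq_zero_of_integral_contDiff_smul_eq_zero (hw.sub hw') fun ψ hψ hψc hψO => ?_
  · exact this.mono fun z hz hzO => sub_eq_zero.1 (hz hzO)
  · have i1 := LocallyIntegrableOn.integrable_mul_of_tsupport_subset hw hψ.continuous hψc hψO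
    have i2 := LocallyIntegrableOn.integrable_mul_of_tsupport_subset hw' hψ.continuous hψc hψO
    have e : ∀ z, ψ z • (w - w') z = w z * ψ z - w' z * ψ z := fun z => by
      simp only [smul_eq_mul, Pi.sub_apply]; ring
    simp only [e]
    rw [integral_sub i1 i2]
    have h1 := h ψ hψ hψc hψO
    have h2 := h' ψ hψ hψc hψO
    linarith

theorem LocallyIntegrableOn.iUnion_of_isOpen {β : Type*} {O : β → Set Z} (hO : ∀ k, IsOpen (O k))
    {u : Z → ℝ} (h : ∀ k, LocallyIntegrableOn u (O k) μ) : LocallyIntegrableOn u (⋃ k, O k) μ := by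
  intro z hz
  obtain ⟨k, hk⟩ := Set.mem_iUnion.1 hz
  have h1 := h k z hk
  rw [(hO k).nhdsWithin_eq hk] at h1
  rwa [(isOpen_iUnion hO).nhdsWithin_eq hz]

/-- Weak derivatives are local. -/
theorem WeakDeriv.iUnion {β : Type*} {O : β → Set Z} (hO : ∀ k, IsOpen (O k)) {v : Z}
    {u w : Z → ℝ} (h : ∀ k, WeakDeriv μ (O k) v u w) (hu : ∀ k, LocallyIntegrableOn u (O k) μ)
    (hw : ∀ k, LocallyIntegrableOn w (O k) μ) : WeakDeriv μ (⋃ k, O k) v u w := by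
  intro ψ hψ hψc hψO
  obtain ⟨t, ht⟩ := hψc.isCompact.elim_finite_subcover O hO hψO
  -- Split the test function with a partition of unity.
  obtain ⟨f, hf⟩ := SmoothPartitionOfUnity.exists_isSubordinate 𝓘(ℝ, Z)
    (isClosed_tsupport ψ) (fun k : t => O k) (fun k => hO k) (by
      rwa [Set.iUnion_subtype])
  have hfs : ∀ k : t, ContDiff ℝ ∞ (f k) := fun k => (f k).contMDiff.contDiff
  set φ : t → Z → ℝ := fun k z => f k z * ψ z with hφ
  have hφs : ∀ k, ContDiff ℝ ∞ (φ k) := fun k => (hfs k).mul hψ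
  have hφc : ∀ k, HasCompactSupport (φ k) := fun k => hψc.mul_left
  have hφO : ∀ k, tsupport (φ k) ⊆ O k := fun k =>
    (closure_mono (Function.support_mul_subset_left _ _)).trans (hf k)
  have hsum : ψ = fun z => ∑ k, φ k z := by
    funext z
    by_cases hz : z ∈ tsupport ψ
    · have h1 := f.sum_eq_one hz
      rw [finsum_eq_sum_of_fintype] at h1
      simp only [hφ]
      rw [← Finset.sum_mul, h1, one_mul]
    · have : ψ z = 0 := image_eq_zero_of_notMem_tsupport hz
      simp [hφ, this]
  have hd : ∀ z, fderiv ℝ ψ z v = ∑ k, fderiv ℝ (φ k) z v := by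
    intro z
    rw [hsum, fderiv_fun_sum fun k _ => (hφs k).differentiable (by simp) z]
    simp
  have hc : ∀ k, Continuous fun z => fderiv ℝ (φ k) z v := fun k =>
    ((hφs k).continuous_fderiv (by simp)).clm_apply continuous_const
  calc ∫ z, u z * fderiv ℝ ψ z v ∂μ = ∫ z, ∑ k, u z * fderiv ℝ (φ k) z v ∂μ := by
        simp only [hd, Finset.mul_sum]
    _ = ∑ k, ∫ z, u z * fderiv ℝ (φ k) z v ∂μ := integral_finsetSum _ fun k _ =>
        LocallyIntegrableOn.integrable_mul_of_tsupport_subset (hu k) (hc k)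
          ((hφc k).fderiv_apply (𝕜 := ℝ) v) ((tsupport_fderiv_apply_subset ℝ v).trans (hφO k))
    _ = ∑ k, - ∫ z, w z * φ k z ∂μ :=
        Finset.sum_congr rfl fun k _ => h k (φ k) (hφs k) (hφc k) (hφO k)
    _ = - ∫ z, ∑ k, w z * φ k z ∂μ := by
        rw [Finset.sum_neg_distrib, integral_finsetSum _ fun (k : t) _ =>
          LocallyIntegrableOn.integrable_mul_of_tsupport_subset (hw k) (hφs k).continuous (hφc k)
            (hφO k)]
    _ = _ := by
        congr 1
        refine integral_congr_ae (.of_forall fun z => ?_)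
        simp only
        rw [hsum, Finset.mul_sum]

end WeakDerivLocal

section Diffeo

variable {Z : Type*} [NormedAddCommGroup Z] [NormedSpace ℝ Z]

/-- A diffeomorphism restricts to the preimage of an open set. -/
theorem IsDiffeoOn.restrict {O O' : Set Z} {T S : Z → Z} (h : IsDiffeoOn O O' T S) {V : Set Z}
    (hV : IsOpen V) : IsDiffeoOn (O ∩ T ⁻¹' V) (O' ∩ V) T S where
  isOpen := h.contDiffOn.continuousOn.isOpen_inter_preimage h.isOpen hV
  isOpen' := h.isOpen'.inter hV
  contDiffOn := h.contDiffOn.mono Set.inter_subset_left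
  contDiffOn_symm := h.contDiffOn_symm.mono Set.inter_subset_left
  mapsTo z hz := ⟨h.mapsTo z hz.1, hz.2⟩
  mapsTo_symm w hw := ⟨h.mapsTo_symm w hw.1, by
    rw [Set.mem_preimage, h.right_inv w hw.1]; exact hw.2⟩
  left_inv z hz := h.left_inv z hz.1
  right_inv w hw := h.right_inv w hw.1

end Diffeo

/-! ### Weak gradients on `M × ℝⁿ` -/

instance isAddHaarMeasure_volume_euclidean_prod (m n : ℕ) :
    (volume : Measure (EuclideanSpace ℝ (Fin m) × EuclideanSpace ℝ (Fin n))).IsAddHaarMeasure :=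
  inferInstanceAs ((volume : Measure (EuclideanSpace ℝ (Fin m))).prod
    (volume : Measure (EuclideanSpace ℝ (Fin n)))).IsAddHaarMeasure

section ProductGradient

variable {m n : ℕ} {M : Type*} [TopologicalSpace M] [ChartedSpace (EuclideanSpace ℝ (Fin m)) M]
  [IsManifold (𝓡 m) ∞ M] [MeasurableSpace M] [BorelSpace M] [SecondCountableTopology M]
  (gM : ContMDiffRiemannianMetric (𝓡 m) ∞ (EuclideanSpace ℝ (Fin m))
      (fun x : M => TangentSpace (𝓡 m) x))

/-- The matrix `g_ij` of the metric of `M` in the chart at `p`, for the standard coordinates. -/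
noncomputable def stdGram (p : M) (z : EuclideanSpace ℝ (Fin m)) : Matrix (Fin m) (Fin m) ℝ :=
  gramMatrix (metricField gM) (EuclideanSpace.basisFun (Fin m) ℝ).toBasis p z

/-- The components `g(X, ∂_i)` of a vector field on `M × ℝⁿ` in the chart at `p`. -/
noncomputable def chartComp
    (X : ∀ q : M × EuclideanSpace ℝ (Fin n), TangentSpace ((𝓡 m).prod (𝓡 n)) q)
    (p : M × EuclideanSpace ℝ (Fin n)) (i : Fin m ⊕ Fin n)
    (z : EuclideanSpace ℝ (Fin m) × EuclideanSpace ℝ (Fin n)) : ℝ :=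
  prodBilin gM n ((extChartAt ((𝓡 m).prod (𝓡 n)) p).symm z).1
    (X ((extChartAt ((𝓡 m).prod (𝓡 n)) p).symm z))
    (chartD ((𝓡 m).prod (𝓡 n)) p z (stdBasis m n i))

/-- The square `g(X, X)` of the length of a vector field on `M × ℝⁿ`. -/
noncomputable def normSq
    (X : ∀ q : M × EuclideanSpace ℝ (Fin n), TangentSpace ((𝓡 m).prod (𝓡 n)) q)
    (q : M × EuclideanSpace ℝ (Fin n)) : ℝ :=
  productMetric (metricField gM) q (X q) (X q)

theorem normSq_nonneg
    (X : ∀ q : M × EuclideanSpace ℝ (Fin n), TangentSpace ((𝓡 m).prod (𝓡 n)) q)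
    (q : M × EuclideanSpace ℝ (Fin n)) : 0 ≤ normSq gM X q :=
  prodBilin_self_nonneg gM q.1 (X q)

/-- Weak gradients in terms of the weak derivatives in the charts. -/
theorem hasWeakGradient_iff {u : M × EuclideanSpace ℝ (Fin n) → ℝ}
    {X : ∀ q : M × EuclideanSpace ℝ (Fin n), TangentSpace ((𝓡 m).prod (𝓡 n)) q} :
    HasWeakGradient (productMetric (metricField gM)) (stdBasis m n) u X ↔
      ∀ p : M × EuclideanSpace ℝ (Fin n),
        LocallyIntegrableOn (fun z => u ((extChartAt ((𝓡 m).prod (𝓡 n)) p).symm z))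
          (extChartAt ((𝓡 m).prod (𝓡 n)) p).target volume ∧
        ∀ i, LocallyIntegrableOn (chartComp gM X p i)
          (extChartAt ((𝓡 m).prod (𝓡 n)) p).target volume ∧
          WeakDeriv volume (extChartAt ((𝓡 m).prod (𝓡 n)) p).target (stdBasis m n i)
            (fun z => u ((extChartAt ((𝓡 m).prod (𝓡 n)) p).symm z)) (chartComp gM X p i) := by
  unfold HasWeakGradient
  rw [addHaar_stdBasis]
  rfl

/-- The coordinate vectors of the chart at `p`, as a basis of the model space. -/
noncomputable def coordBasis (p : M × EuclideanSpace ℝ (Fin n))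
    {z : EuclideanSpace ℝ (Fin m) × EuclideanSpace ℝ (Fin n)}
    (hz : z ∈ (extChartAt ((𝓡 m).prod (𝓡 n)) p).target) :
    Module.Basis (Fin m ⊕ Fin n) ℝ (EuclideanSpace ℝ (Fin m) × EuclideanSpace ℝ (Fin n)) :=
  (stdBasis m n).map (chartD_isInvertible hz).choose.toLinearEquiv

theorem coordBasis_apply (p : M × EuclideanSpace ℝ (Fin n))
    {z : EuclideanSpace ℝ (Fin m) × EuclideanSpace ℝ (Fin n)}
    (hz : z ∈ (extChartAt ((𝓡 m).prod (𝓡 n)) p).target) (i : Fin m ⊕ Fin n) :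
    coordBasis p hz i = chartD ((𝓡 m).prod (𝓡 n)) p z (stdBasis m n i) := by
  have h := (chartD_isInvertible hz).choose_spec
  rw [coordBasis, Module.Basis.map_apply]
  exact congrArg (fun L : _ →L[ℝ] _ => L (stdBasis m n i)) h

/-- The matrix of the product metric with respect to the coordinate vectors. -/
theorem splitMatrix_eq_prodBilin (p : M × EuclideanSpace ℝ (Fin n))
    {z : EuclideanSpace ℝ (Fin m) × EuclideanSpace ℝ (Fin n)}
    (hz : z ∈ (extChartAt ((𝓡 m).prod (𝓡 n)) p).target) (i j : Fin m ⊕ Fin n) :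
    splitMatrix n (stdGram gM p.1 z.1) 1 i j =
      prodBilin gM n ((extChartAt ((𝓡 m).prod (𝓡 n)) p).symm z).1 (coordBasis p hz i)
        (coordBasis p hz j) := by
  rw [stdGram, ← gramMatrix_prod gM p hz, coordBasis_apply, coordBasis_apply]
  rfl

theorem mem_target_fst {p : M × EuclideanSpace ℝ (Fin n)}
    {z : EuclideanSpace ℝ (Fin m) × EuclideanSpace ℝ (Fin n)}
    (hz : z ∈ (extChartAt ((𝓡 m).prod (𝓡 n)) p).target) :
    z.1 ∈ (extChartAt (𝓡 m) p.1).target := by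
  rw [extChartAt_prod_target] at hz
  exact hz.1

theorem isUnit_det_stdGram {p : M} {z : EuclideanSpace ℝ (Fin m)}
    (hz : z ∈ (extChartAt (𝓡 m) p).target) : IsUnit (stdGram gM p z).det :=
  (gramMatrix_posDef gM _ hz).det_pos.ne'.isUnit

theorem isUnit_det_splitMatrix {p : M × EuclideanSpace ℝ (Fin n)}
    {z : EuclideanSpace ℝ (Fin m) × EuclideanSpace ℝ (Fin n)}
    (hz : z ∈ (extChartAt ((𝓡 m).prod (𝓡 n)) p).target) :
    IsUnit (splitMatrix n (stdGram gM p.1 z.1) 1).det := by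
  rw [det_splitMatrix_one]
  exact isUnit_det_stdGram gM (mem_target_fst hz)

/-- The length of a vector in terms of its components `g(X, ∂_i)`. -/
theorem normSq_symm (X : ∀ q : M × EuclideanSpace ℝ (Fin n), TangentSpace ((𝓡 m).prod (𝓡 n)) q)
    (p : M × EuclideanSpace ℝ (Fin n))
    {z : EuclideanSpace ℝ (Fin m) × EuclideanSpace ℝ (Fin n)}
    (hz : z ∈ (extChartAt ((𝓡 m).prod (𝓡 n)) p).target) :
    normSq gM X ((extChartAt ((𝓡 m).prod (𝓡 n)) p).symm z) =
      bilinField (fun z => splitMatrix n (stdGram gM p.1 z.1)⁻¹ 1)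
        (chartComp gM X p) (chartComp gM X p) z := by
  have h := bilin_self_eq_inv_gram (prodBilin gM n ((extChartAt ((𝓡 m).prod (𝓡 n)) p).symm z).1)
    (coordBasis p hz) (prodBilin_symm gM _) (splitMatrix_eq_prodBilin gM p hz)
    (isUnit_det_splitMatrix gM hz) (X ((extChartAt ((𝓡 m).prod (𝓡 n)) p).symm z))
  rw [inv_splitMatrix_one (isUnit_det_stdGram gM (mem_target_fst hz))] at h
  simp only [coordBasis_apply] at h
  exact h

/-- A vector with prescribed products with the coordinate vectors of the chart at `p`. -/
noncomputable def raiseVec (p : M × EuclideanSpace ℝ (Fin n))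
    (z : EuclideanSpace ℝ (Fin m) × EuclideanSpace ℝ (Fin n)) (c : Fin m ⊕ Fin n → ℝ) :
    EuclideanSpace ℝ (Fin m) × EuclideanSpace ℝ (Fin n) :=
  ∑ j, ((splitMatrix n (stdGram gM p.1 z.1) 1)⁻¹.mulVec c) j •
    chartD ((𝓡 m).prod (𝓡 n)) p z (stdBasis m n j)

theorem prodBilin_raiseVec {p : M × EuclideanSpace ℝ (Fin n)}
    {z : EuclideanSpace ℝ (Fin m) × EuclideanSpace ℝ (Fin n)}
    (hz : z ∈ (extChartAt ((𝓡 m).prod (𝓡 n)) p).target) (c : Fin m ⊕ Fin n → ℝ)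
    (i : Fin m ⊕ Fin n) :
    prodBilin gM n ((extChartAt ((𝓡 m).prod (𝓡 n)) p).symm z).1 (raiseVec gM p z c)
      (chartD ((𝓡 m).prod (𝓡 n)) p z (stdBasis m n i)) = c i := by
  have h := bilin_sum_inv_gram (prodBilin gM n ((extChartAt ((𝓡 m).prod (𝓡 n)) p).symm z).1)
    (coordBasis p hz) (prodBilin_symm gM _) (splitMatrix_eq_prodBilin gM p hz)
    (isUnit_det_splitMatrix gM hz) c i
  simp only [coordBasis_apply] at h
  exact h

theorem riemannianVolume_prod_restrict (p : M × EuclideanSpace ℝ (Fin n)) :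
    (riemannianVolume (productMetric (metricField gM)) (stdBasis m n)).restrict
      (extChartAt ((𝓡 m).prod (𝓡 n)) p).source =
      chartVolume (productMetric (metricField gM)) (stdBasis m n) p := by
  have := sFinite_riemannianVolume gM (EuclideanSpace.basisFun (Fin m) ℝ).toBasis
  rw [riemannianVolume_prod, chartVolume_prod, extChartAt_prod_source, ← Measure.prod_restrict,
    riemannianVolume_restrict, Measure.restrict_univ]

theorem exists_countable_cover_source_prod :
    ∃ s : Set (M × EuclideanSpace ℝ (Fin n)), s.Countable ∧
      ⋃ p ∈ s, (extChartAt ((𝓡 m).prod (𝓡 n)) p).source = Set.univ :=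
  exists_countable_cover_source

theorem continuousOn_sqrt_det_prod (p : M × EuclideanSpace ℝ (Fin n)) :
    ContinuousOn (fun z => Real.sqrt
      (gramMatrix (productMetric (metricField gM)) (stdBasis m n) p z).det)
      (extChartAt ((𝓡 m).prod (𝓡 n)) p).target := by
  have h := (continuousOn_sqrt_det_gramMatrix gM (EuclideanSpace.basisFun (Fin m) ℝ).toBasis
    p.1).comp (continuousOn_fst (s := (extChartAt ((𝓡 m).prod (𝓡 n)) p).target))
    fun z hz => mem_target_fst hz
  exact h.congr fun z hz => sqrt_det_gramMatrix_prod gM p hz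

theorem sqrt_det_prod_pos (p : M × EuclideanSpace ℝ (Fin n)) :
    ∀ z ∈ (extChartAt ((𝓡 m).prod (𝓡 n)) p).target,
      0 < Real.sqrt (gramMatrix (productMetric (metricField gM)) (stdBasis m n) p z).det := by
  intro z hz
  rw [sqrt_det_gramMatrix_prod gM p hz]
  exact sqrt_det_gramMatrix_pos gM _ (mem_target_fst hz)

/-- Null sets are those which are null sets in all charts. -/
theorem ae_riemannianVolume_prod_iff {P : M × EuclideanSpace ℝ (Fin n) → Prop} :
    (∀ᵐ q ∂riemannianVolume (productMetric (metricField gM)) (stdBasis m n), P q) ↔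
      ∀ p : M × EuclideanSpace ℝ (Fin n),
        ∀ᵐ z, z ∈ (extChartAt ((𝓡 m).prod (𝓡 n)) p).target →
          P ((extChartAt ((𝓡 m).prod (𝓡 n)) p).symm z) := by
  constructor
  · intro h p
    have h1 : ∀ᵐ q ∂chartVolume (productMetric (metricField gM)) (stdBasis m n) p, P q := by
      rw [← riemannianVolume_prod_restrict]
      exact ae_restrict_of_ae h
    have h2 := ae_of_ae_chartVolume (stdBasis m n) _ p (continuousOn_sqrt_det_prod gM p)
      (sqrt_det_prod_pos gM p) h1
    rwa [addHaar_stdBasis] at h2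
  · intro h
    obtain ⟨s, hs, hcov⟩ := exists_countable_cover_source_prod (M := M) (m := m) (n := n)
    rw [← Measure.restrict_univ (μ := riemannianVolume _ _), ← hcov, ae_restrict_biUnion_iff _ hs]
    intro p _
    rw [riemannianVolume_prod_restrict]
    have h1 := h p
    rw [← addHaar_stdBasis] at h1
    filter_upwards [ae_chartVolume_of_ae (stdBasis m n) (productMetric (metricField gM)) p h1,
      mem_ae_iff.2 (chartVolume_compl_source (stdBasis m n) (productMetric (metricField gM)) p)]
      with q hq hqs
    rwa [(extChartAt ((𝓡 m).prod (𝓡 n)) p).left_inv hqs] at hq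

/-- The length of the weak gradient is determined almost everywhere. -/
theorem HasWeakGradient.normSq_ae_eq {u : M × EuclideanSpace ℝ (Fin n) → ℝ}
    {X X' : ∀ q : M × EuclideanSpace ℝ (Fin n), TangentSpace ((𝓡 m).prod (𝓡 n)) q}
    (h : HasWeakGradient (productMetric (metricField gM)) (stdBasis m n) u X)
    (h' : HasWeakGradient (productMetric (metricField gM)) (stdBasis m n) u X') :
    normSq gM X =ᵐ[riemannianVolume (productMetric (metricField gM)) (stdBasis m n)]
      normSq gM X' := by
  refine (ae_riemannianVolume_prod_iff gM).2 fun p => ?_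
  rw [hasWeakGradient_iff] at h h'
  have hae : ∀ᵐ z, ∀ i, z ∈ (extChartAt ((𝓡 m).prod (𝓡 n)) p).target →
      chartComp gM X p i z = chartComp gM X' p i z :=
    ae_all_iff.2 fun i => ((h p).2 i).2.ae_eq (isOpen_extChartAt_target p) ((h' p).2 i).2
      ((h p).2 i).1 ((h' p).2 i).1
  filter_upwards [hae] with z hz hzt
  rw [normSq_symm gM X p hzt, normSq_symm gM X' p hzt]
  simp only [bilinField, fun i => hz i hzt]

theorem HasWeakGradient.congr_ae {u u' : M × EuclideanSpace ℝ (Fin n) → ℝ}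
    {X : ∀ q : M × EuclideanSpace ℝ (Fin n), TangentSpace ((𝓡 m).prod (𝓡 n)) q}
    (h : HasWeakGradient (productMetric (metricField gM)) (stdBasis m n) u X)
    (hu : u =ᵐ[riemannianVolume (productMetric (metricField gM)) (stdBasis m n)] u') :
    HasWeakGradient (productMetric (metricField gM)) (stdBasis m n) u' X := by
  rw [hasWeakGradient_iff] at h ⊢
  intro p
  have hp := (ae_riemannianVolume_prod_iff gM).1 hu p
  exact ⟨LocallyIntegrableOn.congr_ae (isOpen_extChartAt_target p) (h p).1 hp, fun i =>
    ⟨((h p).2 i).1, ((h p).2 i).2.congr_ae hp (.of_forall fun _ _ => rfl)⟩⟩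

/-- The choice made in the definition of `weakGradient` does not affect the energy. -/
theorem normSq_weakGradient_ae_eq {u : M × EuclideanSpace ℝ (Fin n) → ℝ}
    {X : ∀ q : M × EuclideanSpace ℝ (Fin n), TangentSpace ((𝓡 m).prod (𝓡 n)) q}
    (h : HasWeakGradient (productMetric (metricField gM)) (stdBasis m n) u X) :
    normSq gM (weakGradient (productMetric (metricField gM)) (stdBasis m n) u)
      =ᵐ[riemannianVolume (productMetric (metricField gM)) (stdBasis m n)] normSq gM X := by
  have hex : ∃ X : ∀ q : M × EuclideanSpace ℝ (Fin n), TangentSpace ((𝓡 m).prod (𝓡 n)) q,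
    HasWeakGradient (productMetric (metricField gM)) (stdBasis m n) u X := ⟨X, h⟩
  have : weakGradient (productMetric (metricField gM)) (stdBasis m n) u = hex.choose := by
    rw [weakGradient, dif_pos hex]
  rw [this]
  exact hex.choose_spec.normSq_ae_eq gM h

end ProductGradient

/-! ### Symmetrization near a point of `M` -/

section LocalPiece

variable {m n : ℕ} {M : Type*} [TopologicalSpace M] [ChartedSpace (EuclideanSpace ℝ (Fin m)) M]
  [IsManifold (𝓡 m) ∞ M] [MeasurableSpace M] [BorelSpace M] [SecondCountableTopology M]
  (gM : ContMDiffRiemannianMetric (𝓡 m) ∞ (EuclideanSpace ℝ (Fin m))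
      (fun x : M => TangentSpace (𝓡 m) x))

/-- The volume density is bounded away from zero on compact sets. -/
theorem exists_le_sqrt_det (p : M) {K : Set (EuclideanSpace ℝ (Fin m))} (hK : IsCompact K)
    (hKΩ : K ⊆ (extChartAt (𝓡 m) p).target) :
    ∃ δ > 0, ∀ z ∈ K, δ ≤ Real.sqrt (stdGram gM p z).det := by
  rcases K.eq_empty_or_nonempty with rfl | hne
  · exact ⟨1, one_pos, by simp⟩
  obtain ⟨z₀, hz₀, hmin⟩ := hK.exists_isMinOn hne
    ((continuousOn_sqrt_det_gramMatrix gM (EuclideanSpace.basisFun (Fin m) ℝ).toBasis p).mono hKΩ)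
  exact ⟨_, sqrt_det_gramMatrix_pos gM _ (hKΩ hz₀), fun z hz => hmin hz⟩

/-- Functions on `M × ℝⁿ` whose square is controlled by an integrable function are square
integrable in a chart, over compact subsets of its base. -/
theorem memLp_indicator_chart {p : M × EuclideanSpace ℝ (Fin n)}
    {K : Set (EuclideanSpace ℝ (Fin m))} (hK : IsCompact K)
    (hKΩ : K ⊆ (extChartAt (𝓡 m) p.1).target) {k : M × EuclideanSpace ℝ (Fin n) → ℝ}
    (hk : Integrable k (riemannianVolume (productMetric (metricField gM)) (stdBasis m n)))
    {h : EuclideanSpace ℝ (Fin m) × EuclideanSpace ℝ (Fin n) → ℝ}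
    (hm : AEStronglyMeasurable h
      (volume.restrict (extChartAt ((𝓡 m).prod (𝓡 n)) p).target)) {C : ℝ} (hC0 : 0 ≤ C)
    (hle : ∀ z ∈ K ×ˢ Set.univ, h z ^ 2 ≤ C * k ((extChartAt ((𝓡 m).prod (𝓡 n)) p).symm z)) :
    MemLp ((K ×ˢ Set.univ).indicator h) 2 volume := by
  have hKt : K ×ˢ Set.univ ⊆ (extChartAt ((𝓡 m).prod (𝓡 n)) p).target := by
    rw [extChartAt_prod_target]
    exact Set.prod_mono hKΩ subset_rfl
  have hKm : MeasurableSet (K ×ˢ (Set.univ : Set (EuclideanSpace ℝ (Fin n)))) :=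
    hK.measurableSet.prod .univ
  obtain ⟨δ, hδ, hδle⟩ := exists_le_sqrt_det gM p.1 hK hKΩ
  rw [memLp_indicator_iff_restrict hKm]
  refine memLp_two_of_lintegral_sq (hm.mono_measure (Measure.restrict_mono hKt le_rfl)).aemeasurable
    (ne_top_of_le_ne_top ?_ (?_ : _ ≤ ENNReal.ofReal (C / δ) *
      ∫⁻ q, ENNReal.ofReal (k q) ∂chartVolume (productMetric (metricField gM)) (stdBasis m n) p))
  · refine ENNReal.mul_ne_top ENNReal.ofReal_ne_top ?_
    refine ne_top_of_le_ne_top hk.lintegral_lt_top.ne ?_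
    rw [← riemannianVolume_prod_restrict]
    exact lintegral_mono' Measure.restrict_le_self le_rfl
  · have hkm : AEMeasurable (fun q => ENNReal.ofReal (k q))
        (chartVolume (productMetric (metricField gM)) (stdBasis m n) p) := by
      rw [← riemannianVolume_prod_restrict]
      exact hk.1.aemeasurable.ennreal_ofReal.restrict
    rw [lintegral_chartVolume (stdBasis m n) _ p (continuousOn_sqrt_det_prod gM p) hkm,
      ← lintegral_const_mul' _ _ ENNReal.ofReal_ne_top, addHaar_stdBasis]
    refine le_trans (setLIntegral_mono' hKm fun z hz => ?_) (lintegral_mono_set hKt)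
    rw [sqrt_det_gramMatrix_prod gM p (hKt hz), ← ENNReal.ofReal_mul (Real.sqrt_nonneg _),
      ← ENNReal.ofReal_mul (by positivity)]
    have h1 := hle z hz
    have h2 : 0 ≤ C * k ((extChartAt ((𝓡 m).prod (𝓡 n)) p).symm z) := (sq_nonneg _).trans h1
    refine ENNReal.ofReal_le_ofReal (h1.trans ?_)
    have h3 : δ ≤ Real.sqrt (stdGram gM p.1 z.1).det := hδle z.1 hz.1
    have e : C / δ * (Real.sqrt (stdGram gM p.1 z.1).det *
        k ((extChartAt ((𝓡 m).prod (𝓡 n)) p).symm z)) =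
        (C * k ((extChartAt ((𝓡 m).prod (𝓡 n)) p).symm z)) *
          (Real.sqrt (stdGram gM p.1 z.1).det / δ) := by
      field_simp
    refine le_trans ?_ (le_of_eq e.symm)
    exact le_mul_of_one_le_right h2 ((one_le_div hδ).2 h3)

/-- The Cauchy–Schwarz inequality for `X` and a coordinate vector. -/
theorem chartComp_sq_le
    (X : ∀ q : M × EuclideanSpace ℝ (Fin n), TangentSpace ((𝓡 m).prod (𝓡 n)) q)
    (p : M × EuclideanSpace ℝ (Fin n))
    {z : EuclideanSpace ℝ (Fin m) × EuclideanSpace ℝ (Fin n)}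
    (hz : z ∈ (extChartAt ((𝓡 m).prod (𝓡 n)) p).target) (i : Fin m ⊕ Fin n) :
    chartComp gM X p i z ^ 2 ≤ splitMatrix n (stdGram gM p.1 z.1) 1 i i *
      normSq gM X ((extChartAt ((𝓡 m).prod (𝓡 n)) p).symm z) := by
  have h := LinearMap.BilinForm.apply_sq_le_of_symm
    (prodBilin gM n ((extChartAt ((𝓡 m).prod (𝓡 n)) p).symm z).1)
    (prodBilin_self_nonneg gM _) ⟨prodBilin_symm gM _⟩
    (X ((extChartAt ((𝓡 m).prod (𝓡 n)) p).symm z)) (coordBasis p hz i)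
  rw [splitMatrix_eq_prodBilin gM p hz, mul_comm]
  rw [coordBasis_apply] at h ⊢
  exact h

theorem continuousOn_stdGram_inv (p : M) :
    ContinuousOn (fun z => (stdGram gM p z)⁻¹) (extChartAt (𝓡 m) p).target := by
  have h1 := continuousOn_gramMatrix' gM (EuclideanSpace.basisFun (Fin m) ℝ).toBasis p
  have h2 : ContinuousOn (fun z => (stdGram gM p z).det) (extChartAt (𝓡 m) p).target :=
    (continuous_id.matrix_det).comp_continuousOn h1
  have h3 : ContinuousOn (fun z => (stdGram gM p z).adjugate) (extChartAt (𝓡 m) p).target :=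
    (continuous_id.matrix_adjugate).comp_continuousOn h1
  have h4 := (h2.inv₀ fun z hz => (isUnit_det_stdGram gM hz).ne_zero).smul h3
  refine h4.congr fun z hz => ?_
  simp only [Matrix.inv_def, Ring.inverse_eq_inv']
  rfl

end LocalPiece

section LocalSteiner

variable {m n : ℕ} {M : Type*} [TopologicalSpace M] [ChartedSpace (EuclideanSpace ℝ (Fin m)) M]
  [IsManifold (𝓡 m) ∞ M] [MeasurableSpace M] [BorelSpace M] [SecondCountableTopology M]
  (gM : ContMDiffRiemannianMetric (𝓡 m) ∞ (EuclideanSpace ℝ (Fin m))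
      (fun x : M => TangentSpace (𝓡 m) x))

theorem exists_splitMatrix_diag_le (p : M) {K : Set (EuclideanSpace ℝ (Fin m))} (hK : IsCompact K)
    (hKΩ : K ⊆ (extChartAt (𝓡 m) p).target) (i : Fin m ⊕ Fin n) :
    ∃ C, 0 ≤ C ∧ ∀ z ∈ K, splitMatrix n (stdGram gM p z) 1 i i ≤ C := by
  have hc : ContinuousOn (fun z => splitMatrix n (stdGram gM p z) 1 i i) K := by
    rcases i with i | j
    · have h1 := (continuousOn_gramMatrix' gM (EuclideanSpace.basisFun (Fin m) ℝ).toBasis p).mono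
        hKΩ
      exact (continuous_id.matrix_elem i i).comp_continuousOn h1
    · exact continuousOn_const
  obtain ⟨C, hC⟩ := hK.exists_bound_of_continuousOn hc
  exact ⟨|C|, abs_nonneg C, fun z hz => (le_abs_self _).trans ((hC z hz).trans (le_abs_self C))⟩

/-- The coefficients of the Riemannian energy are bounded on compact sets. -/
theorem exists_field_bound (p : M) {K : Set (EuclideanSpace ℝ (Fin m))} (hK : IsCompact K)
    (hKΩ : K ⊆ (extChartAt (𝓡 m) p).target) :
    ∃ C, (∀ z ∈ K, ∀ i j, |(Real.sqrt (stdGram gM p z).det • (stdGram gM p z)⁻¹) i j| ≤ C) ∧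
      ∀ z ∈ K, Real.sqrt (stdGram gM p z).det ≤ C := by
  have h0 := (continuousOn_sqrt_det_gramMatrix gM (EuclideanSpace.basisFun (Fin m) ℝ).toBasis
    p).mono hKΩ
  have h1 := (continuousOn_stdGram_inv gM p).mono hKΩ
  have h2 : ∀ i j, ContinuousOn
      (fun z => (Real.sqrt (stdGram gM p z).det • (stdGram gM p z)⁻¹) i j) K := fun i j =>
    (continuous_id.matrix_elem i j).comp_continuousOn (h0.smul h1)
  obtain ⟨C₀, hC₀⟩ := hK.exists_bound_of_continuousOn h0
  choose C hC using fun i j => hK.exists_bound_of_continuousOn (h2 i j)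
  have hnn : 0 ≤ ∑ i, ∑ j, |C i j| := Finset.sum_nonneg fun i _ => Finset.sum_nonneg fun j _ =>
    abs_nonneg _
  refine ⟨|C₀| + ∑ i, ∑ j, |C i j|, fun z hz i j => ?_, fun z hz => ?_⟩
  · have e1 : |C i j| ≤ ∑ j, |C i j| :=
      Finset.single_le_sum (f := fun j => |C i j|) (fun j _ => abs_nonneg _) (Finset.mem_univ j)
    have e2 : ∑ j, |C i j| ≤ ∑ i, ∑ j, |C i j| :=
      Finset.single_le_sum (f := fun i => ∑ j, |C i j|)
        (fun i _ => Finset.sum_nonneg fun j _ => abs_nonneg _) (Finset.mem_univ i)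
    have e3 := hC i j z hz
    rw [Real.norm_eq_abs] at e3
    linarith [abs_nonneg C₀, le_abs_self (C i j)]
  · have e3 := hC₀ z hz
    rw [Real.norm_eq_abs] at e3
    have e4 := le_abs_self (Real.sqrt (stdGram gM p z).det)
    have e5 : |Real.sqrt (stdGram gM p z).det| ≤ C₀ := e3
    linarith [le_abs_self C₀]

/-- The energy integrand of components `w` in the chart at `p`, with the density of the volume. -/
noncomputable def energyDensity (p : M)
    (w : Fin m ⊕ Fin n → EuclideanSpace ℝ (Fin m) × EuclideanSpace ℝ (Fin n) → ℝ)
    (z : EuclideanSpace ℝ (Fin m) × EuclideanSpace ℝ (Fin n)) : ℝ :=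
  Real.sqrt (stdGram gM p z.1).det *
    bilinField (fun z => splitMatrix n (stdGram gM p z.1)⁻¹ 1) w w z

/-- Components with smaller energy for all matrix fields have smaller Riemannian energy over the
subsets `A` of the base: the inequality is applied to the coefficients of the Riemannian energy,
extended by zero outside `A`. -/
theorem lintegral_energyDensity_le {p : M} {K A : Set (EuclideanSpace ℝ (Fin m))}
    (hK : IsCompact K) (hKΩ : K ⊆ (extChartAt (𝓡 m) p).target) (hA : MeasurableSet A)
    (hAK : A ⊆ K)
    {w w' : Fin m ⊕ Fin n → EuclideanSpace ℝ (Fin m) × EuclideanSpace ℝ (Fin n) → ℝ}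
    (hw : ∀ i, MemLp (w i) 2 volume) (hw' : ∀ i, MemLp (w' i) 2 volume)
    (h : ∀ (A : EuclideanSpace ℝ (Fin m) → Matrix (Fin m) (Fin m) ℝ)
      (c : EuclideanSpace ℝ (Fin m) → ℝ) (C : ℝ), (∀ i j, Measurable fun x => A x i j) →
        Measurable c → (∀ x, (A x).PosSemidef) → (∀ x, 0 ≤ c x) → (∀ x i j, |A x i j| ≤ C) →
        (∀ x, c x ≤ C) →
        ∫ q, bilinField (fun q => splitMatrix n (A q.1) (c q.1)) w' w' q ≤
          ∫ q, bilinField (fun q => splitMatrix n (A q.1) (c q.1)) w w q) :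
    ∫⁻ z in A ×ˢ Set.univ, ENNReal.ofReal (energyDensity gM p w' z) ≤
      ∫⁻ z in A ×ˢ Set.univ, ENNReal.ofReal (energyDensity gM p w z) := by
  classical
  obtain ⟨C, hC1, hC2⟩ := exists_field_bound gM p hK hKΩ
  have hAΩ := hAK.trans hKΩ
  have h0 := (continuousOn_sqrt_det_gramMatrix gM (EuclideanSpace.basisFun (Fin m) ℝ).toBasis
    p).mono hAΩ
  have h1 := (continuousOn_stdGram_inv gM p).mono hAΩ
  set D : EuclideanSpace ℝ (Fin m) → Matrix (Fin m) (Fin m) ℝ :=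
    A.piecewise (fun x => Real.sqrt (stdGram gM p x).det • (stdGram gM p x)⁻¹) (fun _ => 0) with hD
  set c : EuclideanSpace ℝ (Fin m) → ℝ :=
    A.piecewise (fun x => Real.sqrt (stdGram gM p x).det) (fun _ => 0) with hc
  have hDA : ∀ x ∈ A, D x = Real.sqrt (stdGram gM p x).det • (stdGram gM p x)⁻¹ := fun x hx =>
    Set.piecewise_eq_of_mem _ _ _ hx
  have hDn : ∀ x ∉ A, D x = 0 := fun x hx => Set.piecewise_eq_of_notMem _ _ _ hx
  have hcA : ∀ x ∈ A, c x = Real.sqrt (stdGram gM p x).det := fun x hx =>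
    Set.piecewise_eq_of_mem _ _ _ hx
  have hcn : ∀ x ∉ A, c x = 0 := fun x hx => Set.piecewise_eq_of_notMem _ _ _ hx
  have hDm : ∀ i j, Measurable fun x => D x i j := by
    intro i j
    have h2 : ContinuousOn
        (fun z => (Real.sqrt (stdGram gM p z).det • (stdGram gM p z)⁻¹) i j) A :=
      (continuous_id.matrix_elem i j).comp_continuousOn (h0.smul h1)
    have h3 := h2.measurable_piecewise (g := fun _ => (0 : ℝ)) continuousOn_const hA
    convert h3 using 1
    funext x
    by_cases hx : x ∈ A
    · rw [hDA x hx, Set.piecewise_eq_of_mem _ _ _ hx]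
    · rw [hDn x hx, Set.piecewise_eq_of_notMem _ _ _ hx, Matrix.zero_apply]
  have hcm : Measurable c := h0.measurable_piecewise continuousOn_const hA
  have hDp : ∀ x, (D x).PosSemidef := by
    intro x
    by_cases hx : x ∈ A
    · rw [hDA x hx]
      exact ((gramMatrix_posDef gM _ (hAΩ hx)).inv.posSemidef).smul (Real.sqrt_nonneg _)
    · rw [hDn x hx]
      exact Matrix.PosSemidef.zero
  have hcp : ∀ x, 0 ≤ c x := by
    intro x
    by_cases hx : x ∈ A
    · rw [hcA x hx]
      exact Real.sqrt_nonneg _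
    · rw [hcn x hx]
  have hDC : ∀ x i j, |D x i j| ≤ |C| := by
    intro x i j
    by_cases hx : x ∈ A
    · rw [hDA x hx]
      exact (hC1 x (hAK hx) i j).trans (le_abs_self C)
    · rw [hDn x hx]
      simp
  have hcC : ∀ x, c x ≤ |C| := by
    intro x
    by_cases hx : x ∈ A
    · rw [hcA x hx]
      exact (hC2 x (hAK hx)).trans (le_abs_self C)
    · rw [hcn x hx]
      exact abs_nonneg C
  set B := fun q : EuclideanSpace ℝ (Fin m) × EuclideanSpace ℝ (Fin n) =>
    splitMatrix n (D q.1) (c q.1) with hB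
  have hBm : ∀ i j, Measurable fun q => B q i j := by
    rintro (i | i) (j | j)
    · exact (hDm i j).comp measurable_fst
    · exact measurable_const
    · exact measurable_const
    · exact (hcm.comp measurable_fst).mul_const _
  have hBC : ∀ q i j, |B q i j| ≤ |C| := by
    rintro q (i | i) (j | j)
    · exact hDC q.1 i j
    · simp [hB, splitMatrix]
    · simp [hB, splitMatrix]
    · have : B q (Sum.inr i) (Sum.inr j) = c q.1 * (1 : Matrix (Fin n) (Fin n) ℝ) i j := rfl
      rw [this, Matrix.one_apply]
      split_ifs
      · rw [mul_one, abs_of_nonneg (hcp _)]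
        exact hcC _
      · simp
  have hbs : ∀ (w : Fin m ⊕ Fin n → EuclideanSpace ℝ (Fin m) × EuclideanSpace ℝ (Fin n) → ℝ) z,
      bilinField B w w z = (∑ i, w (Sum.inl i) z * ∑ j, D z.1 i j * w (Sum.inl j) z) +
        c z.1 * ∑ j, w (Sum.inr j) z ^ 2 := fun w z =>
    bilinField_splitMatrix (fun z : EuclideanSpace ℝ (Fin m) × EuclideanSpace ℝ (Fin n) => D z.1)
      (fun z => c z.1) w z
  have hpt : ∀ w : Fin m ⊕ Fin n → EuclideanSpace ℝ (Fin m) × EuclideanSpace ℝ (Fin n) → ℝ,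
      ∀ z, ENNReal.ofReal (bilinField B w w z) =
        (A ×ˢ Set.univ).indicator (fun z => ENNReal.ofReal (energyDensity gM p w z)) z := by
    intro w z
    by_cases hz : z.1 ∈ A
    · rw [Set.indicator_of_mem (by exact ⟨hz, Set.mem_univ _⟩), energyDensity,
        hbs, bilinField_splitMatrix (fun z : EuclideanSpace ℝ (Fin m) ×
          EuclideanSpace ℝ (Fin n) => (stdGram gM p z.1)⁻¹) (fun _ => 1), hDA _ hz, hcA _ hz]
      congr 1
      simp only [Matrix.smul_apply, smul_eq_mul, one_mul, mul_add, Finset.mul_sum]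
      congr 1
      exact Finset.sum_congr rfl fun i _ => Finset.sum_congr rfl fun j _ => by ring
    · rw [Set.indicator_of_notMem (by exact fun h => hz h.1),
        hbs, hDn _ hz, hcn _ hz]
      simp
  have hnn : ∀ w : Fin m ⊕ Fin n → EuclideanSpace ℝ (Fin m) × EuclideanSpace ℝ (Fin n) → ℝ,
      ∀ z, 0 ≤ bilinField B w w z := fun w z =>
    (splitMatrix_posSemidef (hDp z.1) (hcp z.1)).dotProduct_mulVec_nonneg fun i => w i z
  have hAm : MeasurableSet (A ×ˢ (Set.univ : Set (EuclideanSpace ℝ (Fin n)))) := hA.prod .univ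
  rw [← lintegral_indicator hAm, ← lintegral_indicator hAm, ← lintegral_congr (hpt w),
    ← lintegral_congr (hpt w'),
    ← ofReal_integral_eq_lintegral_ofReal (integrable_bilinField hBm hBC hw hw)
      (.of_forall (hnn w)),
    ← ofReal_integral_eq_lintegral_ofReal (integrable_bilinField hBm hBC hw' hw')
      (.of_forall (hnn w'))]
  exact ENNReal.ofReal_le_ofReal (h D c |C| hDm hcm hDp hcp hDC hcC)

/-- Near any point of `M`, the Steiner symmetrization of the absolute value of a Sobolev function has
weak derivatives `W` in `L²`, whose energy over any part of the base is not larger. The chain rule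
for `W` under diffeomorphisms is part of the statement, as it is needed to compare different
charts. -/
theorem exists_local_steiner_gradient (hn : 1 ≤ n) (p : M × EuclideanSpace ℝ (Fin n))
    {u : M × EuclideanSpace ℝ (Fin n) → ℝ}
    {X : ∀ q : M × EuclideanSpace ℝ (Fin n), TangentSpace ((𝓡 m).prod (𝓡 n)) q}
    (hu : MemLp u 2 (riemannianVolume (productMetric (metricField gM)) (stdBasis m n)))
    (hX : HasWeakGradient (productMetric (metricField gM)) (stdBasis m n) u X)
    (hI : Integrable (normSq gM X)
      (riemannianVolume (productMetric (metricField gM)) (stdBasis m n))) :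
    ∃ (B : Set (EuclideanSpace ℝ (Fin m)))
      (W : Fin m ⊕ Fin n → EuclideanSpace ℝ (Fin m) × EuclideanSpace ℝ (Fin n) → ℝ),
      IsOpen B ∧ extChartAt (𝓡 m) p.1 p.1 ∈ B ∧ B ⊆ (extChartAt (𝓡 m) p.1).target ∧
      (∀ i, MemLp (W i) 2 volume) ∧
      (∀ O O' T S, IsDiffeoOn O O' T S → (∀ z ∈ O', z.1 ∈ B) → ∀ e,
        WeakDeriv volume O e
          (fun z => steiner (fun q => |u q|) ((extChartAt ((𝓡 m).prod (𝓡 n)) p).symm (T z)))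
          fun z => ∑ i, (stdBasis m n).repr (fderiv ℝ T z e) i * W i (T z)) ∧
      ∀ A ⊆ B, MeasurableSet A →
        ∫⁻ z in A ×ˢ Set.univ, ENNReal.ofReal (energyDensity gM p.1 W z) ≤
          ∫⁻ z in A ×ˢ Set.univ, ENNReal.ofReal (energyDensity gM p.1 (chartComp gM X p) z) := by
  set φ := extChartAt ((𝓡 m).prod (𝓡 n)) p with hφ
  set Ω := (extChartAt (𝓡 m) p.1).target with hΩ
  set z₀ := extChartAt (𝓡 m) p.1 p.1 with hz₀
  obtain ⟨R, hR, hRΩ⟩ := nhds_basis_closedBall.mem_iff.1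
    ((isOpen_extChartAt_target (I := 𝓡 m) p.1).mem_nhds (mem_extChartAt_target (I := 𝓡 m) p.1))
  set K := closedBall z₀ R with hKdef
  have hK : IsCompact K := isCompact_closedBall _ _
  -- A cutoff function on the base. Symmetrization acts on each fibre separately, so that the
  -- symmetrizations of `χ u` and of `u` agree over the points where `χ = 1`.
  let χ : ContDiffBump z₀ := ⟨R / 2, R, by positivity, by linarith⟩
  set η : EuclideanSpace ℝ (Fin m) × EuclideanSpace ℝ (Fin n) → ℝ := fun z => χ z.1 with hη
  have hηs : ContDiff ℝ ∞ η := χ.contDiff.comp contDiff_fst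
  have hχK : ∀ x ∉ K, χ x = 0 := fun x hx => by
    have : x ∉ tsupport χ := by rwa [χ.tsupport_eq]
    exact image_eq_zero_of_notMem_tsupport this
  have hKt : K ×ˢ Set.univ ⊆ φ.target := by
    rw [hφ, extChartAt_prod_target]
    exact Set.prod_mono hRΩ subset_rfl
  have hηO : tsupport η ⊆ φ.target := by
    refine (closure_minimal ?_ (isClosed_closedBall.prod isClosed_univ)).trans hKt
    intro z hz
    refine ⟨?_, Set.mem_univ _⟩
    by_contra h
    exact hz (hχK z.1 h)
  have hdη : ∀ z e, fderiv ℝ η z e = fderiv ℝ χ z.1 e.1 := by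
    intro z e
    have h1 := ((χ.contDiff (n := 1)).differentiable (by simp) z.1).hasFDerivAt
    have h2 := h1.comp z (hasFDerivAt_fst (𝕜 := ℝ) (p := z))
    rw [show η = (χ : EuclideanSpace ℝ (Fin m) → ℝ) ∘ Prod.fst from rfl, h2.fderiv]
    rfl
  have hdχK : ∀ x ∉ K, ∀ e, fderiv ℝ χ x e = 0 := fun x hx e => by
    have : x ∉ tsupport (fun x => fderiv ℝ χ x e) := fun h => hx (by
      rw [hKdef, ← χ.tsupport_eq]
      exact tsupport_fderiv_apply_subset ℝ e h)
    exact image_eq_zero_of_notMem_tsupport (f := fun x => fderiv ℝ χ x e) this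
  have hχ1 : ∀ x ∈ ball z₀ (R / 2), χ x = 1 := fun x hx =>
    χ.one_of_mem_closedBall (ball_subset_closedBall hx)
  have hdχ0 : ∀ x ∈ ball z₀ (R / 2), ∀ e, fderiv ℝ χ x e = 0 := fun x hx e => by
    have : (χ : EuclideanSpace ℝ (Fin m) → ℝ) =ᶠ[𝓝 x] fun _ => 1 := by
      filter_upwards [isOpen_ball.mem_nhds hx] with y hy using hχ1 y hy
    rw [this.fderiv_eq]
    simp
  set v := fun z => u (φ.symm z) with hv
  have hloc := (hasWeakGradient_iff gM).1 hX p
  have hvK : MemLp ((K ×ˢ Set.univ).indicator v) 2 volume :=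
    memLp_indicator_chart gM hK hRΩ hu.integrable_sq
      (LocallyIntegrableOn.aestronglyMeasurable hloc.1) zero_le_one
      fun z _ => (one_mul _).ge
  have hcK : ∀ i, MemLp ((K ×ˢ Set.univ).indicator (chartComp gM X p i)) 2 volume := by
    intro i
    obtain ⟨C, hC0, hC⟩ := exists_splitMatrix_diag_le (n := n) gM p.1 hK hRΩ i
    refine memLp_indicator_chart gM hK hRΩ hI
      (LocallyIntegrableOn.aestronglyMeasurable (hloc.2 i).1) hC0 fun z hz => ?_
    refine (chartComp_sq_le gM X p (hKt hz) i).trans ?_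
    exact mul_le_mul_of_nonneg_right (hC z.1 hz.1) (normSq_nonneg gM X _)
  set w := fun z => η z * v z with hw
  set W := fun i z => fderiv ℝ η z (stdBasis m n i) * v z + η z * chartComp gM X p i z with hW
  -- The function `w = χ u` has weak derivatives in `L²` on all of `ℝᵐ × ℝⁿ`.
  have hd : ∀ i, WeakDeriv volume Set.univ (stdBasis m n i) w (W i) := fun i =>
    (hloc.2 i).2.mul hloc.1 (hloc.2 i).1 hηs hηO
  have hmul : ∀ (B : EuclideanSpace ℝ (Fin m) → ℝ), Continuous B → HasCompactSupport B →
      (∀ x ∉ K, B x = 0) →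
      ∀ f : EuclideanSpace ℝ (Fin m) × EuclideanSpace ℝ (Fin n) → ℝ,
        MemLp ((K ×ˢ Set.univ).indicator f) 2 volume → MemLp (fun z => B z.1 * f z) 2 volume := by
    intro B hB hBc hBK f hf
    obtain ⟨C, hC⟩ := hBc.exists_bound_of_continuous hB
    have h1 := MemLp.bdd_mul_two hf (B := fun z => B z.1)
      (hB.comp continuous_fst).aestronglyMeasurable (C := C) fun z => hC z.1
    convert h1 using 1
    funext z
    by_cases hz : z.1 ∈ K
    · rw [Set.indicator_of_mem (by exact ⟨hz, Set.mem_univ _⟩)]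
    · rw [hBK z.1 hz]
      simp
  have hwm : MemLp w 2 volume := hmul χ χ.continuous χ.hasCompactSupport hχK v hvK
  have hWm : ∀ i, MemLp (W i) 2 volume := by
    intro i
    refine MemLp.add ?_ (hmul χ χ.continuous χ.hasCompactSupport hχK _ (hcK i))
    simp only [hdη]
    exact hmul (fun x => fderiv ℝ χ x (stdBasis m n i).1)
      (((χ.contDiff (n := 1)).continuous_fderiv (by simp)).clm_apply continuous_const)
      (χ.hasCompactSupport.fderiv_apply (𝕜 := ℝ) _) (fun x hx => hdχK x hx _) v hvK
  -- The flat case, applied to `w`; the weak limits are the derivatives over the smaller ball.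
  obtain ⟨Φ, W', hΦ, hW', hlim, hlimd, hen⟩ := exists_weak_approx_steiner
    (volume : Measure (EuclideanSpace ℝ (Fin m))) hn
    (fun i => EuclideanSpace.basisFun (Fin m) ℝ i) hwm hWm
    (fun i => by rw [← stdBasis_eq_frameVec]; exact hd i) (hyperfilter ℕ) Nat.hyperfilter_le_atTop
  rw [← stdBasis_eq_frameVec] at hlimd
  refine ⟨ball z₀ (R / 2), W', isOpen_ball, mem_ball_self (by positivity),
    (ball_subset_closedBall.trans (closedBall_subset_closedBall (by linarith))).trans hRΩ, hW',
    fun O O' T S hT hO' e => ?_, fun A hAB hA => ?_⟩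
  · refine (hT.weakDeriv_comp (stdBasis m n) (fun k => (hΦ k).1) hW' hlim hlimd e).congr_ae
      (.of_forall fun z hz => ?_) (.of_forall fun z _ => rfl)
    have hTz := hO' _ (hT.mapsTo z hz)
    rw [hφ, extChartAt_prod_symm_apply, steiner_eq_schwarz]
    have e1 : T z = ((T z).1, (T z).2) := rfl
    rw [e1, steiner_eq_schwarz]
    congr 1
    funext y
    simp only [hw, hη, hv, hχ1 _ hTz, one_mul, hφ, extChartAt_prod_symm_apply]
  · have hAK : A ⊆ K := hAB.trans
      (ball_subset_closedBall.trans (closedBall_subset_closedBall (by linarith)))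
    refine (lintegral_energyDensity_le gM hK hRΩ hA hAK hWm hW' hen).trans (le_of_eq ?_)
    refine setLIntegral_congr_fun (hA.prod .univ) fun z hz => ?_
    have e1 : ∀ i, W i z = chartComp gM X p i z := fun i => by
      have h1 : W i z = fderiv ℝ η z (stdBasis m n i) * v z + χ z.1 * chartComp gM X p i z := rfl
      rw [h1, hdη, hdχ0 z.1 (hAB hz.1), hχ1 z.1 (hAB hz.1), zero_mul, one_mul, zero_add]
    simp only [energyDensity, bilinField, e1]

end LocalSteiner

/-! ### Weak gradients from local data -/

/-- The transformed components of a covector field with components in `L²` are locally integrable.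
-/
theorem IsDiffeoOn.locallyIntegrableOn_sum_repr {Z κ : Type*} [NormedAddCommGroup Z]
    [NormedSpace ℝ Z] [FiniteDimensional ℝ Z] [MeasurableSpace Z] [BorelSpace Z] {μ : Measure Z}
    [μ.IsAddHaarMeasure] {O O' : Set Z} {T S : Z → Z} (h : IsDiffeoOn O O' T S) [Fintype κ]
    (b : Module.Basis κ ℝ Z) {W : κ → Z → ℝ} (hW : ∀ i, MemLp (W i) 2 μ) (e : Z) :
    LocallyIntegrableOn (fun z => ∑ i, b.repr (fderiv ℝ T z e) i * W i (T z)) O μ := by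
  refine (locallyIntegrableOn_iff h.isOpen.isLocallyClosed).2 fun K hKO hK =>
    integrable_finsetSum _ fun i _ => ?_
  have h1 := h.integrableOn_comp ((hW i).locallyIntegrable (by norm_num)) hK hKO
  have h2 : ContinuousOn (fun z => b.repr (fderiv ℝ T z e) i) K :=
    (LinearMap.continuous_of_finiteDimensional (b.coord i)).comp_continuousOn
      ((h.continuousOn_fderiv_apply e).mono hKO)
  exact h1.continuousOn_mul h2 hK

theorem isDiffeoOn_id {Z : Type*} [NormedAddCommGroup Z] [NormedSpace ℝ Z] {O : Set Z}
    (hO : IsOpen O) : IsDiffeoOn O O (fun z => z) (fun z => z) :=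
  ⟨hO, hO, contDiffOn_id, contDiffOn_id, fun _ h => h, fun _ h => h, fun _ _ => rfl, fun _ _ => rfl⟩

section Gluing

variable {m n : ℕ} {M : Type*} [TopologicalSpace M] [ChartedSpace (EuclideanSpace ℝ (Fin m)) M]
  [IsManifold (𝓡 m) ∞ M] [MeasurableSpace M] [BorelSpace M] [SecondCountableTopology M]
  (gM : ContMDiffRiemannianMetric (𝓡 m) ∞ (EuclideanSpace ℝ (Fin m))
      (fun x : M => TangentSpace (𝓡 m) x))

/-- Weak derivatives `W k` of `f` over subsets `B k` of the charts at `e k`, whose domains cover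
`M`, are the components of a weak gradient. The chain rule is assumed in `hd`; on overlaps, the
given derivatives are compatible because weak derivatives are unique. -/
theorem exists_hasWeakGradient_of_charts {f : M × EuclideanSpace ℝ (Fin n) → ℝ}
    (hf : ∀ p, LocallyIntegrableOn (fun z => f ((extChartAt ((𝓡 m).prod (𝓡 n)) p).symm z))
      (extChartAt ((𝓡 m).prod (𝓡 n)) p).target volume)
    (e : ℕ → M) (B : ℕ → Set (EuclideanSpace ℝ (Fin m)))
    (W : ℕ → Fin m ⊕ Fin n → EuclideanSpace ℝ (Fin m) × EuclideanSpace ℝ (Fin n) → ℝ)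
    (hB : ∀ k, IsOpen (B k)) (hBΩ : ∀ k, B k ⊆ (extChartAt (𝓡 m) (e k)).target)
    (hcov : ∀ x : M, ∃ k, x ∈ (extChartAt (𝓡 m) (e k)).source ∧ extChartAt (𝓡 m) (e k) x ∈ B k)
    (hW : ∀ k i, MemLp (W k i) 2 volume)
    (hd : ∀ k O O' T S, IsDiffeoOn O O' T S → (∀ z ∈ O', z.1 ∈ B k) → ∀ v,
      WeakDeriv volume O v
        (fun z => f ((extChartAt ((𝓡 m).prod (𝓡 n)) ((e k, 0) :
          M × EuclideanSpace ℝ (Fin n))).symm (T z)))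
        fun z => ∑ i, (stdBasis m n).repr (fderiv ℝ T z v) i * W k i (T z)) :
    ∃ X : ∀ q : M × EuclideanSpace ℝ (Fin n), TangentSpace ((𝓡 m).prod (𝓡 n)) q,
      HasWeakGradient (productMetric (metricField gM)) (stdBasis m n) f X ∧
      ∀ k, ∀ᵐ z, z.1 ∈ B k → ∀ i, chartComp gM X (e k, 0) i z = W k i z := by
  classical
  set P : ℕ → M × EuclideanSpace ℝ (Fin n) := fun k => (e k, 0) with hP
  set I := (𝓡 m).prod (𝓡 n) with hI
  -- At a point over `x`, the vector field is defined by the first member of the family that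
  -- contains `x`.
  set κ : M → ℕ := fun x => Nat.find (hcov x) with hκ
  have hκs : ∀ x, x ∈ (extChartAt (𝓡 m) (e (κ x))).source ∧
      extChartAt (𝓡 m) (e (κ x)) x ∈ B (κ x) := fun x => Nat.find_spec (hcov x)
  set X : ∀ q : M × EuclideanSpace ℝ (Fin n), TangentSpace I q := fun q =>
    raiseVec gM (P (κ q.1)) (extChartAt I (P (κ q.1)) q)
      (fun i => W (κ q.1) i (extChartAt I (P (κ q.1)) q)) with hX
  set O : M × EuclideanSpace ℝ (Fin n) → ℕ →
      Set (EuclideanSpace ℝ (Fin m) × EuclideanSpace ℝ (Fin n)) := fun p k =>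
    overlap I p (P k) ∩ transition I p (P k) ⁻¹' (B k ×ˢ Set.univ) with hO
  -- The `k`-th family of derivatives, transformed to the chart at `p`.
  set θ : M × EuclideanSpace ℝ (Fin n) → ℕ → Fin m ⊕ Fin n →
      EuclideanSpace ℝ (Fin m) × EuclideanSpace ℝ (Fin n) → ℝ := fun p k i z =>
    ∑ j, (stdBasis m n).repr (fderiv ℝ (transition I p (P k)) z (stdBasis m n i)) j *
      W k j (transition I p (P k) z) with hθ
  have hdiff : ∀ p k, IsDiffeoOn (O p k) (overlap I (P k) p ∩ B k ×ˢ Set.univ)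
      (transition I p (P k)) (transition I (P k) p) := fun p k =>
    (isDiffeoOn_transition p (P k)).restrict ((hB k).prod isOpen_univ)
  have hθd : ∀ p k i, WeakDeriv volume (O p k) (stdBasis m n i)
      (fun z => f ((extChartAt I p).symm z)) (θ p k i) := by
    intro p k i
    refine (hd k _ _ _ _ (hdiff p k) (fun z hz => hz.2.1) (stdBasis m n i)).congr_ae
      (.of_forall fun z hz => ?_) (.of_forall fun z _ => rfl)
    have := symm_transition hz.1
    exact congrArg f this
  have hθl : ∀ p k i, LocallyIntegrableOn (θ p k i) (O p k) volume := fun p k i =>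
    (hdiff p k).locallyIntegrableOn_sum_repr (stdBasis m n) (hW k) _
  have hmem : ∀ p, ∀ z ∈ (extChartAt I p).target, ∀ k,
      ((extChartAt I p).symm z).1 ∈ (extChartAt (𝓡 m) (e k)).source →
      extChartAt (𝓡 m) (e k) ((extChartAt I p).symm z).1 ∈ B k → z ∈ O p k := by
    intro p z hz k h1 h2
    refine ⟨⟨hz, ?_⟩, ?_, Set.mem_univ _⟩
    · rw [Set.mem_preimage, hI, extChartAt_prod_source]
      exact ⟨h1, Set.mem_univ _⟩
    · rw [transition, hI, extChartAt_prod_apply]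
      exact h2
  have hOun : ∀ p, ⋃ k, O p k = (extChartAt I p).target := by
    intro p
    refine subset_antisymm (Set.iUnion_subset fun k z hz => hz.1.1) fun z hz => ?_
    exact Set.mem_iUnion.2 ⟨_, hmem p z hz _ (hκs _).1 (hκs _).2⟩
  have hchart : ∀ p, ∀ z ∈ (extChartAt I p).target, ∀ i, chartComp gM X p i z =
      θ p (κ ((extChartAt I p).symm z).1) i z := by
    intro p z hz i
    set q := (extChartAt I p).symm z with hq
    set l := κ q.1 with hl
    have hzO : z ∈ O p l := hmem p z hz l (hκs q.1).1 (hκs q.1).2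
    have hT := (transition_mem_overlap hzO.1).1
    have h1 := symm_transition hzO.1
    have h2 := chartD_transition hzO.1
    have h3 : chartD I p z (stdBasis m n i) = ∑ j, (stdBasis m n).repr
        (fderiv ℝ (transition I p (P l)) z (stdBasis m n i)) j •
          chartD I (P l) (transition I p (P l) z) (stdBasis m n j) := by
      rw [h2, ContinuousLinearMap.comp_apply]
      conv_lhs => rw [← (stdBasis m n).sum_repr
        (fderiv ℝ (transition I p (P l)) z (stdBasis m n i))]
      rw [map_sum]
      simp only [map_smul]
    change prodBilin gM n q.1 (raiseVec gM (P l) (transition I p (P l) z)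
      (fun i => W l i (transition I p (P l) z))) (chartD I p z (stdBasis m n i)) = _
    rw [h3, map_sum]
    simp only [map_smul, smul_eq_mul]
    refine Finset.sum_congr rfl fun j _ => ?_
    congr 1
    have h4 := prodBilin_raiseVec gM hT (fun i => W l i (transition I p (P l) z)) j
    rwa [h1] at h4
  -- By uniqueness of weak derivatives, the choice made by `κ` is irrelevant almost everywhere.
  have hae : ∀ p k i, ∀ᵐ z, z ∈ O p k → θ p k i z = chartComp gM X p i z := by
    intro p k i
    have h1 : ∀ᵐ z, ∀ l, z ∈ O p k ∩ O p l → θ p k i z = θ p l i z :=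
      ae_all_iff.2 fun l =>
        ((hθd p k i).mono Set.inter_subset_left).ae_eq ((hdiff p k).isOpen.inter (hdiff p l).isOpen)
          ((hθd p l i).mono Set.inter_subset_right)
          ((hθl p k i).mono_set Set.inter_subset_left)
          ((hθl p l i).mono_set Set.inter_subset_right)
    filter_upwards [h1] with z hz hzO
    rw [hchart p z hzO.1.1]
    exact hz _ ⟨hzO, hmem p z hzO.1.1 _ (hκs _).1 (hκs _).2⟩
  have hXl : ∀ p k i, LocallyIntegrableOn (chartComp gM X p i) (O p k) volume := fun p k i =>
    LocallyIntegrableOn.congr_ae (hdiff p k).isOpen (hθl p k i) (hae p k i)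
  have hG : HasWeakGradient (productMetric (metricField gM)) (stdBasis m n) f X := by
    rw [hasWeakGradient_iff]
    refine fun p => ⟨hf p, fun i => ?_⟩
    rw [← hI, ← hOun p]
    refine ⟨LocallyIntegrableOn.iUnion_of_isOpen (fun k => (hdiff p k).isOpen) fun k => hXl p k i,
      WeakDeriv.iUnion (fun k => (hdiff p k).isOpen) (fun k => ?_) (fun k => ?_)
        fun k => hXl p k i⟩
    · exact (hθd p k i).congr_ae (.of_forall fun z _ => rfl) (hae p k i)
    · exact (hf p).mono_set fun z hz => hz.1.1
  refine ⟨X, hG, fun k => ?_⟩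
  have hBo : IsOpen (B k ×ˢ (Set.univ : Set (EuclideanSpace ℝ (Fin n)))) := (hB k).prod isOpen_univ
  have hBt : B k ×ˢ Set.univ ⊆ (extChartAt I (P k)).target := by
    rw [hI, extChartAt_prod_target]
    exact Set.prod_mono (hBΩ k) subset_rfl
  rw [hasWeakGradient_iff] at hG
  have key : ∀ᵐ z, ∀ i, z ∈ B k ×ˢ (Set.univ : Set (EuclideanSpace ℝ (Fin n))) →
      chartComp gM X (P k) i z = W k i z := by
    refine ae_all_iff.2 fun i => ?_
    have h1 := hd k _ _ _ _ (isDiffeoOn_id hBo) (fun z hz => hz.1) (stdBasis m n i)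
    have h2 : WeakDeriv volume (B k ×ˢ Set.univ) (stdBasis m n i)
        (fun z => f ((extChartAt I (P k)).symm z)) (W k i) := by
      refine h1.congr_ae (.of_forall fun z _ => rfl) (.of_forall fun z _ => ?_)
      simp [Finsupp.single_apply]
    exact (((hG (P k)).2 i).2.mono hBt).ae_eq hBo h2 (((hG (P k)).2 i).1.mono_set hBt)
      (((hW k i).locallyIntegrable (by norm_num)).locallyIntegrableOn _)
  filter_upwards [key] with z hz hzB i
  exact hz i ⟨hzB, Set.mem_univ _⟩

end Gluing

/-! ### The energy of the symmetrization -/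

section Energy

variable {m n : ℕ} {M : Type*} [TopologicalSpace M] [ChartedSpace (EuclideanSpace ℝ (Fin m)) M]
  [IsManifold (𝓡 m) ∞ M] [MeasurableSpace M] [BorelSpace M] [SecondCountableTopology M]
  (gM : ContMDiffRiemannianMetric (𝓡 m) ∞ (EuclideanSpace ℝ (Fin m))
      (fun x : M => TangentSpace (𝓡 m) x))

/-- Measurability almost everywhere can be checked in the charts. -/
theorem aemeasurable_riemannianVolume_prod_iff {h : M × EuclideanSpace ℝ (Fin n) → ℝ} :
    AEMeasurable h (riemannianVolume (productMetric (metricField gM)) (stdBasis m n)) ↔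
      ∀ p, AEMeasurable h (chartVolume (productMetric (metricField gM)) (stdBasis m n) p) := by
  constructor
  · intro H p
    rw [← riemannianVolume_prod_restrict]
    exact H.restrict
  · intro H
    obtain ⟨s, hs, hcov⟩ := exists_countable_cover_source_prod (M := M) (m := m) (n := n)
    have : Countable s := hs.to_subtype
    rw [← Measure.restrict_univ (μ := riemannianVolume _ _), ← hcov, Set.biUnion_eq_iUnion,
      aemeasurable_iUnion_iff]
    intro p
    rw [riemannianVolume_prod_restrict]
    exact H p

theorem HasWeakGradient.aemeasurable_normSq {u : M × EuclideanSpace ℝ (Fin n) → ℝ}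
    {X : ∀ q : M × EuclideanSpace ℝ (Fin n), TangentSpace ((𝓡 m).prod (𝓡 n)) q}
    (h : HasWeakGradient (productMetric (metricField gM)) (stdBasis m n) u X) :
    AEMeasurable (normSq gM X)
      (riemannianVolume (productMetric (metricField gM)) (stdBasis m n)) := by
  rw [hasWeakGradient_iff] at h
  rw [aemeasurable_riemannianVolume_prod_iff]
  intro p
  have ht := (isOpen_extChartAt_target (I := (𝓡 m).prod (𝓡 n)) p).measurableSet
  have hc : ∀ i, AEMeasurable (chartComp gM X p i)
      (volume.restrict (extChartAt ((𝓡 m).prod (𝓡 n)) p).target) := fun i =>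
    (LocallyIntegrableOn.aestronglyMeasurable ((h p).2 i).1).aemeasurable
  have hG : ∀ i j, AEMeasurable
      (fun z : EuclideanSpace ℝ (Fin m) × EuclideanSpace ℝ (Fin n) => (stdGram gM p.1 z.1)⁻¹ i j)
      (volume.restrict (extChartAt ((𝓡 m).prod (𝓡 n)) p).target) := by
    intro i j
    refine ContinuousOn.aemeasurable ?_ ht
    exact (continuous_id.matrix_elem i j).comp_continuousOn
      ((continuousOn_stdGram_inv gM p.1).comp continuousOn_fst fun z hz => mem_target_fst hz)
  refine aemeasurable_of_chart (stdBasis m n) _ p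
    (k := fun z => normSq gM X ((extChartAt ((𝓡 m).prod (𝓡 n)) p).symm z)) ?_ fun q hq => by
      rw [(extChartAt ((𝓡 m).prod (𝓡 n)) p).left_inv hq]
  rw [addHaar_stdBasis]
  refine AEMeasurable.congr (f := fun z => (∑ i, chartComp gM X p (Sum.inl i) z *
    ∑ j, (stdGram gM p.1 z.1)⁻¹ i j * chartComp gM X p (Sum.inl j) z) +
      1 * ∑ j, chartComp gM X p (Sum.inr j) z ^ 2) ?_ ?_
  · refine AEMeasurable.add (Finset.aemeasurable_fun_sum _ fun i _ => (hc _).mul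
      (Finset.aemeasurable_fun_sum _ fun j _ => (hG i j).mul (hc _)))
      ((Finset.aemeasurable_fun_sum _ fun j _ => (hc _).pow_const 2).const_mul 1)
  · filter_upwards [ae_restrict_mem ht] with z hz
    rw [normSq_symm gM X p hz]
    exact (bilinField_splitMatrix (fun z : EuclideanSpace ℝ (Fin m) × EuclideanSpace ℝ (Fin n) =>
      (stdGram gM p.1 z.1)⁻¹) (fun _ => 1) _ z).symm

/-- The energy over a subset of the domain of a chart, in coordinates. -/
theorem setLIntegral_normSq (p : M × EuclideanSpace ℝ (Fin n)) {D : Set M} (hD : MeasurableSet D)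
    (hDs : D ⊆ (extChartAt (𝓡 m) p.1).source)
    {X : ∀ q : M × EuclideanSpace ℝ (Fin n), TangentSpace ((𝓡 m).prod (𝓡 n)) q}
    (hX : AEMeasurable (normSq gM X)
      (riemannianVolume (productMetric (metricField gM)) (stdBasis m n))) :
    ∫⁻ q in D ×ˢ Set.univ, ENNReal.ofReal (normSq gM X q)
        ∂riemannianVolume (productMetric (metricField gM)) (stdBasis m n) =
      ∫⁻ z in ((extChartAt (𝓡 m) p.1).target ∩ (extChartAt (𝓡 m) p.1).symm ⁻¹' D) ×ˢ Set.univ,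
        ENNReal.ofReal (energyDensity gM p.1 (chartComp gM X p) z) := by
  have hDm : MeasurableSet (D ×ˢ (Set.univ : Set (EuclideanSpace ℝ (Fin n)))) := hD.prod .univ
  have hDss : D ×ˢ Set.univ ⊆ (extChartAt ((𝓡 m).prod (𝓡 n)) p).source := by
    rw [extChartAt_prod_source]
    exact Set.prod_mono hDs subset_rfl
  have hA : MeasurableSet (((extChartAt (𝓡 m) p.1).target ∩ (extChartAt (𝓡 m) p.1).symm ⁻¹' D) ×ˢ
      (Set.univ : Set (EuclideanSpace ℝ (Fin n)))) :=
    (measurableSet_inter_preimage_symm (I := 𝓡 m) p.1 hD).prod .univ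
  have ht := (isOpen_extChartAt_target (I := (𝓡 m).prod (𝓡 n)) p).measurableSet
  rw [← Set.inter_eq_left.2 hDss, ← Measure.restrict_restrict hDm, riemannianVolume_prod_restrict,
    ← lintegral_indicator hDm, lintegral_chartVolume (stdBasis m n) _ p
      (continuousOn_sqrt_det_prod gM p)
      ((((aemeasurable_riemannianVolume_prod_iff gM).1 hX p).ennreal_ofReal).indicator hDm),
    addHaar_stdBasis, ← lintegral_indicator ht, ← lintegral_indicator hA]
  refine lintegral_congr fun z => ?_
  by_cases hz : z ∈ (extChartAt ((𝓡 m).prod (𝓡 n)) p).target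
  · have hz1 := mem_target_fst hz
    rw [Set.indicator_of_mem hz, sqrt_det_gramMatrix_prod gM p hz]
    by_cases hzD : (extChartAt (𝓡 m) p.1).symm z.1 ∈ D
    · rw [Set.indicator_of_mem (by rw [extChartAt_prod_symm_apply]; exact ⟨hzD, Set.mem_univ _⟩),
        Set.indicator_of_mem (by exact ⟨⟨hz1, hzD⟩, Set.mem_univ _⟩), normSq_symm gM X p hz,
        ← ENNReal.ofReal_mul (Real.sqrt_nonneg _)]
      rfl
    · rw [Set.indicator_of_notMem (by rw [extChartAt_prod_symm_apply]; exact fun h => hzD h.1),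
        Set.indicator_of_notMem (by exact fun h => hzD h.1.2), mul_zero]
  · rw [Set.indicator_of_notMem hz, Set.indicator_of_notMem]
    intro h
    refine hz ?_
    rw [extChartAt_prod_target]
    exact ⟨h.1.1, Set.mem_univ _⟩

theorem aestronglyMeasurable_comp_symm (p : M × EuclideanSpace ℝ (Fin n))
    {f : M × EuclideanSpace ℝ (Fin n) → ℝ}
    (hf : AEMeasurable f (riemannianVolume (productMetric (metricField gM)) (stdBasis m n))) :
    AEStronglyMeasurable (fun z => f ((extChartAt ((𝓡 m).prod (𝓡 n)) p).symm z))
      (volume.restrict (extChartAt ((𝓡 m).prod (𝓡 n)) p).target) := by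
  have h1 := aemeasurable_extChartAt_symm (stdBasis m n) p (I := (𝓡 m).prod (𝓡 n))
  rw [addHaar_stdBasis] at h1
  refine AEMeasurable.aestronglyMeasurable
    ⟨fun z => hf.mk f (h1.mk _ z), hf.measurable_mk.comp h1.measurable_mk, ?_⟩
  have h2 := (ae_riemannianVolume_prod_iff gM).1 hf.ae_eq_mk p
  filter_upwards [ae_restrict_of_ae h2, h1.ae_eq_mk,
    ae_restrict_mem (isOpen_extChartAt_target (I := (𝓡 m).prod (𝓡 n)) p).measurableSet]
    with z hz hz1 hzt
  rw [hz hzt, hz1]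

/-- Functions in `L²(M × ℝⁿ)` are locally integrable in each chart. -/
theorem locallyIntegrableOn_comp_symm (p : M × EuclideanSpace ℝ (Fin n))
    {f : M × EuclideanSpace ℝ (Fin n) → ℝ}
    (hf : MemLp f 2 (riemannianVolume (productMetric (metricField gM)) (stdBasis m n))) :
    LocallyIntegrableOn (fun z => f ((extChartAt ((𝓡 m).prod (𝓡 n)) p).symm z))
      (extChartAt ((𝓡 m).prod (𝓡 n)) p).target volume := by
  refine (locallyIntegrableOn_iff (isOpen_extChartAt_target p).isLocallyClosed).2
    fun L hLt hL => ?_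
  have hK : IsCompact (Prod.fst '' L) := hL.image continuous_fst
  have hKΩ : Prod.fst '' L ⊆ (extChartAt (𝓡 m) p.1).target := by
    rintro _ ⟨z, hz, rfl⟩
    exact mem_target_fst (hLt hz)
  have h := memLp_indicator_chart gM hK hKΩ hf.integrable_sq
    (aestronglyMeasurable_comp_symm gM p hf.1.aemeasurable) zero_le_one
      fun z _ => (one_mul _).ge
  have h2 := (h.locallyIntegrable (by norm_num)).integrableOn_isCompact hL
  refine h2.congr_fun (fun z hz => ?_) hL.measurableSet
  exact Set.indicator_of_mem (by exact ⟨⟨z, hz, rfl⟩, Set.mem_univ _⟩) _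

/-- The Steiner symmetrization of the absolute value of a Sobolev function has a weak gradient, and
its energy is not larger. -/
theorem exists_steiner_gradient (hn : 1 ≤ n) {u : M × EuclideanSpace ℝ (Fin n) → ℝ}
    {X : ∀ q : M × EuclideanSpace ℝ (Fin n), TangentSpace ((𝓡 m).prod (𝓡 n)) q}
    (hu : MemLp u 2 (riemannianVolume (productMetric (metricField gM)) (stdBasis m n)))
    (hX : HasWeakGradient (productMetric (metricField gM)) (stdBasis m n) u X)
    (hI : Integrable (normSq gM X)
      (riemannianVolume (productMetric (metricField gM)) (stdBasis m n))) :
    ∃ X' : ∀ q : M × EuclideanSpace ℝ (Fin n), TangentSpace ((𝓡 m).prod (𝓡 n)) q,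
      HasWeakGradient (productMetric (metricField gM)) (stdBasis m n)
        (steiner fun q => |u q|) X' ∧
      Integrable (normSq gM X')
        (riemannianVolume (productMetric (metricField gM)) (stdBasis m n)) ∧
      ∫ q, normSq gM X' q ∂riemannianVolume (productMetric (metricField gM)) (stdBasis m n) ≤
        ∫ q, normSq gM X q ∂riemannianVolume (productMetric (metricField gM)) (stdBasis m n) := by
  rcases isEmpty_or_nonempty M with hM | hM
  · have hN : IsEmpty (M × EuclideanSpace ℝ (Fin n)) := inferInstance
    refine ⟨X, fun p => (hN.false p).elim, hI, le_rfl⟩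
  -- Countably many of the local pieces cover `M`. Their derivatives are glued to a weak gradient.
  choose B W hBo hBx hBΩ hW hd hen using fun x : M =>
    exists_local_steiner_gradient gM hn ((x, 0) : M × EuclideanSpace ℝ (Fin n)) hu hX hI
  set V : M → Set M := fun x =>
    (extChartAt (𝓡 m) x).source ∩ extChartAt (𝓡 m) x ⁻¹' B x with hV
  have hVo : ∀ x, IsOpen (V x) := fun x =>
    (continuousOn_extChartAt x).isOpen_inter_preimage (isOpen_extChartAt_source x) (hBo x)
  obtain ⟨s, hs, hcov⟩ := TopologicalSpace.countable_cover_nhds (f := V) fun x =>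
    (hVo x).mem_nhds ⟨mem_extChartAt_source x, hBx x⟩
  have hne : s.Nonempty := by
    by_contra h
    rw [Set.not_nonempty_iff_eq_empty] at h
    rw [h] at hcov
    simp only [Set.mem_empty_iff_false, Set.iUnion_of_empty, Set.iUnion_empty] at hcov
    exact Set.empty_ne_univ hcov
  obtain ⟨e, he⟩ := hs.exists_eq_range hne
  have hcov' : ∀ x : M, ∃ k, x ∈ V (e k) := by
    intro x
    have hx : x ∈ ⋃ y ∈ s, V y := hcov ▸ Set.mem_univ x
    rw [he, Set.biUnion_range] at hx
    exact Set.mem_iUnion.1 hx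
  have hsS : MemLp (steiner fun q => |u q|) 2
      (riemannianVolume (productMetric (metricField gM)) (stdBasis m n)) := by
    have := sFinite_riemannianVolume gM (EuclideanSpace.basisFun (Fin m) ℝ).toBasis
    rw [riemannianVolume_prod] at hu ⊢
    exact memLp_steiner hn hu.abs (.of_forall fun q => abs_nonneg _)
  obtain ⟨X', hX', hX'W⟩ := exists_hasWeakGradient_of_charts gM
    (fun p => locallyIntegrableOn_comp_symm gM p hsS) e (fun k => B (e k)) (fun k => W (e k))
    (fun k => hBo _) (fun k => hBΩ _) hcov' (fun k => hW _) fun k => hd _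
  have hXm := hX.aemeasurable_normSq gM
  have hX'm := hX'.aemeasurable_normSq gM
  -- Compare the energies over the sets of a partition which refines the cover.
  set D : ℕ → Set M := disjointed fun k => V (e k) with hD
  have hDm : ∀ k, MeasurableSet (D k) := fun k =>
    MeasurableSet.disjointed (fun k => (hVo _).measurableSet) k
  have hDV : ∀ k, D k ⊆ V (e k) := fun k => disjointed_subset _ k
  have hsum : ∀ h : M × EuclideanSpace ℝ (Fin n) → ℝ≥0∞,
      ∫⁻ q, h q ∂riemannianVolume (productMetric (metricField gM)) (stdBasis m n) =
      ∑' k, ∫⁻ q in D k ×ˢ Set.univ, h q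
        ∂riemannianVolume (productMetric (metricField gM)) (stdBasis m n) := by
    intro h
    rw [← lintegral_iUnion (fun k => (hDm k).prod .univ), ← Set.iUnion_prod_const,
      iUnion_disjointed, Set.iUnion_eq_univ_iff.2 hcov', Set.univ_prod_univ,
      Measure.restrict_univ]
    intro k l hkl
    exact Set.Disjoint.set_prod_left (disjoint_disjointed _ hkl) _ _
  have hle : ∫⁻ q, ENNReal.ofReal (normSq gM X' q)
      ∂riemannianVolume (productMetric (metricField gM)) (stdBasis m n) ≤
      ∫⁻ q, ENNReal.ofReal (normSq gM X q)
        ∂riemannianVolume (productMetric (metricField gM)) (stdBasis m n) := by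
    rw [hsum, hsum]
    refine ENNReal.tsum_le_tsum fun k => ?_
    have hDs : D k ⊆ (extChartAt (𝓡 m) (e k)).source := fun x hx => (hDV k hx).1
    rw [setLIntegral_normSq gM (e k, 0) (hDm k) hDs hXm,
      setLIntegral_normSq gM (e k, 0) (hDm k) hDs hX'm]
    have hA := measurableSet_inter_preimage_symm (I := 𝓡 m) (e k) (hDm k)
    have hAB : (extChartAt (𝓡 m) (e k)).target ∩ (extChartAt (𝓡 m) (e k)).symm ⁻¹' D k ⊆
        B (e k) := by
      rintro z ⟨hz, hzD⟩
      have := (hDV k hzD).2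
      rwa [Set.mem_preimage, (extChartAt (𝓡 m) (e k)).right_inv hz] at this
    refine le_trans (le_of_eq ?_) (hen (e k) _ hAB hA)
    refine setLIntegral_congr_fun_ae (hA.prod .univ) ?_
    filter_upwards [hX'W k] with z hz hzA
    simp only [energyDensity, bilinField, hz (hAB hzA.1)]
  have hfin := hI.lintegral_lt_top
  have hI' : Integrable (normSq gM X')
      (riemannianVolume (productMetric (metricField gM)) (stdBasis m n)) :=
    (lintegral_ofReal_ne_top_iff_integrable hX'm.aestronglyMeasurable
      (.of_forall fun q => normSq_nonneg gM X' q)).1 (hle.trans_lt hfin).ne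
  refine ⟨X', hX', hI', ?_⟩
  rw [integral_eq_lintegral_of_nonneg_ae (.of_forall fun q => normSq_nonneg gM X' q)
      hX'm.aestronglyMeasurable,
    integral_eq_lintegral_of_nonneg_ae (.of_forall fun q => normSq_nonneg gM X q)
      hXm.aestronglyMeasurable]
  exact ENNReal.toReal_mono hfin.ne hle

end Energy

/-! ### The scalar curvature of `M × ℝⁿ` and the Yamabe quotient -/

section Curvature

variable {E : Type*} [NormedAddCommGroup E] [NormedSpace ℝ E] {ι : Type*} [Fintype ι]
  [DecidableEq ι] (b : Module.Basis ι ℝ E)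

theorem partialD_congr {f f' : E → ℝ} {z : E} (h : f =ᶠ[𝓝 z] f') (i : ι) :
    partialD b i f z = partialD b i f' z := by
  rw [partialD, partialD, h.fderiv_eq]

/-- The Christoffel symbols depend on the germ of the metric only. -/
theorem christoffel_congr {G G' : E → Matrix ι ι ℝ} {z : E} (h : G =ᶠ[𝓝 z] G') (k i j : ι) :
    christoffel b G k i j =ᶠ[𝓝 z] christoffel b G' k i j := by
  filter_upwards [h.eventuallyEq_nhds] with w hw
  have hp : ∀ i j l, partialD b i (fun w => G w j l) w = partialD b i (fun w => G' w j l) w :=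
    fun i j l => partialD_congr b (hw.mono fun x hx => by simp only [hx]) i
  simp only [christoffel, hp, hw.eq_of_nhds]

/-- The Ricci curvature depends on the germ of the metric only. -/
theorem ricciCoord_congr {G G' : E → Matrix ι ι ℝ} {z : E} (h : G =ᶠ[𝓝 z] G') (j k : ι) :
    ricciCoord b G j k z = ricciCoord b G' j k z := by
  have hp : ∀ a i j k, partialD b a (christoffel b G i j k) z =
      partialD b a (christoffel b G' i j k) z := fun a i j k =>
    partialD_congr b (christoffel_congr b h i j k) a
  have hc : ∀ i j k, christoffel b G i j k z = christoffel b G' i j k z := fun i j k =>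
    (christoffel_congr b h i j k).eq_of_nhds
  simp only [ricciCoord, hp, hc]

theorem partialD_add {f : E → ℝ} {t : E} (h : ∀ z, f (z + t) = f z) (i : ι) (z : E) :
    partialD b i f (z + t) = partialD b i f z := by
  rw [partialD, partialD, ← fderiv_comp_add_right]
  simp only [h]

theorem christoffel_add {G : E → Matrix ι ι ℝ} {t : E} (h : ∀ z, G (z + t) = G z) (k i j : ι)
    (z : E) : christoffel b G k i j (z + t) = christoffel b G k i j z := by
  have hp : ∀ i j l, partialD b i (fun w => G w j l) (z + t) = partialD b i (fun w => G w j l) z :=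
    fun i j l => partialD_add b (fun w => by rw [h]) i z
  simp only [christoffel, hp, h]

/-- The Ricci curvature of a translation invariant metric is translation invariant. -/
theorem ricciCoord_add {G : E → Matrix ι ι ℝ} {t : E} (h : ∀ z, G (z + t) = G z) (j k : ι)
    (z : E) : ricciCoord b G j k (z + t) = ricciCoord b G j k z := by
  have hp : ∀ a i j k, partialD b a (christoffel b G i j k) (z + t) =
      partialD b a (christoffel b G i j k) z := fun a i j k =>
    partialD_add b (christoffel_add b h i j k) a z
  simp only [ricciCoord, hp, christoffel_add b h]

end Curvature

section Conclusion

variable {m n : ℕ} {M : Type*} [TopologicalSpace M] [ChartedSpace (EuclideanSpace ℝ (Fin m)) M]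
  [IsManifold (𝓡 m) ∞ M]
  (gM : ContMDiffRiemannianMetric (𝓡 m) ∞ (EuclideanSpace ℝ (Fin m))
      (fun x : M => TangentSpace (𝓡 m) x))

/-- The scalar curvature of `M × ℝⁿ` is a function on `M`. -/
theorem scalarCurvature_prod (x : M) (y : EuclideanSpace ℝ (Fin n)) :
    scalarCurvature (productMetric (metricField gM)) (stdBasis m n) (x, y) =
      scalarCurvature (productMetric (metricField gM)) (stdBasis m n)
        ((x, 0) : M × EuclideanSpace ℝ (Fin n)) := by
  set H : EuclideanSpace ℝ (Fin m) × EuclideanSpace ℝ (Fin n) →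
    Matrix (Fin m ⊕ Fin n) (Fin m ⊕ Fin n) ℝ := fun z => splitMatrix n (stdGram gM x z.1) 1 with hH
  have hG : ∀ y : EuclideanSpace ℝ (Fin n), ∀ z ∈ (extChartAt ((𝓡 m).prod (𝓡 n)) (x, y)).target,
      gramMatrix (productMetric (metricField gM)) (stdBasis m n) (x, y) z = H z := fun y z hz =>
    gramMatrix_prod gM (x, y) hz
  have key : ∀ y : EuclideanSpace ℝ (Fin n),
      scalarCurvature (productMetric (metricField gM)) (stdBasis m n) (x, y) =
        ∑ j, ∑ k, (H (extChartAt (𝓡 m) x x, 0))⁻¹ j k *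
          ricciCoord (stdBasis m n) H j k (extChartAt (𝓡 m) x x, 0) := by
    intro y
    have hz := mem_extChartAt_target (I := (𝓡 m).prod (𝓡 n)) (x, y)
    have hev : gramMatrix (productMetric (metricField gM)) (stdBasis m n) (x, y)
        =ᶠ[𝓝 (extChartAt ((𝓡 m).prod (𝓡 n)) (x, y) (x, y))] H := by
      filter_upwards [(isOpen_extChartAt_target (I := (𝓡 m).prod (𝓡 n)) (x, y)).mem_nhds hz]
        with z hz using hG y z hz
    -- The charts at `(x, y)` and `(x, 0)` are the same, and the metric is invariant under
    -- translations in `y`.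
    have hpt : extChartAt ((𝓡 m).prod (𝓡 n)) (x, y) (x, y) =
        (extChartAt (𝓡 m) x x, 0) + (0, y) := by
      rw [extChartAt_prod_apply]
      simp
    have hinv : ∀ z, H (z + (0, y)) = H z := fun z => by simp [hH]
    simp only [scalarCurvature, ricciCoord_congr (stdBasis m n) hev, hev.eq_of_nhds]
    rw [hpt]
    simp only [ricciCoord_add (stdBasis m n) hinv, hinv]
  rw [key, key]

variable [MeasurableSpace M] [BorelSpace M] [SecondCountableTopology M]

/-- A function which agrees almost everywhere with the Steiner symmetrization of `|u|` is a better
competitor for the Yamabe quotient than `u`. -/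
theorem yamabeQuotient_le_of_ae_eq_steiner (hn : 1 ≤ n) {a s : ℝ} (ha : 0 ≤ a) (hs : 0 < s)
    {u v : M × EuclideanSpace ℝ (Fin n) → ℝ}
    (hu : MemSobolev (productMetric (metricField gM)) (stdBasis m n) u)
    (hu0 : ¬ u =ᵐ[riemannianVolume (productMetric (metricField gM)) (stdBasis m n)] 0)
    (hv : v =ᵐ[riemannianVolume (productMetric (metricField gM)) (stdBasis m n)]
      steiner fun q => |u q|) :
    MemSobolev (productMetric (metricField gM)) (stdBasis m n) v ∧
    0 ≤ᵐ[riemannianVolume (productMetric (metricField gM)) (stdBasis m n)] v ∧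
    ¬ v =ᵐ[riemannianVolume (productMetric (metricField gM)) (stdBasis m n)] 0 ∧
    yamabeQuotient (productMetric (metricField gM)) (stdBasis m n) a s v ≤
      yamabeQuotient (productMetric (metricField gM)) (stdBasis m n) a s u := by
  obtain ⟨huL, X, hX, hI⟩ := hu
  obtain ⟨X', hX', hI', hle⟩ := exists_steiner_gradient gM hn huL hX hI
  have hvX' := HasWeakGradient.congr_ae gM hX' hv.symm
  have hgv := integral_congr_ae (normSq_weakGradient_ae_eq gM hvX')
  have hgu := integral_congr_ae (normSq_weakGradient_ae_eq gM hX)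
  have := sFinite_riemannianVolume gM (EuclideanSpace.basisFun (Fin m) ℝ).toBasis
  have hvol := riemannianVolume_prod (n := n) gM
  set μ := riemannianVolume (productMetric (metricField gM)) (stdBasis m n) with hμ
  have habs : 0 ≤ᵐ[μ] fun q => |u q| := .of_forall fun q => abs_nonneg _
  have huA : MemLp (fun q => |u q|) 2 μ := huL.abs
  have hSL : MemLp (steiner fun q => |u q|) 2 μ := by
    rw [hvol] at huA habs ⊢
    exact memLp_steiner hn huA habs
  have hS0 : 0 ≤ᵐ[μ] steiner fun q => |u q| := by
    rw [hvol] at huA habs ⊢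
    exact steiner_ae_nonneg hn huA habs
  have hsq : ∀ h : M → ℝ, ∫ q, h q.1 * v q ^ 2 ∂μ = ∫ q, h q.1 * u q ^ 2 ∂μ := by
    intro h
    have h1 : ∫ q, h q.1 * steiner (fun q => |u q|) q ^ 2 ∂μ = ∫ q, h q.1 * |u q| ^ 2 ∂μ := by
      rw [hvol] at huA habs ⊢
      exact integral_mul_steiner_sq hn huA habs h
    simp only [sq_abs] at h1
    rw [← h1]
    refine integral_congr_ae ?_
    filter_upwards [hv] with q hq
    rw [hq]
  have hpow : ∫ q, |v q| ^ s ∂μ = ∫ q, |u q| ^ s ∂μ := by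
    have h1 : ∫ q, |steiner (fun q => |u q|) q| ^ s ∂μ = ∫ q, |(|u q|)| ^ s ∂μ := by
      rw [hvol] at huA habs ⊢
      exact integral_abs_steiner_rpow hn huA habs hs
    simp only [abs_abs] at h1
    rw [← h1]
    refine integral_congr_ae ?_
    filter_upwards [hv] with q hq
    rw [hq]
  refine ⟨⟨hSL.ae_eq hv.symm, X', hvX', hI'⟩, hS0.trans hv.symm.le, fun h0 => hu0 ?_, ?_⟩
  · have h1 := hsq fun _ => 1
    simp only [one_mul] at h1
    have h2 : ∫ q, v q ^ 2 ∂μ = 0 := by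
      rw [integral_congr_ae (g := fun _ => 0) (by filter_upwards [h0] with q hq; simp [hq])]
      simp
    rw [h2] at h1
    have h3 := (integral_eq_zero_iff_of_nonneg (fun q => sq_nonneg (u q)) huL.integrable_sq).1
      h1.symm
    filter_upwards [h3] with q hq
    exact pow_eq_zero_iff two_ne_zero |>.1 hq
  · have hscal : ∀ w : M × EuclideanSpace ℝ (Fin n) → ℝ,
        ∫ q, scalarCurvature (productMetric (metricField gM)) (stdBasis m n) q * w q ^ 2 ∂μ =
          ∫ q, scalarCurvature (productMetric (metricField gM)) (stdBasis m n)
            ((q.1, 0) : M × EuclideanSpace ℝ (Fin n)) * w q ^ 2 ∂μ := fun w =>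
      integral_congr_ae (.of_forall fun q => by
        change scalarCurvature _ _ (q.1, q.2) * _ = _
        rw [scalarCurvature_prod gM q.1 q.2])
    have hnum : ∀ w : M × EuclideanSpace ℝ (Fin n) → ℝ,
        yamabeQuotient (productMetric (metricField gM)) (stdBasis m n) a s w =
        (a * ∫ q, normSq gM (weakGradient (productMetric (metricField gM)) (stdBasis m n) w) q ∂μ
          + ∫ q, scalarCurvature (productMetric (metricField gM)) (stdBasis m n)
            ((q.1, 0) : M × EuclideanSpace ℝ (Fin n)) * w q ^ 2 ∂μ) /
              (∫ q, |w q| ^ s ∂μ) ^ (2 / s) := fun w => by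
      rw [← hscal]
      rfl
    rw [hnum, hnum, hgv, hgu, hpow, hsq fun x => scalarCurvature _ _ (x, 0)]
    refine div_le_div_of_nonneg_right ?_ (Real.rpow_nonneg (integral_nonneg fun q =>
      Real.rpow_nonneg (abs_nonneg _) _) _)
    gcongr

end Conclusion

end SteinerSymmetrization

theorem corollary2 {m n : ℕ} (hn : 1 ≤ n) (hmn : 3 ≤ m + n)
    {M : Type*} [TopologicalSpace M] [ChartedSpace (EuclideanSpace ℝ (Fin m)) M]
    [IsManifold (𝓡 m) ∞ M] [CompactSpace M] [T2Space M] [MeasurableSpace M] [BorelSpace M]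
    (gM : ContMDiffRiemannianMetric (𝓡 m) ∞ (EuclideanSpace ℝ (Fin m))
      (fun x : M => TangentSpace (𝓡 m) x))
    (g : MetricField ((𝓡 m).prod (𝓡 n)) (M × EuclideanSpace ℝ (Fin n)))
    (hg : g = productMetric fun x v w => gM.inner x v w)
    (a p : ℝ) (ha : a = 4 * ((m : ℝ) + n - 1) / ((m : ℝ) + n - 2))
    (hp : p = 2 * ((m : ℝ) + n) / ((m : ℝ) + n - 2))
    (s : ℝ) (hs : 2 ≤ s) (hsp : s ≤ p) :
    (∀ u : M × EuclideanSpace ℝ (Fin n) → ℝ,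
      MemSobolev g (stdBasis m n) u →
      0 ≤ᵐ[riemannianVolume g (stdBasis m n)] u →
      ¬ u =ᵐ[riemannianVolume g (stdBasis m n)] 0 →
        MemSobolev g (stdBasis m n) (steiner u) ∧
        0 ≤ᵐ[riemannianVolume g (stdBasis m n)] steiner u ∧
        ¬ steiner u =ᵐ[riemannianVolume g (stdBasis m n)] 0 ∧
        yamabeQuotient g (stdBasis m n) a s (steiner u) ≤ yamabeQuotient g (stdBasis m n) a s u) ∧
    (∀ u : M × EuclideanSpace ℝ (Fin n) → ℝ,
      IsYamabeMinimizer g (stdBasis m n) a s u →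
        IsYamabeMinimizer g (stdBasis m n) a s (steiner fun q => |u q|) ∧
        0 ≤ᵐ[riemannianVolume g (stdBasis m n)] (steiner fun q => |u q|) ∧
        IsRadial (steiner fun q => |u q|)) := by
  have hgm : g = productMetric (metricField gM) := hg
  subst hgm
  have : SecondCountableTopology M :=
    ChartedSpace.secondCountable_of_sigmaCompact (EuclideanSpace ℝ (Fin m)) M
  have hmn' : (3 : ℝ) ≤ (m : ℝ) + n := by exact_mod_cast hmn
  have ha0 : 0 ≤ a := by
    rw [ha]
    exact div_nonneg (by linarith) (by linarith)
  have hs0 : 0 < s := by linarith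
  refine ⟨fun u hu hu0 hne => ?_, fun u hu => ?_⟩
  · refine yamabeQuotient_le_of_ae_eq_steiner gM hn ha0 hs0 hu hne ?_
    have := sFinite_riemannianVolume gM (EuclideanSpace.basisFun (Fin m) ℝ).toBasis
    rw [riemannianVolume_prod] at hu0 ⊢
    refine steiner_congr_ae hn ?_
    filter_upwards [hu0] with q hq
    exact (abs_of_nonneg hq).symm
  · obtain ⟨h1, h2, h3, h4⟩ := yamabeQuotient_le_of_ae_eq_steiner gM hn ha0 hs0 hu.1 hu.2.1
      (ae_eq_refl (steiner fun q => |u q|))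
    exact ⟨⟨h1, h3, fun v hv hv0 => h4.trans (hu.2.2 v hv hv0)⟩, h2, isRadial_steiner hn _⟩
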